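/- Let $n,m\ge 1$, let $\Lambda=\mathrm{diag}(-I_n,I_m)$ and $U(n,m)=\{\Phi\in GL_{n+m}(\mathbb C):\Phi^*\Lambda\Phi=\Lambda\}$, with the left invariant metric given on its Lie algebra $\mathfrak u(n,m)$ by $\langle A,B\rangle=\tfrac12\mathrm{Re}\,\mathrm{Tr}(A^*B)$. Give $U(n,m)/U(m)$ and $D_{n,m}=U(n,m)/(U(n)\times U(m))$ the metrics for which the projections $\hat\pi:U(n,m)\to U(n,m)/U(m)$, $\tilde\pi:U(n,m)\to D_{n,m}$ and the principal $U(n)$-bundle $\pi:U(n,m)/U(m)\to D_{n,m}$ are Riemannian submersions; here $h\in U(n)$ acts by $gU(m)\cdot h=g\,\mathrm{diag}(h,I_m)\,U(m)$. For $X\in M_{m\times n}(\mathbb C)$ put $\widehat X=\begin{pmatrix}0&X^*\\X&0\end{pmatrix}$. For $X\neq 0$ put $W=X/|\widehat X|$, where $|\cdot|$ is the norm of $\langle\cdot,\cdot\rangle$, and $\tilde S=\{e^{\widehat{wW}}:w\in\mathbb C\}\subset U(n,m)$. For $g\in U(n,m)$ let $S=\tilde\pi(g\tilde S)$, a surface in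 $D_{n,m}$ with complex coordinate $w$ (the point with coordinate $w$ is $\tilde\pi(ge^{\widehat{wW}})$), oriented by this coordinate. Let $\omega_{(X,g)}$ be the 2-form on $S$ with $$\omega_{(X,g)}(\tilde\pi_*x,\tilde\pi_*y)=\det\begin{pmatrix}\langle g_1^{-1}x,\widehat W\rangle&\langle g_1^{-1}y,\widehat W\rangle\\ \langle g_1^{-1}x,\widehat{iW}\rangle&\langle g_1^{-1}y,\widehat{iW}\rangle\end{pmatrix}$$ for $x,y$ tangent to $g\tilde S$ at $g_1$. Let $c:[0,1]\to S$ be a smooth, simple, closed, orientation-preserving curve (that is, it runs positively around the region on $S$ that it surrounds), and let $\hat c:[0,1]\to U(n,m)/U(m)$ be a horizontal lift of $c$. Let $\mathrm{Area}(c)$ be the area, with respect to $\omega_{(X,g)}$, of the region on $S$ surrounded by $c$, and let $A(c)$ be its area with respect to the metric induced on $S$ from $D_{n,m}$. Suppose that $X^*X$ has exactly one positive eigenvalue and that its algebraic multiplicity is $q$. Then: (a) $\mathrm{Area}(c)=A(c)$. (b) There is an $h\in U(n)$ with $\hat c(0)\in\hat\pi(g\tilde S)\cdot h$ (with $h=I_n$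 if $\hat c$ starts on $\hat\pi(g\tilde S)$). For such an $h$ there is a matrix $\Psi\in\mathfrak u(n)$ such that $$h\Psi h^{*}\in\mathrm{Span}_{\mathbb R}\{i(X^*X)^k\}_{k=1}^{\mathrm{rk}X},\qquad \hat c(1)=\hat c(0)\cdot e^{\Psi},\qquad \mathrm{Tr}(\Psi)=2i\,\mathrm{Area}(c),$$ and every such $\Psi$ satisfies, for some $A\in U(n)$, $$\Psi=A\,\mathrm{diag}\big[\underbrace{\tfrac{2i}{q}\mathrm{Area}(c),\dots,\tfrac{2i}{q}\mathrm{Area}(c)}_{q},\underbrace{0,\dots,0}_{n-q}\big]A^*=A\,\mathrm{diag}\big[\underbrace{\tfrac{2i}{q}A(c),\dots,\tfrac{2i}{q}A(c)}_{q},\underbrace{0,\dots,0}_{n-q}\big]A^*.$$ (c) If $q=n$, then $X^*X=\lambda I_n$ for some $\lambda\in\mathbb C\setminus\{0\}$ (that is, $X\in U_{m,n}(\mathbb C)$), $S$ is totally geodesic in $D_{n,m}$, and $e^{\Psi}=e^{i\theta}I_n$ with $\theta=\tfrac2n\mathrm{Area}(c)=\tfrac2nA(c)$ for every $\Psi$ as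 in (b). -/

import Mathlib

open scoped Matrix ContDiff Matrix.Norms.L2Operator

namespace Holonomy

noncomputable section

/-! ### The group `U(n,m)` and its subgroups -/

/-- Square complex matrices of size `n + m`, in block form. -/
abbrev Mat (n m : ℕ) : Type := Matrix (Fin n ⊕ Fin m) (Fin n ⊕ Fin m) ℂ

/-- The matrix `diag(-I_n, I_m)` of the Hermitian form `F`. -/
def Lam (n m : ℕ) : Mat n m := Matrix.fromBlocks (-1) 0 0 1

/-- The indefinite unitary group `U(n,m)`. -/
def U (n m : ℕ) : Subgroup (Matrix.GeneralLinearGroup (Fin n ⊕ Fin m) ℂ) where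
  carrier := {Φ | (Φ : Mat n m)ᴴ * Lam n m * (Φ : Mat n m) = Lam n m}
  one_mem' := by simp
  mul_mem' := by
    intro a b ha hb
    simp only [Set.mem_ofPred_eq, Units.val_mul, Matrix.conjTranspose_mul] at *
    calc (b : Mat n m)ᴴ * (a : Mat n m)ᴴ * Lam n m * ((a : Mat n m) * (b : Mat n m))
        = (b : Mat n m)ᴴ * ((a : Mat n m)ᴴ * Lam n m * (a : Mat n m)) * (b : Mat n m) := by
          simp only [Matrix.mul_assoc]
      _ = Lam n m := by rw [ha, hb]
  inv_mem' := by
    intro a ha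
    simp only [Set.mem_ofPred_eq] at *
    have h1 : (a : Mat n m) * ((a⁻¹ : Matrix.GeneralLinearGroup (Fin n ⊕ Fin m) ℂ) : Mat n m) = 1 :=
      Units.mul_inv a
    have h2 : ((a⁻¹ : Matrix.GeneralLinearGroup (Fin n ⊕ Fin m) ℂ) : Mat n m)ᴴ
        * (a : Mat n m)ᴴ = 1 := by
      rw [← Matrix.conjTranspose_mul, h1, Matrix.conjTranspose_one]
    set b := ((a⁻¹ : Matrix.GeneralLinearGroup (Fin n ⊕ Fin m) ℂ) : Mat n m)
    calc bᴴ * Lam n m * b = bᴴ * ((a : Mat n m)ᴴ * Lam n m * (a : Mat n m)) * b := by rw [ha]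
      _ = (bᴴ * (a : Mat n m)ᴴ) * Lam n m * ((a : Mat n m) * b) := by
          simp only [Matrix.mul_assoc]
      _ = Lam n m := by rw [h1, h2]; simp

/-- The underlying matrix of an element of `U(n,m)`. -/
abbrev mat {n m : ℕ} (g : U n m) : Mat n m :=
  ((g : Matrix.GeneralLinearGroup (Fin n ⊕ Fin m) ℂ) : Mat n m)

/-- The embedding `(h, k) ↦ diag(h, k)` of `U(n) × U(m)` in `U(n,m)`. -/
def blockHom (n m : ℕ) :
    Matrix.unitaryGroup (Fin n) ℂ × Matrix.unitaryGroup (Fin m) ℂ →* U n m where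
  toFun p := ⟨⟨Matrix.fromBlocks p.1 0 0 p.2, Matrix.fromBlocks (star p.1) 0 0 (star p.2),
      by simp [Matrix.fromBlocks_multiply], by simp [Matrix.fromBlocks_multiply]⟩, by
    have h1 : ((p.1 : Matrix (Fin n) (Fin n) ℂ))ᴴ * (p.1 : Matrix (Fin n) (Fin n) ℂ) = 1 :=
      Matrix.mem_unitaryGroup_iff'.1 p.1.2
    have h2 : ((p.2 : Matrix (Fin m) (Fin m) ℂ))ᴴ * (p.2 : Matrix (Fin m) (Fin m) ℂ) = 1 :=
      Matrix.mem_unitaryGroup_iff'.1 p.2.2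
    simp [U, Lam, Matrix.fromBlocks_conjTranspose, Matrix.fromBlocks_multiply, h1, h2]⟩
  map_one' := by
    apply Subtype.ext; apply Units.ext; simp
  map_mul' := by
    intro p q
    apply Subtype.ext; apply Units.ext; simp [Matrix.fromBlocks_multiply]

/-- `h ↦ diag(h, I_m)`. -/
def leftHom (n m : ℕ) : Matrix.unitaryGroup (Fin n) ℂ →* U n m :=
  (blockHom n m).comp (MonoidHom.inl _ _)

/-- `k ↦ diag(I_n, k)`. -/
def rightHom (n m : ℕ) : Matrix.unitaryGroup (Fin m) ℂ →* U n m :=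
  (blockHom n m).comp (MonoidHom.inr _ _)

/-- The subgroup `U(n) × U(m)` of `U(n,m)`. -/
def subUU (n m : ℕ) : Subgroup (U n m) := (blockHom n m).range

/-- The subgroup `U(m)` of `U(n,m)`. -/
def subU (n m : ℕ) : Subgroup (U n m) := (rightHom n m).range

theorem subU_le (n m : ℕ) : subU n m ≤ subUU n m := by
  rintro _ ⟨k, rfl⟩
  exact ⟨(1, k), rfl⟩

/-! ### The bundle `U(n) → U(n,m)/U(m) → D_{n,m}` -/

/-- The base space `D_{n,m} = U(n,m)/(U(n) × U(m))`. -/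
abbrev D (n m : ℕ) : Type := U n m ⧸ subUU n m

/-- The total space `U(n,m)/U(m)`. -/
abbrev Total (n m : ℕ) : Type := U n m ⧸ subU n m

/-- The projection of `U(n,m)` onto `D_{n,m}`. -/
def projD {n m : ℕ} (g : U n m) : D n m := QuotientGroup.mk g

/-- The projection of `U(n,m)` onto `U(n,m)/U(m)`. -/
def projTotal {n m : ℕ} (g : U n m) : Total n m := QuotientGroup.mk g

/-- The bundle projection `U(n,m)/U(m) → D_{n,m}`. -/
def bundleProj {n m : ℕ} : Total n m → D n m := Subgroup.quotientMapOfLE (subU_le n m)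

/-- The right action `gU(m) · h = (g diag(h, I_m))U(m)` of `U(n)` on `U(n,m)/U(m)`. -/
def rightAct {n m : ℕ} (p : Total n m) (h : Matrix.unitaryGroup (Fin n) ℂ) : Total n m :=
  Quotient.liftOn' p (fun g => projTotal (g * leftHom n m h)) (by
    intro a b hab
    rw [QuotientGroup.leftRel_apply] at hab
    obtain ⟨k, hk⟩ := hab
    apply QuotientGroup.eq.2
    refine ⟨k, ?_⟩
    have hcomm : rightHom n m k * leftHom n m h = leftHom n m h * rightHom n m k := by
      simp [rightHom, leftHom, ← map_mul]
    rw [mul_inv_rev, mul_assoc, ← mul_assoc a⁻¹, ← hk, hcomm, inv_mul_cancel_left])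

/-! ### The metric -/

/-- The inner product `⟨A, B⟩ = ½ Re Tr(A*B)`. -/
def ip {n m : ℕ} (A B : Mat n m) : ℝ := (1 / 2) * (Matrix.trace (Aᴴ * B)).re

/-- The element `[[0, X*], [X, 0]]` of `𝔪 ⊆ 𝔲(n,m)`. -/
def hat {n m : ℕ} (X : Matrix (Fin m) (Fin n) ℂ) : Mat n m := Matrix.fromBlocks 0 Xᴴ X 0

theorem exp_hat_mul_Lam {n m : ℕ} (X : Matrix (Fin m) (Fin n) ℂ) :
    (NormedSpace.exp (hat X))ᴴ * Lam n m * NormedSpace.exp (hat X) = Lam n m := by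
  have hLL : Lam n m * Lam n m = 1 := by
    simp [Lam, Matrix.fromBlocks_multiply]
  have hu : IsUnit (Lam n m) := IsUnit.of_mul_eq_one _ hLL
  have hinv : (Lam n m)⁻¹ = Lam n m := Matrix.inv_eq_right_inv hLL
  have hH : (hat X)ᴴ = hat X := by simp [hat, Matrix.fromBlocks_conjTranspose]
  have hc : Lam n m * hat X * (Lam n m)⁻¹ = -hat X := by
    rw [hinv]; simp [Lam, hat, Matrix.fromBlocks_multiply, Matrix.fromBlocks_neg]
  have h1 := Matrix.exp_conj (Lam n m) (hat X) hu
  rw [hc, hinv] at h1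
  have h2 : NormedSpace.exp (hat X) * NormedSpace.exp (-hat X) = 1 := by
    rw [← Matrix.exp_add_of_commute _ _ ((Commute.refl (hat X)).neg_right)]; simp
  rw [← Matrix.exp_conjTranspose, hH]
  calc NormedSpace.exp (hat X) * Lam n m * NormedSpace.exp (hat X)
      = NormedSpace.exp (hat X) * (Lam n m * NormedSpace.exp (hat X) * Lam n m) * Lam n m := by
        simp only [Matrix.mul_assoc, hLL, Matrix.mul_one]
    _ = Lam n m := by rw [← h1, h2, Matrix.one_mul]

/-- The exponential of `hat X`, as an element of `U(n,m)`. -/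
def expHat {n m : ℕ} (X : Matrix (Fin m) (Fin n) ℂ) : U n m :=
  ⟨⟨NormedSpace.exp (hat X), NormedSpace.exp (-hat X),
    by rw [← Matrix.exp_add_of_commute _ _ ((Commute.refl (hat X)).neg_right)]; simp,
    by rw [← Matrix.exp_add_of_commute _ _ ((Commute.refl (hat X)).neg_left)]; simp⟩,
   exp_hat_mul_Lam X⟩

/-- The global chart of `D_{n,m}`: the class of `[[a, b], [c, d]]` has the coordinate `c a⁻¹`.
It identifies `D_{n,m}` with the bounded domain `{Z : I - Z*Z > 0}` of `M_{m×n}(ℂ)`. -/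
def coord {n m : ℕ} (p : D n m) : Matrix (Fin m) (Fin n) ℂ :=
  Quotient.liftOn' p (fun g => (mat g).toBlocks₂₁ * ((mat g).toBlocks₁₁)⁻¹) (by
    intro a b hab
    rw [QuotientGroup.leftRel_apply] at hab
    obtain ⟨⟨h, k⟩, hk⟩ := hab
    have hb : b = a * blockHom n m (h, k) := by rw [hk, mul_inv_cancel_left]
    have hm : mat b = mat a * Matrix.fromBlocks (h : Matrix (Fin n) (Fin n) ℂ) 0 0
        (k : Matrix (Fin m) (Fin m) ℂ) := by rw [hb]; rfl
    have hh : (h : Matrix (Fin n) (Fin n) ℂ) * (h : Matrix (Fin n) (Fin n) ℂ)⁻¹ = 1 := by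
      apply Matrix.mul_nonsing_inv
      apply (Matrix.isUnit_iff_isUnit_det _).1
      exact IsUnit.of_mul_eq_one _ (Matrix.mem_unitaryGroup_iff.1 h.2)
    have e : mat a = Matrix.fromBlocks (mat a).toBlocks₁₁ (mat a).toBlocks₁₂
        (mat a).toBlocks₂₁ (mat a).toBlocks₂₂ := (Matrix.fromBlocks_toBlocks _).symm
    rw [e, Matrix.fromBlocks_multiply] at hm
    simp only [hm, Matrix.toBlocks_fromBlocks₁₁, Matrix.toBlocks_fromBlocks₂₁,
      Matrix.mul_zero, add_zero, Matrix.mul_inv_rev]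
    rw [Matrix.mul_assoc, ← Matrix.mul_assoc (h : Matrix (Fin n) (Fin n) ℂ), hh, Matrix.one_mul])

/-- The Riemannian metric of `D_{n,m}` in the global chart, at the point with coordinate `Z`.
By `coord_submersion` and `metricD_submersion` below it is the one that makes
`U(n,m) → D_{n,m}` a Riemannian submersion. -/
def metricD {n m : ℕ} (Z V V' : Matrix (Fin m) (Fin n) ℂ) : ℝ :=
  (Matrix.trace ((1 - Zᴴ * Z)⁻¹ * Vᴴ * (1 - Z * Zᴴ)⁻¹ * V')).re

open scoped ComplexOrder in
theorem block_facts {n m : ℕ} (g : U n m) :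
    IsUnit (mat g).toBlocks₁₁ ∧ IsUnit (mat g).toBlocks₂₂ ∧
    (1 - (coord (projD g))ᴴ * coord (projD g))⁻¹ = (mat g).toBlocks₁₁ * ((mat g).toBlocks₁₁)ᴴ ∧
    (1 - coord (projD g) * (coord (projD g))ᴴ)⁻¹ = (mat g).toBlocks₂₂ * ((mat g).toBlocks₂₂)ᴴ ∧
    (mat g).toBlocks₂₂ - coord (projD g) * (mat g).toBlocks₁₂ =
      (((mat g).toBlocks₂₂)ᴴ)⁻¹ := by
  have hg : (mat g)ᴴ * Lam n m * mat g = Lam n m := g.2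
  have hZ : coord (projD g) = (mat g).toBlocks₂₁ * ((mat g).toBlocks₁₁)⁻¹ := rfl
  rw [hZ]
  have e : mat g = Matrix.fromBlocks (mat g).toBlocks₁₁ (mat g).toBlocks₁₂
        (mat g).toBlocks₂₁ (mat g).toBlocks₂₂ := (Matrix.fromBlocks_toBlocks _).symm
  rw [e] at hg
  generalize (mat g).toBlocks₁₁ = a at *
  generalize (mat g).toBlocks₁₂ = b at *
  generalize (mat g).toBlocks₂₁ = c at *
  generalize (mat g).toBlocks₂₂ = d at *
  simp only [Lam, Matrix.fromBlocks_conjTranspose, Matrix.fromBlocks_multiply,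
    Matrix.fromBlocks_inj, Matrix.mul_zero, Matrix.mul_neg, Matrix.mul_one, add_zero, zero_add,
    Matrix.neg_mul] at hg
  obtain ⟨h1, h2, -, h4⟩ := hg
  have ha2 : aᴴ * a = 1 + cᴴ * c := by
    rw [← sub_eq_zero] at h1 ⊢; rw [← neg_eq_zero, ← h1]; abel
  have hd2 : dᴴ * d = 1 + bᴴ * b := by
    rw [← sub_eq_zero] at h4 ⊢; rw [← h4]; abel
  have hab : aᴴ * b = cᴴ * d := by
    rw [← sub_eq_zero, ← neg_eq_zero, ← h2]; abel
  have ua : IsUnit a := by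
    have hp : (aᴴ * a).PosDef := by
      rw [ha2]; exact Matrix.PosDef.one.add_posSemidef (Matrix.posSemidef_conjTranspose_mul_self c)
    have := hp.isUnit
    rw [Matrix.isUnit_iff_isUnit_det, Matrix.det_mul] at this
    exact (Matrix.isUnit_iff_isUnit_det _).2 (isUnit_of_mul_isUnit_right this)
  have ud : IsUnit d := by
    have hp : (dᴴ * d).PosDef := by
      rw [hd2]; exact Matrix.PosDef.one.add_posSemidef (Matrix.posSemidef_conjTranspose_mul_self b)
    have := hp.isUnit
    rw [Matrix.isUnit_iff_isUnit_det, Matrix.det_mul] at this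
    exact (Matrix.isUnit_iff_isUnit_det _).2 (isUnit_of_mul_isUnit_right this)
  have ada := (Matrix.isUnit_iff_isUnit_det _).1 ua
  have add := (Matrix.isUnit_iff_isUnit_det _).1 ud
  have aa : a⁻¹ * a = 1 := Matrix.nonsing_inv_mul _ ada
  have aa' : a * a⁻¹ = 1 := Matrix.mul_nonsing_inv _ ada
  have aaH : (a⁻¹)ᴴ * aᴴ = 1 := by rw [← Matrix.conjTranspose_mul, aa', Matrix.conjTranspose_one]
  have aaH' : aᴴ * (a⁻¹)ᴴ = 1 := by rw [← Matrix.conjTranspose_mul, aa, Matrix.conjTranspose_one]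
  have ddH : (d⁻¹)ᴴ * dᴴ = 1 := by
    rw [← Matrix.conjTranspose_mul, Matrix.mul_nonsing_inv _ add, Matrix.conjTranspose_one]
  set Z := c * a⁻¹ with hZd
  have hb : b = Zᴴ * d := by
    rw [hZd, Matrix.conjTranspose_mul, Matrix.mul_assoc, ← hab, ← Matrix.mul_assoc, aaH,
      Matrix.one_mul]
  have hZZ : 1 - Zᴴ * Z = (a⁻¹)ᴴ * a⁻¹ := by
    have : cᴴ * c = aᴴ * a - 1 := by rw [ha2]; abel
    rw [hZd, Matrix.conjTranspose_mul, ← Matrix.mul_assoc, Matrix.mul_assoc _ cᴴ c, this,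
      Matrix.mul_sub, ← Matrix.mul_assoc, aaH, Matrix.sub_mul, Matrix.one_mul, aa',
      Matrix.mul_one, sub_sub_cancel]
  have hdd : dᴴ * ((1 - Z * Zᴴ) * d) = 1 := by
    have : bᴴ * b = dᴴ * (Z * Zᴴ) * d := by
      rw [hb, Matrix.conjTranspose_mul, Matrix.conjTranspose_conjTranspose]
      simp only [Matrix.mul_assoc]
    rw [this] at hd2
    rw [Matrix.sub_mul, Matrix.one_mul, Matrix.mul_sub, hd2, Matrix.mul_assoc dᴴ,
      add_sub_cancel_right]
  refine ⟨ua, ud, ?_, ?_, ?_⟩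
  · apply Matrix.inv_eq_right_inv
    rw [hZZ, Matrix.mul_assoc, ← Matrix.mul_assoc a⁻¹, aa, Matrix.one_mul, aaH]
  · apply Matrix.inv_eq_left_inv
    have := mul_eq_one_comm.1 hdd
    rw [Matrix.mul_assoc] at this
    exact mul_eq_one_comm.1 this
  · have hs : d - Z * b = (1 - Z * Zᴴ) * d := by
      rw [hb, Matrix.sub_mul, Matrix.one_mul, Matrix.mul_assoc Z]
    rw [hs]
    exact (Matrix.inv_eq_right_inv hdd).symm

/-- The differential of `U(n,m) → D_{n,m}` at `g = [[a, b], [c, d]]`, in the global chart,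
on the horizontal vector `g · hat X`. -/
theorem coord_submersion {n m : ℕ} (g : U n m) (X : Matrix (Fin m) (Fin n) ℂ) :
    HasDerivAt (fun t : ℝ => coord (projD (g * expHat (t • X))))
      ((((mat g).toBlocks₂₂)ᴴ)⁻¹ * X * ((mat g).toBlocks₁₁)⁻¹) 0 := by
  obtain ⟨ua, -, -, -, h5⟩ := block_facts g
  let L1 : Mat n m →ₗ[ℝ] Matrix (Fin n) (Fin n) ℂ :=
    { toFun := Matrix.toBlocks₁₁, map_add' := fun _ _ => rfl, map_smul' := fun _ _ => rfl }
  let L2 : Mat n m →ₗ[ℝ] Matrix (Fin m) (Fin n) ℂ :=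
    { toFun := Matrix.toBlocks₂₁, map_add' := fun _ _ => rfl, map_smul' := fun _ _ => rfl }
  let J : Matrix (Fin n) (Fin n) ℂ →ₗ[ℝ] Mat n m :=
    { toFun := fun A => Matrix.fromBlocks A 0 0 0
      map_add' := fun _ _ => by simp [Matrix.fromBlocks_add]
      map_smul' := fun _ _ => by simp [Matrix.fromBlocks_smul] }
  let P : ℝ → Mat n m := fun t => mat g * NormedSpace.exp (t • hat X)
  have hP0 : P 0 = mat g := by simp [P]
  have hP : HasDerivAt P (mat g * hat X) 0 := by
    have := (hasDerivAt_exp_smul_const (𝕂 := ℝ) (hat X) (0 : ℝ)).const_mul (mat g)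
    simpa using this
  have hfun : ∀ t : ℝ, coord (projD (g * expHat (t • X))) =
      L2 (P t * J (Ring.inverse (L1 (P t)))) := by
    intro t
    have hsm : (hat (t • X) : Mat n m) = t • hat X := by
      simp [hat, Matrix.fromBlocks_smul, Matrix.conjTranspose_smul]
    have hPt : mat (g * expHat (t • X)) = P t := by
      simp only [P, ← hsm]; rfl
    have hc : coord (projD (g * expHat (t • X))) =
      (mat (g * expHat (t • X))).toBlocks₂₁ * ((mat (g * expHat (t • X))).toBlocks₁₁)⁻¹ := rfl
    rw [hc, hPt, ← Matrix.nonsing_inv_eq_ringInverse]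
    change (P t).toBlocks₂₁ * ((P t).toBlocks₁₁)⁻¹ =
      (P t * Matrix.fromBlocks ((P t).toBlocks₁₁)⁻¹ 0 0 0).toBlocks₂₁
    generalize P t = M
    conv_rhs => rw [← Matrix.fromBlocks_toBlocks M]
    simp [Matrix.fromBlocks_multiply]
  have hL1 : HasDerivAt (fun t => L1 (P t)) (L1 (mat g * hat X)) 0 :=
    (L1.toContinuousLinearMap.hasFDerivAt (x := P 0)).comp_hasDerivAt 0 hP
  obtain ⟨u, hu⟩ := ua
  have hu0 : L1 (P 0) = u := by rw [hP0]; exact hu.symm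
  have hinv : HasDerivAt (fun t => Ring.inverse (L1 (P t)))
      (-(((u⁻¹ : (Matrix (Fin n) (Fin n) ℂ)ˣ) : Matrix (Fin n) (Fin n) ℂ) * L1 (mat g * hat X) *
        ((u⁻¹ : (Matrix (Fin n) (Fin n) ℂ)ˣ) : Matrix (Fin n) (Fin n) ℂ))) 0 := by
    have h := hasFDerivAt_ringInverse (𝕜 := ℝ) u
    rw [← hu0] at h
    exact h.comp_hasDerivAt (0 : ℝ) hL1
  have hJ := (J.toContinuousLinearMap.hasFDerivAt
    (x := Ring.inverse (L1 (P 0)))).comp_hasDerivAt 0 hinv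
  have hall := (L2.toContinuousLinearMap.hasFDerivAt
    (x := P 0 * J (Ring.inverse (L1 (P 0))))).comp_hasDerivAt 0 (hP.mul hJ)
  have heq : (fun t : ℝ => coord (projD (g * expHat (t • X)))) =
      fun t => L2 (P t * J (Ring.inverse (L1 (P t)))) := funext hfun
  rw [heq]
  refine hall.congr_deriv ?_
  have hui : Ring.inverse (L1 (mat g)) = (mat g).toBlocks₁₁⁻¹ := by
    rw [← Matrix.nonsing_inv_eq_ringInverse]; rfl
  have hui' : ((u⁻¹ : (Matrix (Fin n) (Fin n) ℂ)ˣ) : Matrix (Fin n) (Fin n) ℂ) =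
      (mat g).toBlocks₁₁⁻¹ := by
    rw [← hu]; simp
  have hZ : coord (projD g) = (mat g).toBlocks₂₁ * ((mat g).toBlocks₁₁)⁻¹ := rfl
  rw [← h5, hZ]
  simp only [Function.comp_apply, LinearMap.coe_toContinuousLinearMap', hui', hP0, hui]
  change (mat g * hat X * Matrix.fromBlocks (mat g).toBlocks₁₁⁻¹ 0 0 0 +
    mat g * Matrix.fromBlocks (-((mat g).toBlocks₁₁⁻¹ * (mat g * hat X).toBlocks₁₁ *
      (mat g).toBlocks₁₁⁻¹)) 0 0 0).toBlocks₂₁ = _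
  conv_lhs => rw [← Matrix.fromBlocks_toBlocks (mat g)]
  simp only [hat, Matrix.fromBlocks_multiply,
    Matrix.toBlocks_fromBlocks₁₁, Matrix.toBlocks_fromBlocks₂₁, Matrix.fromBlocks_add,
    Matrix.mul_zero, zero_add, add_zero, Matrix.mul_neg, Matrix.mul_assoc,
    sub_eq_add_neg, Matrix.add_mul, Matrix.neg_mul]

/-- The differential of `U(n,m) → D_{n,m}` is isometric on horizontal vectors. -/
theorem metricD_submersion {n m : ℕ} (g : U n m) (X Y : Matrix (Fin m) (Fin n) ℂ) :
    metricD (coord (projD g))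
      ((((mat g).toBlocks₂₂)ᴴ)⁻¹ * X * ((mat g).toBlocks₁₁)⁻¹)
      ((((mat g).toBlocks₂₂)ᴴ)⁻¹ * Y * ((mat g).toBlocks₁₁)⁻¹) = ip (hat X) (hat Y) := by
  obtain ⟨ua, ud, h1, h2, -⟩ := block_facts g
  unfold metricD
  rw [h1, h2]
  generalize (mat g).toBlocks₁₁ = a at *
  generalize (mat g).toBlocks₂₂ = d at *
  have ada := (Matrix.isUnit_iff_isUnit_det _).1 ua
  have add := (Matrix.isUnit_iff_isUnit_det _).1 ud
  have aa : a⁻¹ * a = 1 := Matrix.nonsing_inv_mul _ ada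
  have aaH' : aᴴ * (a⁻¹)ᴴ = 1 := by rw [← Matrix.conjTranspose_mul, aa, Matrix.conjTranspose_one]
  have dd : d⁻¹ * d = 1 := Matrix.nonsing_inv_mul _ add
  have ddH : dᴴ * (dᴴ)⁻¹ = 1 := by
    rw [← Matrix.conjTranspose_nonsing_inv, ← Matrix.conjTranspose_mul, dd,
      Matrix.conjTranspose_one]
  have key : a * aᴴ * ((dᴴ)⁻¹ * X * a⁻¹)ᴴ * (d * dᴴ) * ((dᴴ)⁻¹ * Y * a⁻¹)
      = a * (Xᴴ * Y) * a⁻¹ := by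
    have e1 : ((dᴴ)⁻¹)ᴴ = d⁻¹ := by
      rw [← Matrix.conjTranspose_nonsing_inv, Matrix.conjTranspose_conjTranspose]
    rw [Matrix.conjTranspose_mul, Matrix.conjTranspose_mul, e1]
    calc a * aᴴ * ((a⁻¹)ᴴ * (Xᴴ * d⁻¹)) * (d * dᴴ) * ((dᴴ)⁻¹ * Y * a⁻¹)
        = a * (aᴴ * (a⁻¹)ᴴ) * Xᴴ * (d⁻¹ * d) * (dᴴ * (dᴴ)⁻¹) * Y * a⁻¹ := by
          simp only [Matrix.mul_assoc]
      _ = a * (Xᴴ * Y) * a⁻¹ := by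
          rw [aaH', dd, ddH]; simp only [Matrix.mul_one, Matrix.mul_assoc]
  rw [key, Matrix.trace_mul_cycle, aa, Matrix.one_mul]
  have e2 : Matrix.trace (X * Yᴴ) = star (Matrix.trace (Xᴴ * Y)) := by
    rw [← Matrix.trace_conjTranspose, Matrix.conjTranspose_mul,
      Matrix.conjTranspose_conjTranspose, Matrix.trace_mul_comm]
  have e3 : ∀ (P : Matrix (Fin n) (Fin n) ℂ) (Q : Matrix (Fin m) (Fin m) ℂ),
      Matrix.trace (Matrix.fromBlocks P 0 0 Q) = Matrix.trace P + Matrix.trace Q := by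
    intro P Q; simp [Matrix.trace, Fintype.sum_sum_type]
  simp only [ip, hat, Matrix.fromBlocks_conjTranspose, Matrix.fromBlocks_multiply,
    e3, Matrix.conjTranspose_conjTranspose, Matrix.conjTranspose_zero,
    Matrix.zero_mul, Matrix.mul_zero, zero_add, add_zero, e2, Complex.add_re]
  simp only [Complex.star_def, Complex.conj_re]
  ring

/-! ### Geodesics of `D_{n,m}` -/

/-- `γ : ℝ → D_{n,m}` is a (complete) geodesic: in the chart, with `G` the metric,
`d/dt G_γ(γ', V) = ½ (∂_V G)_γ(γ', γ')` for every constant vector field `V`. By the Koszul formula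
the difference of the two sides is `G_γ(∇_{γ'} γ', V)`, where `∇` is the Levi-Civita connection. -/
def IsGeodesic {n m : ℕ} (γ : ℝ → D n m) : Prop :=
  ContDiff ℝ ∞ (fun t => coord (γ t)) ∧
  ∀ (t : ℝ) (V : Matrix (Fin m) (Fin n) ℂ),
    deriv (fun s => metricD (coord (γ s)) (deriv (fun r => coord (γ r)) s) V) t =
      (1 / 2) * deriv (fun s : ℝ => metricD (coord (γ t) + s • V)
        (deriv (fun r => coord (γ r)) t) (deriv (fun r => coord (γ r)) t)) 0

/-- A submanifold `S` of `D_{n,m}` is (complete and) totally geodesic: for every tangent vector of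
`S`, that is, for the velocity at `0` of every smooth curve `σ` in `S`, the geodesic of `D_{n,m}`
with this initial velocity exists for all times and lies in `S`. -/
def IsTotallyGeodesic {n m : ℕ} (S : Set (D n m)) : Prop :=
  ∀ σ : ℝ → D n m, ContDiff ℝ ∞ (fun t => coord (σ t)) → (∀ t, σ t ∈ S) →
    ∃ γ : ℝ → D n m, IsGeodesic γ ∧ γ 0 = σ 0 ∧
      deriv (fun t => coord (γ t)) 0 = deriv (fun t => coord (σ t)) 0 ∧ ∀ t, γ t ∈ S

/-! ### The complex surface related to `(X, g)` and its two area forms -/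

/-- `W = X / |hat X|`. -/
def unitize {n m : ℕ} (X : Matrix (Fin m) (Fin n) ℂ) : Matrix (Fin m) (Fin n) ℂ :=
  (Real.sqrt (ip (hat X) (hat X)))⁻¹ • X

/-- The point `g e^{hat(wW)}` of `g S̃ ⊆ U(n,m)`. -/
def surfaceLift {n m : ℕ} (X : Matrix (Fin m) (Fin n) ℂ) (g : U n m) (w : ℂ) : U n m :=
  g * expHat (w • unitize X)

/-- The point of `S` with complex coordinate `w`. -/
def surfacePoint {n m : ℕ} (X : Matrix (Fin m) (Fin n) ℂ) (g : U n m) (w : ℂ) : D n m :=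
  projD (surfaceLift X g w)

/-- The complex surface `S` related to `(X, g)` in `D_{n,m}`. -/
def surface {n m : ℕ} (X : Matrix (Fin m) (Fin n) ℂ) (g : U n m) : Set (D n m) :=
  Set.range (surfacePoint X g)

/-- The area form `ω_{(X,g)}` on the images of two vectors `x`, `y` tangent to `g S̃` at `g₁`. -/
def areaForm {n m : ℕ} (X : Matrix (Fin m) (Fin n) ℂ) (g₁ : U n m) (x y : Mat n m) : ℝ :=
  Matrix.det !![ip ((mat g₁)⁻¹ * x) (hat (unitize X)), ip ((mat g₁)⁻¹ * y) (hat (unitize X));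
    ip ((mat g₁)⁻¹ * x) (hat (Complex.I • unitize X)),
    ip ((mat g₁)⁻¹ * y) (hat (Complex.I • unitize X))]

/-- The coefficient `ω_{(X,g)}(∂/∂u, ∂/∂v)` at the point of `S` with coordinate `w = u + iv`. -/
def relatedDensity {n m : ℕ} (X : Matrix (Fin m) (Fin n) ℂ) (g : U n m) (w : ℂ) : ℝ :=
  areaForm X (surfaceLift X g w)
    (deriv (fun s : ℝ => mat (surfaceLift X g (w + s))) 0)
    (deriv (fun s : ℝ => mat (surfaceLift X g (w + s * Complex.I))) 0)

/-- The coefficient `ω(∂/∂u, ∂/∂v)` of the area form `ω` induced on `S`, with its orientation by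
`w = u + iv`, by the metric of `D_{n,m}`: the square root of the Gram determinant. -/
def inducedDensity {n m : ℕ} (X : Matrix (Fin m) (Fin n) ℂ) (g : U n m) (w : ℂ) : ℝ :=
  let Z := coord (surfacePoint X g w)
  let Zu := deriv (fun s : ℝ => coord (surfacePoint X g (w + s))) 0
  let Zv := deriv (fun s : ℝ => coord (surfacePoint X g (w + s * Complex.I))) 0
  Real.sqrt (metricD Z Zu Zu * metricD Z Zv Zv - metricD Z Zu Zv ^ 2)

/-! ### Closed curves on `S` -/

/-- The region surrounded by the plane curve `z : [0,1] → ℂ`: the bounded part of the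
complement. -/
def enclosed (z : ℝ → ℂ) : Set ℂ :=
  {w | w ∉ z '' Set.Icc 0 1 ∧
    Bornology.IsBounded (connectedComponentIn (z '' Set.Icc 0 1)ᶜ w)}

/-- The winding number of `z : [0,1] → ℂ` around `w`. -/
def winding (z : ℝ → ℂ) (w : ℂ) : ℂ :=
  (2 * Real.pi * Complex.I)⁻¹ * ∫ t in (0 : ℝ)..1, deriv z t / (z t - w)

/-- `c : [0,1] → S` is a smooth, simple, closed, orientation-preserving curve on the surface `S`
related to `(X, g)`, and `z` is its expression in the complex coordinate of `S`. -/
structure IsSimpleClosedCurve {n m : ℕ} (X : Matrix (Fin m) (Fin n) ℂ) (g : U n m)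
    (c : ℝ → D n m) (z : ℝ → ℂ) : Prop where
  coord_eq : ∀ t ∈ Set.Icc (0 : ℝ) 1, c t = surfacePoint X g (z t)
  smooth : ContDiffOn ℝ ∞ z (Set.Icc 0 1)
  closed : c 0 = c 1
  simple : Set.InjOn c (Set.Ico 0 1)
  oriented : ∀ w ∈ enclosed z, winding z w = 1

/-- `Area(c)`: the area, with respect to `ω_{(X,g)}`, of the region on `S` surrounded by the curve
with coordinate expression `z`. -/
def relatedArea {n m : ℕ} (X : Matrix (Fin m) (Fin n) ℂ) (g : U n m) (z : ℝ → ℂ) : ℝ :=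
  ∫ w in enclosed z, relatedDensity X g w

/-- `A(c)`: the area of the region on `S` surrounded by the curve with coordinate expression `z`,
with respect to the metric induced on `S` by that of `D_{n,m}`. -/
def inducedArea {n m : ℕ} (X : Matrix (Fin m) (Fin n) ℂ) (g : U n m) (z : ℝ → ℂ) : ℝ :=
  ∫ w in enclosed z, inducedDensity X g w

/-! ### Horizontal lifts and holonomy -/

/-- `chat : [0,1] → U(n,m)/U(m)` is a smooth horizontal lift of `c : [0,1] → D_{n,m}`.
A smooth curve in `U(n,m)/U(m)` is the image of a smooth curve `cbar` in `U(n,m)`. With tangent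
vectors moved to the identity by left translation, the tangent space of `U(n,m)/U(m)` is the
orthogonal complement of `𝔲(m)`, and the vertical space in it is `𝔲(n)`; as `𝔲(m) ⟂ 𝔲(n)`,
horizontality says that `cbar⁻¹ cbar'` is orthogonal to `𝔲(n)`. -/
def IsHorizontalLift {n m : ℕ} (chat : ℝ → Total n m) (c : ℝ → D n m) : Prop :=
  (∀ t ∈ Set.Icc (0 : ℝ) 1, bundleProj (chat t) = c t) ∧
  ∃ cbar : ℝ → U n m, ContDiffOn ℝ ∞ (fun t => mat (cbar t)) (Set.Icc 0 1) ∧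
    ∀ t ∈ Set.Icc (0 : ℝ) 1, projTotal (cbar t) = chat t ∧
      ∀ A : Matrix (Fin n) (Fin n) ℂ, Aᴴ = -A →
        ip ((mat (cbar t))⁻¹ * derivWithin (fun s => mat (cbar s)) (Set.Icc 0 1) t)
          (Matrix.fromBlocks A 0 0 0) = 0

/-- The point `p` of the bundle lies on the translate by `h` of the image of `g S̃`. -/
def LiesOver {n m : ℕ} (X : Matrix (Fin m) (Fin n) ℂ) (g : U n m)
    (h : Matrix.unitaryGroup (Fin n) ℂ) (p : Total n m) : Prop :=
  ∃ w : ℂ, p = rightAct (projTotal (surfaceLift X g w)) h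

/-- `Ψ ∈ 𝔲(n)` describes the holonomy displacement of `chat`, where `a` is the area surrounded by
the base curve: `Ψ` is in the real span of the `i (X*X)^k`, `1 ≤ k ≤ rk X`, conjugated by the `h`
with which `chat` starts on the translate by `h` of `g S̃`; `chat 1 = chat 0 · e^Ψ`; and
`Tr Ψ = 2ia`. -/
structure IsHolonomyExponent {n m : ℕ} (X : Matrix (Fin m) (Fin n) ℂ)
    (h : Matrix.unitaryGroup (Fin n) ℂ) (chat : ℝ → Total n m) (a : ℝ)
    (Ψ : Matrix (Fin n) (Fin n) ℂ) : Prop where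
  span : (h : Matrix (Fin n) (Fin n) ℂ) * Ψ * (h : Matrix (Fin n) (Fin n) ℂ)ᴴ ∈
    Submodule.span ℝ ((fun k : ℕ => Complex.I • (Xᴴ * X) ^ k) '' Set.Icc 1 X.rank)
  displacement : ∃ u : Matrix.unitaryGroup (Fin n) ℂ,
    (u : Matrix (Fin n) (Fin n) ℂ) = NormedSpace.exp Ψ ∧ chat 1 = rightAct (chat 0) u
  trace_eq : Matrix.trace Ψ = 2 * Complex.I * a

/-! ### The hypothesis and the conclusion -/

/-- `M` has exactly one positive eigenvalue, and its algebraic multiplicity is `q`. -/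
def HasSinglePositiveEigenvalue {n : ℕ} (M : Matrix (Fin n) (Fin n) ℂ) (q : ℕ) : Prop :=
  ∃ l : ℝ, 0 < l ∧ M.charpoly.IsRoot (l : ℂ) ∧ M.charpoly.rootMultiplicity (l : ℂ) = q ∧
    ∀ l' : ℝ, 0 < l' → M.charpoly.IsRoot (l' : ℂ) → l' = l

/-- `A diag[(2i/q)a, …, (2i/q)a, 0, …, 0] A*`: the first `q` entries are `(2i/q)a`. -/
def diagConj {n : ℕ} (q : ℕ) (a : ℝ) (A : Matrix.unitaryGroup (Fin n) ℂ) :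
    Matrix (Fin n) (Fin n) ℂ :=
  (A : Matrix (Fin n) (Fin n) ℂ) *
    Matrix.diagonal (fun j : Fin n => if (j : ℕ) < q then 2 * Complex.I / q * a else 0) *
    (A : Matrix (Fin n) (Fin n) ℂ)ᴴ

/-- The set `U_{m,n}(ℂ)` of the `X` with `X*X = λ I_n` for some `λ ≠ 0`. -/
def conformal (m n : ℕ) : Set (Matrix (Fin m) (Fin n) ℂ) :=
  {X | ∃ l : ℂ, l ≠ 0 ∧ Xᴴ * X = l • (1 : Matrix (Fin n) (Fin n) ℂ)}

end

end Holonomy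

namespace Holonomy

noncomputable section

/-! ### Exponentials of idempotents and partial isometries -/

/-! A single positive eigenvalue l of X*X means X = √l V for a partial isometry V, with P = V*V an
orthogonal projection of rank q, and then W = κV with κ = 1/√q (`exists_partialIsometry`). Because V
V* V = V, the matrices `rot V a b` multiply like the 2×2 matrices [[a, b̄], [b, ā]] (`rot_mul`), and
e^{hat(wV)} is the one with a = cosh|w| and b = `sinhPolar w` (`exp_hat_smul`). Everything on S thus
happens in a copy of SU(1,1), and S is a hyperbolic disc.

In the coordinate w both area forms have the density sinh(κr)cosh(κr)/(κr), r = |w|, which gives (a)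
(`relatedDensity_eq`, `inducedDensity_eq`).

A horizontal lift is the standard lift through g e^{hat(wW)} times diag(h, k), and horizontality
becomes h' = iβPh, where β = Im(S̄S') and S = `sinhPolar` of κz (`hasDerivWithinAt_holonomy`). As P
is constant, no path ordering occurs, and h(1) = (1 + (e^{i∫β} − 1)P)h(0) (`holonomy_eq`).

It remains to see that ∫β = 2κ² Area = (2/q) Area. This is Stokes' theorem on the enclosed region,
obtained here from winding numbers instead of the geometry of the boundary. The convolution of the
density with the kernel 1/(z − w) is computed on circles, as in Newton's shell theorem
(`integral_density_div`), and its line integral along the curve gives ∫β. Exchanging the integrals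
gives the integral of the density against the winding number, which is 1 on the enclosed region and
0 in the unbounded part of the complement (`lineIntegral_eq_area`).

All positive powers of X*X are multiples of P, so an admissible Ψ lies on the real line through i
h*Ph, and its trace fixes it (`eq_holonomyGenerator`).

Finally, the tangent vectors of S at the class of G correspond to the multiples yV, and the
geodesics G e^{t hat(yV)} stay in the same SU(1,1)-orbit (`isGeodesic_mul_expHat`,
`projD_surfaceLift_mul_expHat_mem`, `isTotallyGeodesic_surface`). -/

theorem exp_smul_of_idempotent {ι : Type*} [Fintype ι] [DecidableEq ι] {e : Matrix ι ι ℂ}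
    (he : e * e = e) (s : ℂ) :
    NormedSpace.exp (s • e) = 1 + (Complex.exp s - 1) • e := by
  -- Positive powers of e are e itself, so the series of e^s times e is wrong only in its constant
  -- term, which the summand 1 − e at k = 0 corrects.
  have hs : HasSum (fun k : ℕ => ((k.factorial : ℂ)⁻¹ * s ^ k) • e + if k = 0 then 1 - e else 0)
      (Complex.exp s • e + (1 - e)) := by
    refine HasSum.add (HasSum.smul_const ?_ e) (hasSum_ite_eq 0 (1 - e))
    rw [Complex.exp_eq_exp_ℂ]
    simpa using NormedSpace.exp_series_hasSum_exp' (𝕂 := ℂ) s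
  have h2 := NormedSpace.exp_series_hasSum_exp' (𝕂 := ℂ) (s • e)
  have h3 : ∀ k : ℕ, ((k.factorial : ℂ)⁻¹ • (s • e) ^ k) =
      ((k.factorial : ℂ)⁻¹ * s ^ k) • e + if k = 0 then 1 - e else 0 := by
    intro k
    rcases Nat.eq_zero_or_pos k with rfl | hk
    · simp
    · have : e ^ k = e := (IsIdempotentElem.pow_eq (show IsIdempotentElem e from he) hk.ne')
      rw [smul_pow, this, if_neg hk.ne', add_zero, smul_smul]
  simp only [h3] at h2
  rw [h2.unique hs, sub_smul, one_smul]
  abel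

/-- The matrix acting as `[[a, conj b], [b, conj a]]` on the initial and the final space of the
partial isometry `V`, and as the identity on their complements. -/
def rot {n m : ℕ} (V : Matrix (Fin m) (Fin n) ℂ) (a b : ℂ) : Mat n m :=
  Matrix.fromBlocks (1 + (a - 1) • (Vᴴ * V)) ((starRingEnd ℂ) b • Vᴴ) (b • V)
    (1 + ((starRingEnd ℂ) a - 1) • (V * Vᴴ))

/-- `sinh r · e^{iφ}` at the point `w = r e^{iφ}`. -/
def sinhPolar (w : ℂ) : ℂ := ((Real.sinh ‖w‖ / ‖w‖ : ℝ) : ℂ) * w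

section PartialIsometry

variable {n m : ℕ} {V : Matrix (Fin m) (Fin n) ℂ}

theorem conjTranspose_mul_partialIsometry (hV : V * Vᴴ * V = V) : Vᴴ * (V * Vᴴ) = Vᴴ := by
  have := congrArg Matrix.conjTranspose hV
  simpa [Matrix.conjTranspose_mul] using this

/-- V*V and VV* are the projections onto the initial and the final space of V, and V, V* are inverse
isometries between these spaces; so products are computed as for [[a, b̄], [b, ā]], and the
complements carry the identity. -/
theorem rot_mul (hV : V * Vᴴ * V = V) (a b a' b' : ℂ) :
    rot V a b * rot V a' b' =
      rot V (a * a' + (starRingEnd ℂ) b * b') (b * a' + (starRingEnd ℂ) a * b') := by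
  have h1 : V * (Vᴴ * V) = V := by rw [← Matrix.mul_assoc, hV]
  have h2 := conjTranspose_mul_partialIsometry hV
  have h3 : Vᴴ * V * Vᴴ = Vᴴ := by rw [Matrix.mul_assoc, h2]
  have h4 : Vᴴ * V * (Vᴴ * V) = Vᴴ * V := by rw [← Matrix.mul_assoc, h3]
  have h5 : V * Vᴴ * (V * Vᴴ) = V * Vᴴ := by rw [← Matrix.mul_assoc, hV]
  simp only [rot, Matrix.fromBlocks_multiply, Matrix.add_mul, Matrix.mul_add, Matrix.one_mul,
    Matrix.mul_one, Matrix.smul_mul, Matrix.mul_smul, h1, h2, h3, h4, h5, hV, map_add, map_mul,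
    Complex.conj_conj]
  congr 1 <;> module

theorem rot_one_zero : rot V 1 0 = 1 := by simp [rot]

theorem norm_sq_mul_conj (w : ℂ) : (starRingEnd ℂ) w * w = ((‖w‖ ^ 2 : ℝ) : ℂ) := by
  rw [mul_comm, Complex.mul_conj, Complex.normSq_eq_norm_sq]

theorem norm_sinhPolar (w : ℂ) : ‖sinhPolar w‖ = Real.sinh ‖w‖ := by
  have h0 : 0 ≤ Real.sinh ‖w‖ := Real.sinh_nonneg_iff.2 (norm_nonneg w)
  rw [sinhPolar, norm_mul, Complex.norm_real, Real.norm_of_nonneg (by positivity)]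
  -- At w = 0 the quotient sinh‖w‖/‖w‖ has the value 0 instead of its limit 1; it is only ever
  -- multiplied by w = 0.
  rcases eq_or_ne w 0 with rfl | hw
  · simp
  · have : ‖w‖ ≠ 0 := norm_ne_zero_iff.2 hw
    field_simp

/-- The 2×2 matrix behind e^{hat(wV)} has determinant one, that is, it lies in SU(1,1). -/
theorem cosh_sq_sub_sinhPolar (w : ℂ) :
    (Real.cosh ‖w‖ : ℂ) * Real.cosh ‖w‖ - (starRingEnd ℂ) (sinhPolar w) * sinhPolar w = 1 := by
  rw [norm_sq_mul_conj, norm_sinhPolar]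
  have := Real.cosh_sq_sub_sinh_sq ‖w‖
  rw [← sq]
  exact_mod_cast this

/-- Up to the factor r = ‖w‖, `hat (w • V)` is an involution J on the sum of the initial and the
final space and zero on the complement. Its spectral projections reduce the exponential to that of
idempotents. -/
theorem exp_hat_smul (hV : V * Vᴴ * V = V) (w : ℂ) :
    NormedSpace.exp (hat (w • V)) = rot V (Real.cosh ‖w‖) (sinhPolar w) := by
  rcases eq_or_ne w 0 with rfl | hw
  · simp [hat, sinhPolar, rot_one_zero]
  have hr : (‖w‖ : ℂ) ≠ 0 := by exact_mod_cast norm_ne_zero_iff.2 hw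
  set r : ℝ := ‖w‖ with hrdef
  set u : ℂ := w / r with hu
  have huu : (starRingEnd ℂ) u * u = 1 := by
    rw [hu, map_div₀, Complex.conj_ofReal, div_mul_div_comm, norm_sq_mul_conj, ← hrdef]
    field_simp
    push_cast
    ring
  have huu' : u * (starRingEnd ℂ) u = 1 := by rw [mul_comm, huu]
  have h1 : V * (Vᴴ * V) = V := by rw [← Matrix.mul_assoc, hV]
  have h2 := conjTranspose_mul_partialIsometry hV
  have h3 : Vᴴ * V * Vᴴ = Vᴴ := by rw [Matrix.mul_assoc, h2]
  have h4 : Vᴴ * V * (Vᴴ * V) = Vᴴ * V := by rw [← Matrix.mul_assoc, h3]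
  have h5 : V * Vᴴ * (V * Vᴴ) = V * Vᴴ := by rw [← Matrix.mul_assoc, hV]
  let N : Mat n m := Matrix.fromBlocks (Vᴴ * V) 0 0 (V * Vᴴ)
  let J : Mat n m := hat (u • V)
  have hNN : N * N = N := by simp [N, Matrix.fromBlocks_multiply, h4, h5]
  have hNJ : N * J = J := by
    simp [N, J, hat, Matrix.fromBlocks_multiply, h3, hV]
  have hJN : J * N = J := by
    simp [N, J, hat, Matrix.fromBlocks_multiply, h2, h1]
  have hJJ : J * J = N := by
    simp [N, J, hat, Matrix.fromBlocks_multiply, smul_smul, huu, huu']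
  -- The spectral projections of J for the eigenvalues 1 and −1.
  let ep : Mat n m := (1 / 2 : ℂ) • (N + J)
  let em : Mat n m := (1 / 2 : ℂ) • (N - J)
  have hp : ep * ep = ep := by
    simp only [ep, Matrix.smul_mul, Matrix.mul_smul, Matrix.mul_add, Matrix.add_mul, hNN, hNJ, hJN,
      hJJ]
    module
  have hm : em * em = em := by
    simp only [em, Matrix.smul_mul, Matrix.mul_smul, Matrix.mul_sub, Matrix.sub_mul, hNN, hNJ, hJN,
      hJJ]
    module
  have hpm : ep * em = 0 := by
    simp only [ep, em, Matrix.smul_mul, Matrix.mul_smul, Matrix.mul_sub, Matrix.add_mul, hNN, hNJ,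
      hJN, hJJ]
    module
  have hmp : em * ep = 0 := by
    simp only [ep, em, Matrix.smul_mul, Matrix.mul_smul, Matrix.mul_add, Matrix.sub_mul, hNN, hNJ,
      hJN, hJJ]
    module
  have hdec : hat (w • V) = (r : ℂ) • ep + (-(r : ℂ)) • em := by
    have hwu : w = r * u := by rw [hu]; field_simp
    have : (hat (w • V) : Mat n m) = (r : ℂ) • J := by
      simp only [J, hat, Matrix.fromBlocks_smul, Matrix.conjTranspose_smul, smul_zero, smul_smul]
      rw [hwu]
      simp
    rw [this]
    simp only [ep, em]
    module
  have hcomm : Commute ((r : ℂ) • ep) ((-(r : ℂ)) • em) := by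
    simp [Commute, SemiconjBy, hpm, hmp]
  rw [hdec, Matrix.exp_add_of_commute _ _ hcomm, exp_smul_of_idempotent hp,
    exp_smul_of_idempotent hm]
  have hfin : (1 + (Complex.exp r - 1) • ep) * (1 + (Complex.exp (-r) - 1) • em) =
      1 + (Complex.cosh r - 1) • N + Complex.sinh r • J := by
    simp only [Matrix.add_mul, Matrix.mul_add, Matrix.one_mul, Matrix.mul_one, Matrix.smul_mul,
      Matrix.mul_smul, hpm, smul_zero, add_zero, Complex.cosh, Complex.sinh]
    simp only [ep, em]
    module
  rw [hfin]
  have hsu : (sinhPolar w : ℂ) = Complex.sinh r * u := by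
    rw [sinhPolar, ← hrdef, hu]; push_cast; ring
  have hone : (1 : Mat n m) = Matrix.fromBlocks 1 0 0 1 := Matrix.fromBlocks_one.symm
  rw [hone]
  simp only [rot, N, J, hat, Matrix.fromBlocks_smul, Matrix.fromBlocks_add, hsu,
    Matrix.conjTranspose_smul, smul_zero, add_zero, zero_add, smul_smul, map_mul,
    Complex.ofReal_cosh, ← Complex.cosh_conj, ← Complex.sinh_conj, Complex.conj_ofReal]
  rfl

theorem mat_expHat_smul (hV : V * Vᴴ * V = V) (w : ℂ) :
    mat (expHat (w • V)) = rot V (Real.cosh ‖w‖) (sinhPolar w) := exp_hat_smul hV w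

theorem rot_mul_rot_neg (hV : V * Vᴴ * V = V) (w : ℂ) :
    rot V (Real.cosh ‖w‖) (sinhPolar w) * rot V (Real.cosh ‖w‖) (-sinhPolar w) = 1 := by
  rw [rot_mul hV, Complex.conj_ofReal, mul_neg, ← sub_eq_add_neg, cosh_sq_sub_sinhPolar]
  convert rot_one_zero (V := V) using 2
  ring

end PartialIsometry

/-! ### Cosets and the chart -/

section Cosets

variable {n m : ℕ}

theorem mat_inv (g : U n m) : mat g⁻¹ = (mat g)⁻¹ := by
  simp [mat]

theorem mat_inv_mul (g : U n m) : (mat g)⁻¹ * mat g = 1 := by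
  rw [← mat_inv]; exact Units.inv_mul _

theorem mat_mul_inv (g : U n m) : mat g * (mat g)⁻¹ = 1 := by
  rw [← mat_inv]; exact Units.mul_inv _

theorem Lam_mul_Lam : Lam n m * Lam n m = 1 := by
  simp [Lam, Matrix.fromBlocks_multiply]

theorem mat_inv_eq (g : U n m) : (mat g)⁻¹ = Lam n m * (mat g)ᴴ * Lam n m := by
  have hg : (mat g)ᴴ * Lam n m * mat g = Lam n m := g.2
  apply Matrix.inv_eq_left_inv
  rw [Matrix.mul_assoc, Matrix.mul_assoc, ← Matrix.mul_assoc _ (Lam n m), hg, Lam_mul_Lam]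

theorem mat_inv_fromBlocks (g : U n m) :
    (mat g)⁻¹ = Matrix.fromBlocks ((mat g).toBlocks₁₁)ᴴ (-((mat g).toBlocks₂₁)ᴴ)
      (-((mat g).toBlocks₁₂)ᴴ) ((mat g).toBlocks₂₂)ᴴ := by
  rw [mat_inv_eq]
  conv_lhs => rw [← Matrix.fromBlocks_toBlocks (mat g)]
  simp [Lam, Matrix.fromBlocks_conjTranspose, Matrix.fromBlocks_multiply]

/-- If the block c vanishes, g⁻¹g = 1 gives a*a = 1 and a*b = 0, hence b = 0; then gg⁻¹ = 1 gives
dd* = 1. -/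
theorem mem_subUU_iff (g : U n m) : g ∈ subUU n m ↔ (mat g).toBlocks₂₁ = 0 := by
  constructor
  · rintro ⟨p, rfl⟩
    rfl
  · intro hc
    have h1 := mat_inv_mul g
    have h2 := mat_mul_inv g
    rw [mat_inv_fromBlocks] at h1 h2
    have e : mat g = Matrix.fromBlocks (mat g).toBlocks₁₁ (mat g).toBlocks₁₂
        (mat g).toBlocks₂₁ (mat g).toBlocks₂₂ := (Matrix.fromBlocks_toBlocks _).symm
    rw [e] at h1 h2
    simp only [hc, Matrix.toBlocks_fromBlocks₁₁, Matrix.toBlocks_fromBlocks₁₂,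
      Matrix.toBlocks_fromBlocks₂₁, Matrix.toBlocks_fromBlocks₂₂, Matrix.conjTranspose_zero,
      neg_zero, Matrix.fromBlocks_multiply, Matrix.zero_mul, Matrix.mul_zero, add_zero, zero_add,
      ← Matrix.fromBlocks_one, Matrix.fromBlocks_inj] at h1 h2
    obtain ⟨h11, h12, -, -⟩ := h1
    obtain ⟨h21, -, -, h24⟩ := h2
    have hb : (mat g).toBlocks₁₂ = 0 := by
      have hz : (mat g).toBlocks₁₁ * (((mat g).toBlocks₁₁)ᴴ * (mat g).toBlocks₁₂) = 0 := by
        rw [h12, Matrix.mul_zero]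
      rw [← Matrix.mul_assoc, mul_eq_one_comm.1 h11, Matrix.one_mul] at hz
      exact hz
    refine ⟨(⟨(mat g).toBlocks₁₁, Matrix.mem_unitaryGroup_iff'.2 h11⟩,
      ⟨(mat g).toBlocks₂₂, Matrix.mem_unitaryGroup_iff.2 h24⟩), ?_⟩
    apply Subtype.ext
    apply Units.ext
    change Matrix.fromBlocks (mat g).toBlocks₁₁ 0 0 (mat g).toBlocks₂₂ = mat g
    conv_rhs => rw [e]
    rw [hb, hc]

theorem projD_eq_iff (g g' : U n m) :
    projD g = projD g' ↔ ((mat g)⁻¹ * mat g').toBlocks₂₁ = 0 := by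
  rw [projD, projD, QuotientGroup.eq, mem_subUU_iff, ← mat_inv]
  rfl

end Cosets

/-! ### Calculus of matrix-valued functions -/

section Calculus

variable {ι κ ν : Type*} [Fintype ι] [Fintype κ] [DecidableEq κ] [Fintype ν]
  [DecidableEq ν]

/-- Products of rectangular matrices are not multiplication in one ring, so the product rule and
smoothness are drawn from this bounded bilinear map. -/
theorem isBoundedBilinearMap_matrix_mul :
    IsBoundedBilinearMap ℝ (fun p : Matrix ι κ ℂ × Matrix κ ν ℂ => p.1 * p.2) where
  add_left := fun _ _ _ => Matrix.add_mul _ _ _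
  smul_left := fun _ _ _ => Matrix.smul_mul _ _ _
  add_right := fun _ _ _ => Matrix.mul_add _ _ _
  smul_right := fun _ _ _ => Matrix.mul_smul _ _ _
  bound := ⟨1, one_pos, fun A B => by simpa using Matrix.l2_opNorm_mul A B⟩

theorem hasDerivWithinAt_matrix_mul {A : ℝ → Matrix ι κ ℂ} {B : ℝ → Matrix κ ν ℂ}
    {A' : Matrix ι κ ℂ} {B' : Matrix κ ν ℂ} {s : Set ℝ} {t : ℝ} (hA : HasDerivWithinAt A A' s t)
    (hB : HasDerivWithinAt B B' s t) :
    HasDerivWithinAt (fun r => A r * B r) (A t * B' + A' * B t) s t := by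
  have h := isBoundedBilinearMap_matrix_mul (ι := ι) (κ := κ) (ν := ν)
  exact (h.hasFDerivAt (A t, B t)).comp_hasDerivWithinAt t (hA.prodMk hB)

theorem hasDerivAt_matrix_mul {A : ℝ → Matrix ι κ ℂ} {B : ℝ → Matrix κ ν ℂ}
    {A' : Matrix ι κ ℂ} {B' : Matrix κ ν ℂ} {t : ℝ} (hA : HasDerivAt A A' t)
    (hB : HasDerivAt B B' t) :
    HasDerivAt (fun r => A r * B r) (A t * B' + A' * B t) t := by
  rw [← hasDerivWithinAt_univ] at *
  exact hasDerivWithinAt_matrix_mul hA hB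

theorem contDiff_matrix_mul {A : ℝ → Matrix ι κ ℂ} {B : ℝ → Matrix κ ν ℂ}
    (hA : ContDiff ℝ ∞ A) (hB : ContDiff ℝ ∞ B) : ContDiff ℝ ∞ (fun r => A r * B r) :=
  (isBoundedBilinearMap_matrix_mul (ι := ι) (κ := κ) (ν := ν)).contDiff.comp (hA.prodMk hB)

variable [DecidableEq ι]

theorem hasDerivAt_matrix_inv {A : ℝ → Matrix ι ι ℂ} {A' : Matrix ι ι ℂ} {t : ℝ}
    (hA : HasDerivAt A A' t) (hu : IsUnit (A t)) :
    HasDerivAt (fun r => (A r)⁻¹) (-((A t)⁻¹ * A' * (A t)⁻¹)) t := by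
  obtain ⟨u, hu⟩ := hu
  have h := hasFDerivAt_ringInverse (𝕜 := ℝ) u
  rw [hu] at h
  have h2 := h.comp_hasDerivAt t hA
  have e : (((u⁻¹ : (Matrix ι ι ℂ)ˣ)) : Matrix ι ι ℂ) = (A t)⁻¹ := by rw [← hu]; simp
  simp only [neg_apply, ContinuousLinearMap.mulLeftRight_apply, e] at h2
  refine h2.congr_of_eventuallyEq (Filter.Eventually.of_forall fun r => ?_)
  exact Matrix.nonsing_inv_eq_ringInverse _

theorem contDiff_matrix_inv {A : ℝ → Matrix ι ι ℂ} (hA : ContDiff ℝ ∞ A)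
    (hu : ∀ t, IsUnit (A t)) : ContDiff ℝ ∞ (fun r => (A r)⁻¹) := by
  rw [contDiff_iff_contDiffAt] at *
  intro t
  obtain ⟨u, hu⟩ := hu t
  have h := contDiffAt_ringInverse ℝ (n := ∞) u
  rw [hu] at h
  refine (h.comp t (hA t)).congr_of_eventuallyEq (Filter.Eventually.of_forall fun r => ?_)
  exact Matrix.nonsing_inv_eq_ringInverse _

/-- The conjugate transpose as a continuous real linear map. -/
def conjTransposeCLM : Matrix ι κ ℂ →L[ℝ] Matrix κ ι ℂ :=
  LinearMap.toContinuousLinearMap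
    { toFun := Matrix.conjTranspose, map_add' := Matrix.conjTranspose_add,
      map_smul' := fun r A => by simp [Matrix.conjTranspose_smul] }

theorem hasDerivAt_conjTranspose {A : ℝ → Matrix ι κ ℂ} {A' : Matrix ι κ ℂ} {t : ℝ}
    (hA : HasDerivAt A A' t) : HasDerivAt (fun r => (A r)ᴴ) A'ᴴ t :=
  (conjTransposeCLM (ι := ι) (κ := κ)).hasFDerivAt.comp_hasDerivAt t hA

/-- The real part of the trace as a continuous real linear map. -/
def reTraceCLM : Matrix ι ι ℂ →L[ℝ] ℝ :=
  LinearMap.toContinuousLinearMap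
    { toFun := fun A => (Matrix.trace A).re, map_add' := fun A B => by simp,
      map_smul' := fun r A => by simp [Matrix.trace_smul] }

theorem hasDerivAt_reTrace {A : ℝ → Matrix ι ι ℂ} {A' : Matrix ι ι ℂ} {t : ℝ}
    (hA : HasDerivAt A A' t) :
    HasDerivAt (fun r => (Matrix.trace (A r)).re) (Matrix.trace A').re t :=
  (reTraceCLM (ι := ι)).hasFDerivAt.comp_hasDerivAt t hA

end Calculus

/-! ### Blocks of elements of U(n,m) and the differential of the chart -/

section Blocks

variable {n m : ℕ}

def block₁₁ : Mat n m →L[ℝ] Matrix (Fin n) (Fin n) ℂ :=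
  LinearMap.toContinuousLinearMap
    { toFun := Matrix.toBlocks₁₁, map_add' := fun _ _ => rfl, map_smul' := fun _ _ => rfl }

def block₂₁ : Mat n m →L[ℝ] Matrix (Fin m) (Fin n) ℂ :=
  LinearMap.toContinuousLinearMap
    { toFun := Matrix.toBlocks₂₁, map_add' := fun _ _ => rfl, map_smul' := fun _ _ => rfl }

def block₂₂ : Mat n m →L[ℝ] Matrix (Fin m) (Fin m) ℂ :=
  LinearMap.toContinuousLinearMap
    { toFun := Matrix.toBlocks₂₂, map_add' := fun _ _ => rfl, map_smul' := fun _ _ => rfl }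

theorem toBlocks₁₁_mul (M N : Mat n m) : (M * N).toBlocks₁₁ =
    M.toBlocks₁₁ * N.toBlocks₁₁ + M.toBlocks₁₂ * N.toBlocks₂₁ := by
  conv_lhs => rw [← Matrix.fromBlocks_toBlocks M, ← Matrix.fromBlocks_toBlocks N]
  simp [Matrix.fromBlocks_multiply]

theorem toBlocks₂₁_mul (M N : Mat n m) : (M * N).toBlocks₂₁ =
    M.toBlocks₂₁ * N.toBlocks₁₁ + M.toBlocks₂₂ * N.toBlocks₂₁ := by
  conv_lhs => rw [← Matrix.fromBlocks_toBlocks M, ← Matrix.fromBlocks_toBlocks N]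
  simp [Matrix.fromBlocks_multiply]

theorem toBlocks₂₂_mul (M N : Mat n m) : (M * N).toBlocks₂₂ =
    M.toBlocks₂₁ * N.toBlocks₁₂ + M.toBlocks₂₂ * N.toBlocks₂₂ := by
  conv_lhs => rw [← Matrix.fromBlocks_toBlocks M, ← Matrix.fromBlocks_toBlocks N]
  simp [Matrix.fromBlocks_multiply]

theorem coord_projD (g : U n m) :
    coord (projD g) = (mat g).toBlocks₂₁ * ((mat g).toBlocks₁₁)⁻¹ := rfl

theorem coord_mul_toBlocks₁₁ (g : U n m) :
    coord (projD g) * (mat g).toBlocks₁₁ = (mat g).toBlocks₂₁ := by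
  have ua := (Matrix.isUnit_iff_isUnit_det _).1 (block_facts g).1
  rw [coord_projD, Matrix.mul_assoc, Matrix.nonsing_inv_mul _ ua, Matrix.mul_one]

/-- This is the off-diagonal relation a*b = c*d, multiplied by the inverse of a*. -/
theorem conjTranspose_coord_mul_toBlocks₂₂ (g : U n m) :
    (coord (projD g))ᴴ * (mat g).toBlocks₂₂ = (mat g).toBlocks₁₂ := by
  have ua := (Matrix.isUnit_iff_isUnit_det _).1 (block_facts g).1
  have h1 := mat_inv_mul g
  rw [mat_inv_fromBlocks] at h1
  conv_lhs at h1 => rw [← Matrix.fromBlocks_toBlocks (mat g)]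
  simp only [Matrix.toBlocks_fromBlocks₁₁, Matrix.toBlocks_fromBlocks₁₂,
    Matrix.toBlocks_fromBlocks₂₁, Matrix.toBlocks_fromBlocks₂₂, Matrix.fromBlocks_multiply,
    ← Matrix.fromBlocks_one, Matrix.fromBlocks_inj, Matrix.neg_mul, ← sub_eq_add_neg,
    sub_eq_zero] at h1
  have h2 : (((mat g).toBlocks₁₁)⁻¹)ᴴ * ((mat g).toBlocks₁₁)ᴴ = 1 := by
    rw [← Matrix.conjTranspose_mul, Matrix.mul_nonsing_inv _ ua, Matrix.conjTranspose_one]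
  rw [coord_projD, Matrix.conjTranspose_mul, Matrix.mul_assoc, ← h1.2.1, ← Matrix.mul_assoc, h2,
    Matrix.one_mul]

/-- The differential of `U(n,m) → D_{n,m}` in the global chart. -/
theorem hasDerivAt_coord {G : ℝ → U n m} {G' : Mat n m} {t : ℝ}
    (hG : HasDerivAt (fun s => mat (G s)) G' t) :
    HasDerivAt (fun s => coord (projD (G s)))
      ((((mat (G t)).toBlocks₂₂)ᴴ)⁻¹ * ((mat (G t))⁻¹ * G').toBlocks₂₁ *
        ((mat (G t)).toBlocks₁₁)⁻¹) t := by
  obtain ⟨ua, -, -, -, h5⟩ := block_facts (G t)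
  have h1 : HasDerivAt (fun s => (mat (G s)).toBlocks₁₁) G'.toBlocks₁₁ t :=
    (block₁₁ (n := n) (m := m)).hasFDerivAt.comp_hasDerivAt t hG
  have h2 : HasDerivAt (fun s => (mat (G s)).toBlocks₂₁) G'.toBlocks₂₁ t :=
    (block₂₁ (n := n) (m := m)).hasFDerivAt.comp_hasDerivAt t hG
  refine (hasDerivAt_matrix_mul h2 (hasDerivAt_matrix_inv h1 ua)).congr_deriv ?_
  -- With G' = GK and Z = ca⁻¹, the derivative is (c' − Za')a⁻¹. The block K₁₁ cancels because Za =
  -- c, and K₂₁ keeps the factor d − Zb = (d*)⁻¹.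
  have hG' : G' = mat (G t) * ((mat (G t))⁻¹ * G') := by
    rw [← Matrix.mul_assoc, mat_mul_inv, Matrix.one_mul]
  generalize (mat (G t))⁻¹ * G' = K at *
  rw [hG', toBlocks₁₁_mul, toBlocks₂₁_mul, ← h5]
  have hc := coord_mul_toBlocks₁₁ (G t)
  have e : (mat (G t)).toBlocks₂₁ * -((mat (G t)).toBlocks₁₁⁻¹ *
      ((mat (G t)).toBlocks₁₁ * K.toBlocks₁₁ + (mat (G t)).toBlocks₁₂ * K.toBlocks₂₁) *
        (mat (G t)).toBlocks₁₁⁻¹) = -(coord (projD (G t)) *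
      ((mat (G t)).toBlocks₁₁ * K.toBlocks₁₁ + (mat (G t)).toBlocks₁₂ * K.toBlocks₂₁)) *
        (mat (G t)).toBlocks₁₁⁻¹ := by
    rw [coord_projD]; simp only [Matrix.mul_neg, Matrix.neg_mul, Matrix.mul_assoc]
  rw [e, ← Matrix.add_mul]
  congr 1
  rw [Matrix.mul_add, ← Matrix.mul_assoc (coord _), hc, Matrix.sub_mul,
    ← Matrix.mul_assoc (coord _)]
  abel

theorem contDiff_coord {G : ℝ → U n m} (hG : ContDiff ℝ ∞ (fun s => mat (G s))) :
    ContDiff ℝ ∞ (fun s => coord (projD (G s))) := by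
  have h1 : ContDiff ℝ ∞ (fun s => (mat (G s)).toBlocks₁₁) :=
    (block₁₁ (n := n) (m := m)).contDiff.comp hG
  have h2 : ContDiff ℝ ∞ (fun s => (mat (G s)).toBlocks₂₁) :=
    (block₂₁ (n := n) (m := m)).contDiff.comp hG
  exact contDiff_matrix_mul h2 (contDiff_matrix_inv h1 fun t => (block_facts (G t)).1)

/-! ### Geodesics -/

theorem hat_real_smul (t : ℝ) (Y : Matrix (Fin m) (Fin n) ℂ) :
    (hat (t • Y) : Mat n m) = t • hat Y := by
  simp [hat, Matrix.fromBlocks_smul, Matrix.conjTranspose_smul]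

theorem mat_mul_expHat (g : U n m) (t : ℝ) (Y : Matrix (Fin m) (Fin n) ℂ) :
    mat (g * expHat (t • Y)) = mat g * NormedSpace.exp (t • hat Y) := by
  rw [← hat_real_smul]; rfl

theorem hasDerivAt_mat_mul_expHat (g : U n m) (Y : Matrix (Fin m) (Fin n) ℂ) (t : ℝ) :
    HasDerivAt (fun s : ℝ => mat (g * expHat (s • Y))) (mat (g * expHat (t • Y)) * hat Y) t := by
  simp only [mat_mul_expHat]
  have := (hasDerivAt_exp_smul_const (𝕂 := ℝ) (hat Y) t).const_mul (mat g)
  rwa [← Matrix.mul_assoc] at this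

theorem contDiff_mat_mul_expHat (g : U n m) (Y : Matrix (Fin m) (Fin n) ℂ) :
    ContDiff ℝ ∞ (fun s : ℝ => mat (g * expHat (s • Y))) := by
  have h : ContDiff ℝ ∞ (NormedSpace.exp : Mat n m → Mat n m) := by
    rw [contDiff_iff_contDiffAt]
    intro x
    exact (NormedSpace.exp_analytic (𝕂 := ℝ) x).contDiffAt
  simp only [mat_mul_expHat]
  exact contDiff_const.mul (h.comp (contDiff_id.smul contDiff_const))

theorem deriv_coord_mul_expHat (g : U n m) (Y : Matrix (Fin m) (Fin n) ℂ) (t : ℝ) :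
    deriv (fun s : ℝ => coord (projD (g * expHat (s • Y)))) t =
      (((mat (g * expHat (t • Y))).toBlocks₂₂)ᴴ)⁻¹ * Y *
        ((mat (g * expHat (t • Y))).toBlocks₁₁)⁻¹ := by
  rw [(hasDerivAt_coord (hasDerivAt_mat_mul_expHat g Y t)).deriv, ← Matrix.mul_assoc,
    mat_inv_mul, Matrix.one_mul]
  rfl

/-- Since (1 − Z*Z)⁻¹ = aa* and (1 − ZZ*)⁻¹ = dd*, the inverses in the horizontal velocity cancel.
What remains is polynomial in the blocks of g and their adjoints, and so is easy to differentiate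
along a geodesic. -/
theorem metricD_left_velocity (g : U n m) (Y V : Matrix (Fin m) (Fin n) ℂ) :
    metricD (coord (projD g)) ((((mat g).toBlocks₂₂)ᴴ)⁻¹ * Y * ((mat g).toBlocks₁₁)⁻¹) V =
      (Matrix.trace ((mat g).toBlocks₁₁ * Yᴴ * ((mat g).toBlocks₂₂)ᴴ * V)).re := by
  obtain ⟨ua, ud, h1, h2, -⟩ := block_facts g
  have ada := (Matrix.isUnit_iff_isUnit_det _).1 ua
  have add := (Matrix.isUnit_iff_isUnit_det _).1 ud
  unfold metricD
  rw [h1, h2]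
  generalize (mat g).toBlocks₁₁ = a at *
  generalize (mat g).toBlocks₂₂ = d at *
  have e1 : ((dᴴ)⁻¹ * Y * a⁻¹)ᴴ = (a⁻¹)ᴴ * Yᴴ * d⁻¹ := by
    rw [Matrix.conjTranspose_mul, Matrix.conjTranspose_mul, ← Matrix.conjTranspose_nonsing_inv,
      Matrix.conjTranspose_conjTranspose, Matrix.mul_assoc]
  have e2 : aᴴ * (a⁻¹)ᴴ = 1 := by
    rw [← Matrix.conjTranspose_mul, Matrix.nonsing_inv_mul _ ada, Matrix.conjTranspose_one]
  congr 2
  calc a * aᴴ * ((dᴴ)⁻¹ * Y * a⁻¹)ᴴ * (d * dᴴ) * V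
      = a * (aᴴ * (a⁻¹)ᴴ) * Yᴴ * (d⁻¹ * d) * dᴴ * V := by rw [e1]; simp only [Matrix.mul_assoc]
    _ = a * Yᴴ * dᴴ * V := by
      rw [e2, Matrix.nonsing_inv_mul _ add]; simp only [Matrix.mul_one]

theorem reTrace_conjTranspose {k : ℕ} (A : Matrix (Fin k) (Fin k) ℂ) :
    (Matrix.trace Aᴴ).re = (Matrix.trace A).re := by
  simp [Matrix.trace_conjTranspose]

/-- This provides the right-hand side of the geodesic equation. Differentiating each of the two
inverse factors gives a pair of terms that are adjoint up to a cyclic permutation; they have the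
same real trace, whence the factor 2. -/
theorem hasDerivAt_metricD (g : U n m) (Y V : Matrix (Fin m) (Fin n) ℂ) :
    HasDerivAt (fun s : ℝ => metricD (coord (projD g) + s • V)
        ((((mat g).toBlocks₂₂)ᴴ)⁻¹ * Y * ((mat g).toBlocks₁₁)⁻¹)
        ((((mat g).toBlocks₂₂)ᴴ)⁻¹ * Y * ((mat g).toBlocks₁₁)⁻¹))
      (2 * (Matrix.trace ((mat g).toBlocks₁₂ * Y * Yᴴ * ((mat g).toBlocks₂₂)ᴴ * V +
        (mat g).toBlocks₁₁ * Yᴴ * Y * ((mat g).toBlocks₂₁)ᴴ * V)).re) 0 := by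
  obtain ⟨ua, ud, h1, h2, -⟩ := block_facts g
  have ada := (Matrix.isUnit_iff_isUnit_det _).1 ua
  have add := (Matrix.isUnit_iff_isUnit_det _).1 ud
  have hc := coord_mul_toBlocks₁₁ g
  have hb := conjTranspose_coord_mul_toBlocks₂₂ g
  unfold metricD
  generalize (mat g).toBlocks₁₁ = a at *
  generalize (mat g).toBlocks₂₂ = d at *
  generalize (mat g).toBlocks₁₂ = b at *
  generalize (mat g).toBlocks₂₁ = c at *
  set Z := coord (projD g)
  set T := (dᴴ)⁻¹ * Y * a⁻¹ with hT
  have uaH : IsUnit (aᴴ) := ua.star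
  have udH : IsUnit (dᴴ) := ud.star
  have hline : HasDerivAt (fun s : ℝ => Z + s • V) V 0 := by
    simpa using ((hasDerivAt_id (0 : ℝ)).smul_const V).const_add Z
  have hlineH := hasDerivAt_conjTranspose hline
  have hM0 := (hasDerivAt_matrix_mul hlineH hline).const_sub 1
  have hN0 := (hasDerivAt_matrix_mul hline hlineH).const_sub 1
  have uM : IsUnit (1 - Zᴴ * Z) := by
    rw [← Matrix.isUnit_nonsing_inv_iff, h1]; exact ua.mul uaH
  have uN : IsUnit (1 - Z * Zᴴ) := by
    rw [← Matrix.isUnit_nonsing_inv_iff, h2]; exact ud.mul udH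
  have hM := hasDerivAt_matrix_inv hM0 (by simpa using uM)
  have hN := hasDerivAt_matrix_inv hN0 (by simpa using uN)
  have hall := hasDerivAt_reTrace (hasDerivAt_matrix_mul (hasDerivAt_matrix_mul
    (hasDerivAt_matrix_mul hM (hasDerivAt_const (0 : ℝ) Tᴴ)) hN) (hasDerivAt_const (0 : ℝ) T))
  refine hall.congr_deriv ?_
  simp only [zero_smul, add_zero, h1, h2, Matrix.mul_zero, zero_add, Matrix.mul_neg,
    Matrix.neg_mul, neg_neg]
  have e1 : Tᴴ = (a⁻¹)ᴴ * Yᴴ * d⁻¹ := by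
    rw [hT, Matrix.conjTranspose_mul, Matrix.conjTranspose_mul, ← Matrix.conjTranspose_nonsing_inv,
      Matrix.conjTranspose_conjTranspose, Matrix.mul_assoc]
  have e2 : aᴴ * (a⁻¹)ᴴ = 1 := by
    rw [← Matrix.conjTranspose_mul, Matrix.nonsing_inv_mul _ ada, Matrix.conjTranspose_one]
  have e3 : aᴴ * Tᴴ * d = Yᴴ := by
    rw [e1]
    calc aᴴ * ((a⁻¹)ᴴ * Yᴴ * d⁻¹) * d = (aᴴ * (a⁻¹)ᴴ) * Yᴴ * (d⁻¹ * d) := by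
          simp only [Matrix.mul_assoc]
      _ = Yᴴ := by rw [e2, Matrix.nonsing_inv_mul _ add, Matrix.one_mul, Matrix.mul_one]
  have e4 : dᴴ * T * a = Y := by
    have := congrArg Matrix.conjTranspose e3
    simpa [Matrix.conjTranspose_mul, Matrix.mul_assoc] using this
  have e5 : dᴴ * T = Y * a⁻¹ := by
    rw [← e4, Matrix.mul_assoc (dᴴ * T), Matrix.mul_nonsing_inv _ ada, Matrix.mul_one]
  have hcH : aᴴ * Zᴴ = cᴴ := by rw [← Matrix.conjTranspose_mul, hc]
  have hbH : dᴴ * Z = bᴴ := by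
    rw [← hb, Matrix.conjTranspose_mul, Matrix.conjTranspose_conjTranspose]
  -- The two minus signs, from 1 − ZZ* and from the derivative of the inverse, have cancelled. The
  -- outer factors a and a⁻¹ are removed from the trace by `k3`.
  have k1 : a * aᴴ * Tᴴ * (d * dᴴ * (Z * Vᴴ + V * Zᴴ) * (d * dᴴ)) * T =
      a * (Yᴴ * (bᴴ * Vᴴ * d + dᴴ * V * b) * Y * a⁻¹) := by
    calc a * aᴴ * Tᴴ * (d * dᴴ * (Z * Vᴴ + V * Zᴴ) * (d * dᴴ)) * T
        = a * (aᴴ * Tᴴ * d) * ((dᴴ * Z) * Vᴴ * d + dᴴ * V * (Zᴴ * d)) * (dᴴ * T) := by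
          simp only [Matrix.mul_assoc, Matrix.mul_add, Matrix.add_mul]
      _ = _ := by rw [e3, e5, hb, hbH]; simp only [Matrix.mul_assoc]
  have k2 : a * aᴴ * (Zᴴ * V + Vᴴ * Z) * (a * aᴴ) * Tᴴ * (d * dᴴ) * T =
      a * ((cᴴ * V * a + aᴴ * Vᴴ * c) * Yᴴ * Y * a⁻¹) := by
    calc a * aᴴ * (Zᴴ * V + Vᴴ * Z) * (a * aᴴ) * Tᴴ * (d * dᴴ) * T
        = a * ((aᴴ * Zᴴ) * V * a + aᴴ * Vᴴ * (Z * a)) * (aᴴ * Tᴴ * d) * (dᴴ * T) := by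
          simp only [Matrix.mul_assoc, Matrix.mul_add, Matrix.add_mul]
      _ = _ := by rw [e3, e5, hc, hcH]; simp only [Matrix.mul_assoc]
  have k3 : ∀ K : Matrix (Fin n) (Fin n) ℂ, Matrix.trace (a * (K * a⁻¹)) = Matrix.trace K := by
    intro K
    rw [← Matrix.mul_assoc, Matrix.trace_mul_cycle, Matrix.nonsing_inv_mul _ ada, Matrix.one_mul]
  rw [Matrix.add_mul, k1, k2, Matrix.trace_add, k3, k3, Matrix.mul_add, Matrix.add_mul,
    Matrix.add_mul, Matrix.add_mul]
  simp only [Matrix.trace_add, Complex.add_re]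
  have t1 : (Matrix.trace (Yᴴ * (bᴴ * Vᴴ * d) * Y)).re =
      (Matrix.trace (Yᴴ * (dᴴ * V * b) * Y)).re := by
    rw [← reTrace_conjTranspose]
    simp [Matrix.conjTranspose_mul, Matrix.mul_assoc]
  have t2 : Matrix.trace (Yᴴ * (dᴴ * V * b) * Y) = Matrix.trace (b * Y * Yᴴ * dᴴ * V) := by
    have : Yᴴ * (dᴴ * V * b) * Y = (Yᴴ * dᴴ * V) * (b * Y) := by simp only [Matrix.mul_assoc]
    rw [this, Matrix.trace_mul_comm]
    simp only [Matrix.mul_assoc]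
  have t3 : (Matrix.trace (aᴴ * Vᴴ * c * Yᴴ * Y)).re =
      (Matrix.trace (a * Yᴴ * Y * cᴴ * V)).re := by
    rw [← reTrace_conjTranspose]
    have : (aᴴ * Vᴴ * c * Yᴴ * Y)ᴴ = (Yᴴ * Y * cᴴ * V) * a := by
      simp [Matrix.conjTranspose_mul, Matrix.mul_assoc]
    rw [this, Matrix.trace_mul_comm]
    simp only [Matrix.mul_assoc]
  have t4 : Matrix.trace (cᴴ * V * a * Yᴴ * Y) = Matrix.trace (a * Yᴴ * Y * cᴴ * V) := by
    have : cᴴ * V * a * Yᴴ * Y = (cᴴ * V) * (a * Yᴴ * Y) := by simp only [Matrix.mul_assoc]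
    rw [this, Matrix.trace_mul_comm]
    simp only [Matrix.mul_assoc]
  rw [t1, t2, t3, t4]
  ring

/-- Along the curve a' = bY and d' = cY*, so the product rule for aY*d* yields exactly half of the
derivative in `hasDerivAt_metricD`. -/
theorem isGeodesic_mul_expHat (g : U n m) (Y : Matrix (Fin m) (Fin n) ℂ) :
    IsGeodesic (fun t : ℝ => projD (g * expHat (t • Y))) := by
  refine ⟨contDiff_coord (contDiff_mat_mul_expHat g Y), fun t V => ?_⟩
  simp only [deriv_coord_mul_expHat]
  rw [(hasDerivAt_metricD (g * expHat (t • Y)) Y V).deriv]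
  simp only [metricD_left_velocity]
  have hM := hasDerivAt_mat_mul_expHat g Y t
  set M := fun s : ℝ => mat (g * expHat (s • Y))
  have h1 : HasDerivAt (fun s => (M s).toBlocks₁₁) (M t * hat Y).toBlocks₁₁ t :=
    (block₁₁ (n := n) (m := m)).hasFDerivAt.comp_hasDerivAt t hM
  have h2 : HasDerivAt (fun s => (M s).toBlocks₂₂) (M t * hat Y).toBlocks₂₂ t :=
    (block₂₂ (n := n) (m := m)).hasFDerivAt.comp_hasDerivAt t hM
  have hall := hasDerivAt_reTrace (hasDerivAt_matrix_mul (hasDerivAt_matrix_mul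
    (hasDerivAt_matrix_mul h1 (hasDerivAt_const t Yᴴ)) (hasDerivAt_conjTranspose h2))
    (hasDerivAt_const t V))
  rw [hall.deriv, toBlocks₁₁_mul, toBlocks₂₂_mul]
  simp only [hat, Matrix.toBlocks_fromBlocks₁₁, Matrix.toBlocks_fromBlocks₁₂,
    Matrix.toBlocks_fromBlocks₂₁, Matrix.toBlocks_fromBlocks₂₂, Matrix.mul_zero, zero_add,
    add_zero, Matrix.conjTranspose_mul, Matrix.conjTranspose_conjTranspose]
  rw [← mul_assoc, one_div, inv_mul_cancel₀ (two_ne_zero' ℝ), one_mul]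
  congr 2
  simp only [Matrix.mul_assoc, Matrix.add_mul]
  abel

end Blocks

/-! ### The surface `S` -/

/-- The tangent vector of `rot V` with components `a`, `b`. -/
def rotTangent {n m : ℕ} (V : Matrix (Fin m) (Fin n) ℂ) (a b : ℂ) : Mat n m :=
  Matrix.fromBlocks (a • (Vᴴ * V)) ((starRingEnd ℂ) b • Vᴴ) (b • V)
    ((starRingEnd ℂ) a • (V * Vᴴ))

section PartialIsometry

variable {n m : ℕ} {V : Matrix (Fin m) (Fin n) ℂ}

/-- `rot V` is real affine in (a, b), although not complex affine because of the conjugates; its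
derivative is therefore `rotTangent`. -/
theorem rot_eq_add_rotTangent (a b : ℂ) :
    rot V a b = (1 - rotTangent V 1 0) + rotTangent V a b := by
  rw [← Matrix.fromBlocks_one, rot, rotTangent, rotTangent,
    sub_eq_add_neg (Matrix.fromBlocks _ _ _ _), Matrix.fromBlocks_neg,
    Matrix.fromBlocks_add, Matrix.fromBlocks_add]
  congr 1
  · module
  · simp
  · simp
  · rw [map_one]; module

theorem rot_mul_rotTangent (hV : V * Vᴴ * V = V) (a b a' b' : ℂ) :
    rot V a b * rotTangent V a' b' =
      rotTangent V (a * a' + (starRingEnd ℂ) b * b') (b * a' + (starRingEnd ℂ) a * b') := by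
  have h1 : V * (Vᴴ * V) = V := by rw [← Matrix.mul_assoc, hV]
  have h2 := conjTranspose_mul_partialIsometry hV
  have h3 : Vᴴ * V * Vᴴ = Vᴴ := by rw [Matrix.mul_assoc, h2]
  have h4 : Vᴴ * V * (Vᴴ * V) = Vᴴ * V := by rw [← Matrix.mul_assoc, h3]
  have h5 : V * Vᴴ * (V * Vᴴ) = V * Vᴴ := by rw [← Matrix.mul_assoc, hV]
  simp only [rot, rotTangent, Matrix.fromBlocks_multiply, Matrix.add_mul, Matrix.one_mul,
    Matrix.smul_mul, Matrix.mul_smul, h1, h2, h3, h4, h5, hV, map_add, map_mul,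
    Complex.conj_conj]
  congr 1 <;> module

theorem hasDerivWithinAt_rot {a b : ℝ → ℂ} {a' b' : ℂ} {s : Set ℝ} {t : ℝ}
    (ha : HasDerivWithinAt a a' s t) (hb : HasDerivWithinAt b b' s t) :
    HasDerivWithinAt (fun r => rot V (a r) (b r)) (rotTangent V a' b') s t := by
  let L : ℂ × ℂ →ₗ[ℝ] Mat n m :=
    { toFun := fun p => rotTangent V p.1 p.2
      map_add' := fun p q => by
        simp only [rotTangent, Matrix.fromBlocks_add, Prod.fst_add, Prod.snd_add, map_add, add_smul]
      map_smul' := fun r p => by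
        simp [rotTangent, Matrix.fromBlocks_smul, mul_smul] }
  simp only [rot_eq_add_rotTangent]
  exact ((L.toContinuousLinearMap.hasFDerivAt (x := (a t, b t))).comp_hasDerivWithinAt t
    (ha.prodMk hb)).const_add _

/-- Only the off-diagonal blocks meet; they contribute equally, which cancels the factor ½ of the
metric, and the component a drops out. -/
theorem ip_rotTangent_hat (a b v : ℂ) :
    ip (rotTangent V a b) (hat (v • V)) =
      ((starRingEnd ℂ) b * v).re * (Matrix.trace (Vᴴ * V)).re := by
  have e3 : ∀ (P : Matrix (Fin n) (Fin n) ℂ) (A : Matrix (Fin n) (Fin m) ℂ)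
      (B : Matrix (Fin m) (Fin n) ℂ) (Q : Matrix (Fin m) (Fin m) ℂ),
      Matrix.trace (Matrix.fromBlocks P A B Q) = Matrix.trace P + Matrix.trace Q := by
    intro P A B Q; simp [Matrix.trace, Fintype.sum_sum_type]
  have e4 : (Matrix.trace (Vᴴ * V)).im = 0 := by
    have : (starRingEnd ℂ) (Matrix.trace (Vᴴ * V)) = Matrix.trace (Vᴴ * V) := by
      rw [starRingEnd_apply, ← Matrix.trace_conjTranspose, Matrix.conjTranspose_mul,
        Matrix.conjTranspose_conjTranspose]
    exact Complex.conj_eq_iff_im.1 this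
  simp only [ip, rotTangent, hat, Matrix.fromBlocks_conjTranspose, Matrix.fromBlocks_multiply, e3,
    Matrix.mul_zero, zero_add, add_zero, Matrix.conjTranspose_smul, Matrix.smul_mul,
    Matrix.mul_smul, smul_smul, Matrix.trace_smul, Matrix.conjTranspose_conjTranspose,
    Matrix.trace_mul_comm V Vᴴ, smul_eq_mul]
  simp [Complex.mul_re, e4]
  ring

theorem contDiff_exp_hat_smul :
    ContDiff ℝ ∞ (fun w : ℂ => (NormedSpace.exp (hat (w • V)) : Mat n m)) := by
  have h : ContDiff ℝ ∞ (NormedSpace.exp : Mat n m → Mat n m) := by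
    rw [contDiff_iff_contDiffAt]
    intro x
    exact (NormedSpace.exp_analytic (𝕂 := ℝ) x).contDiffAt
  let L : ℂ →ₗ[ℝ] Mat n m :=
    { toFun := fun w => hat (w • V)
      map_add' := fun p q => by
        simp only [hat, Matrix.fromBlocks_add, add_smul, Matrix.conjTranspose_add, add_zero]
      map_smul' := fun r p => by
        simp [hat, Matrix.fromBlocks_smul, mul_smul] }
  exact h.comp L.toContinuousLinearMap.contDiff

end PartialIsometry

/-! ### The functions sinh and cosh in polar form -/

/-- The formula through ‖w‖ hides the smoothness at 0. It becomes visible for n = m = 1, V = 1,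
where the function is a matrix entry of the smooth map w ↦ e^{hat w}. -/
theorem contDiff_sinhPolar : ContDiff ℝ ∞ sinhPolar := by
  have hV : (1 : Matrix (Fin 1) (Fin 1) ℂ) * 1ᴴ * 1 = 1 := by simp
  have h := contDiff_exp_hat_smul (V := (1 : Matrix (Fin 1) (Fin 1) ℂ))
  let L : Mat 1 1 →ₗ[ℝ] ℂ :=
    { toFun := fun M => M (Sum.inr 0) (Sum.inl 0), map_add' := fun _ _ => rfl,
      map_smul' := fun _ _ => rfl }
  have h2 : ContDiff ℝ ∞ (fun w : ℂ => L (NormedSpace.exp (hat (w • 1)))) :=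
    L.toContinuousLinearMap.contDiff.comp h
  convert h2 using 2 with w
  change sinhPolar w = (NormedSpace.exp (hat (w • 1)) : Mat 1 1) (Sum.inr 0) (Sum.inl 0)
  rw [exp_hat_smul hV]
  simp [rot]

theorem contDiff_cosh_norm : ContDiff ℝ ∞ (fun w : ℂ => ((Real.cosh ‖w‖ : ℝ) : ℂ)) := by
  have hV : (1 : Matrix (Fin 1) (Fin 1) ℂ) * 1ᴴ * 1 = 1 := by simp
  have h := contDiff_exp_hat_smul (V := (1 : Matrix (Fin 1) (Fin 1) ℂ))
  let L : Mat 1 1 →ₗ[ℝ] ℂ :=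
    { toFun := fun M => M (Sum.inl 0) (Sum.inl 0), map_add' := fun _ _ => rfl,
      map_smul' := fun _ _ => rfl }
  have h2 : ContDiff ℝ ∞ (fun w : ℂ => L (NormedSpace.exp (hat (w • 1)))) :=
    L.toContinuousLinearMap.contDiff.comp h
  convert h2 using 2 with w
  change ((Real.cosh ‖w‖ : ℝ) : ℂ) = (NormedSpace.exp (hat (w • 1)) : Mat 1 1) (Sum.inl 0) (Sum.inl 0)
  rw [exp_hat_smul hV]
  simp [rot]

theorem sinhPolar_injective : Function.Injective sinhPolar := by
  intro w w' h
  have h1 : ‖w‖ = ‖w'‖ := by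
    have := congrArg norm h
    rw [norm_sinhPolar, norm_sinhPolar] at this
    exact Real.sinh_injective this
  rcases eq_or_ne w' 0 with rfl | hw
  · simpa using h1
  · have hr : 0 < ‖w'‖ := norm_pos_iff.2 hw
    have hs : (Real.sinh ‖w'‖ / ‖w'‖ : ℝ) ≠ 0 := (div_pos (Real.sinh_pos_iff.2 hr) hr).ne'
    rw [sinhPolar, sinhPolar, h1] at h
    exact mul_left_cancel₀ (by exact_mod_cast hs) h

theorem sinhPolar_surjective : Function.Surjective sinhPolar := by
  intro s
  rcases eq_or_ne s 0 with rfl | hs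
  · exact ⟨0, by simp [sinhPolar]⟩
  have hn : 0 < ‖s‖ := norm_pos_iff.2 hs
  have ha : 0 < Real.arsinh ‖s‖ := Real.arsinh_pos_iff.2 hn
  -- The argument of s is kept, and its modulus is replaced by arsinh‖s‖.
  refine ⟨((Real.arsinh ‖s‖ / ‖s‖ : ℝ) : ℂ) * s, ?_⟩
  have h1 : ‖((Real.arsinh ‖s‖ / ‖s‖ : ℝ) : ℂ) * s‖ = Real.arsinh ‖s‖ := by
    rw [norm_mul, Complex.norm_real, Real.norm_of_nonneg (by positivity)]
    field_simp
  rw [sinhPolar, h1, Real.sinh_arsinh, ← mul_assoc, ← Complex.ofReal_mul,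
    div_mul_div_cancel₀ ha.ne', div_self hn.ne']
  simp

/-! ### Points of the surface, and total geodesy -/

section Surface

variable {n m : ℕ} {V X : Matrix (Fin m) (Fin n) ℂ} {κ : ℝ}

theorem mat_surfaceLift (hV : V * Vᴴ * V = V) (hW : unitize X = κ • V) (g : U n m) (w : ℂ) :
    mat (surfaceLift X g w) =
      mat g * rot V (Real.cosh ‖(κ : ℂ) * w‖) (sinhPolar (κ * w)) := by
  have : w • unitize X = ((κ : ℂ) * w) • V := by
    rw [hW, mul_comm, mul_smul]; rfl
  rw [← mat_expHat_smul hV, ← this]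
  rfl

theorem mat_surfaceLift_inv_mul (hV : V * Vᴴ * V = V) (hW : unitize X = κ • V) (g : U n m)
    (w : ℂ) (M : Mat n m) :
    (mat (surfaceLift X g w))⁻¹ * (mat g * M) =
      rot V (Real.cosh ‖(κ : ℂ) * w‖) (-sinhPolar (κ * w)) * M := by
  rw [mat_surfaceLift hV hW, Matrix.mul_inv_rev, Matrix.inv_eq_right_inv (rot_mul_rot_neg hV _),
    Matrix.mul_assoc, ← Matrix.mul_assoc (mat g)⁻¹, mat_inv_mul, Matrix.one_mul]

/-- The criterion `projD_eq_iff` is applied to a product of two matrices of type `rot`, whose lower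
left block is a multiple of V. The condition compares the coordinates b/a in the hyperbolic disc,
with denominators cleared. -/
theorem surfacePoint_eq_iff (hV : V * Vᴴ * V = V) (hV0 : V ≠ 0) (hW : unitize X = κ • V)
    (g g' : U n m) (a b : ℂ) (hg' : mat g' = mat g * rot V a b) (w : ℂ) :
    surfacePoint X g w = projD g' ↔
      Real.cosh ‖(κ : ℂ) * w‖ * b = sinhPolar (κ * w) * a := by
  rw [surfacePoint, projD_eq_iff, hg', mat_surfaceLift_inv_mul hV hW, rot_mul hV, rot,
    Matrix.toBlocks_fromBlocks₂₁, smul_eq_zero, or_iff_left hV0, Complex.conj_ofReal, neg_mul,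
    neg_add_eq_zero, eq_comm]

theorem surfacePoint_injective (hV : V * Vᴴ * V = V) (hV0 : V ≠ 0) (hκ : κ ≠ 0)
    (hW : unitize X = κ • V) (g : U n m) : Function.Injective (surfacePoint X g) := by
  intro w w' h
  change _ = projD (surfaceLift X g w') at h
  rw [surfacePoint_eq_iff hV hV0 hW g _ _ _ (mat_surfaceLift hV hW g w')] at h
  refine mul_left_cancel₀ (show (κ : ℂ) ≠ 0 by exact_mod_cast hκ) ?_
  generalize (κ : ℂ) * w = x at *
  generalize (κ : ℂ) * w' = y at *
  -- Taking moduli leaves tanh‖x‖ = tanh‖y‖ with denominators cleared, that is, sinh(‖y‖ − ‖x‖) = 0.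
  have h1 : Real.cosh ‖x‖ * Real.sinh ‖y‖ = Real.sinh ‖x‖ * Real.cosh ‖y‖ := by
    have := congrArg norm h
    rwa [norm_mul, norm_mul, norm_sinhPolar, norm_sinhPolar, Complex.norm_real, Complex.norm_real,
      Real.norm_of_nonneg (Real.cosh_pos _).le, Real.norm_of_nonneg (Real.cosh_pos _).le] at this
  have h2 : ‖y‖ = ‖x‖ := by
    have : Real.sinh (‖y‖ - ‖x‖) = 0 := by rw [Real.sinh_sub]; linarith
    rw [Real.sinh_eq_zero] at this
    linarith
  have h3 : sinhPolar y = sinhPolar x := by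
    rw [h2, mul_comm (sinhPolar x)] at h
    exact mul_left_cancel₀ (by exact_mod_cast (Real.cosh_pos _).ne') h
  exact (sinhPolar_injective h3).symm

/-- The product is again g times some `rot V a b` with |a|² − |b|² = 1. A phase in U(n) × U(m),
invisible in D, makes a positive, and then the matrix is an exponential. -/
theorem projD_surfaceLift_mul_expHat_mem (hV : V * Vᴴ * V = V) (hV0 : V ≠ 0) (hκ : κ ≠ 0)
    (hW : unitize X = κ • V) (g : U n m) (w v : ℂ) :
    projD (surfaceLift X g w * expHat (v • V)) ∈ surface X g := by
  set C₀ : ℝ := Real.cosh ‖(κ : ℂ) * w‖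
  set S₀ := sinhPolar (κ * w)
  set C : ℝ := Real.cosh ‖v‖
  set S := sinhPolar v
  have hmat : mat (surfaceLift X g w * expHat (v • V)) =
      mat g * rot V (C₀ * C + (starRingEnd ℂ) S₀ * S) (S₀ * C + C₀ * S) := by
    change mat (surfaceLift X g w) * mat (expHat (v • V)) = _
    rw [mat_surfaceLift hV hW, mat_expHat_smul hV, Matrix.mul_assoc, rot_mul hV,
      Complex.conj_ofReal]
  set a : ℂ := C₀ * C + (starRingEnd ℂ) S₀ * S with ha
  set b : ℂ := S₀ * C + C₀ * S with hb
  have hab : (starRingEnd ℂ) a * a - (starRingEnd ℂ) b * b = 1 := by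
    have h1 := cosh_sq_sub_sinhPolar (κ * w)
    have h2 := cosh_sq_sub_sinhPolar v
    simp only [ha, hb, map_add, map_mul, Complex.conj_ofReal, Complex.conj_conj]
    linear_combination ((C : ℂ) * C - (starRingEnd ℂ) S * S) * h1 + h2
  have hab' : ‖a‖ ^ 2 = 1 + ‖b‖ ^ 2 := by
    rw [norm_sq_mul_conj, norm_sq_mul_conj] at hab
    have : ‖a‖ ^ 2 - ‖b‖ ^ 2 = 1 := by exact_mod_cast hab
    linarith
  have ha0 : 0 < ‖a‖ := by
    rcases (norm_nonneg a).eq_or_lt with h | h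
    · rw [← h] at hab'; nlinarith [sq_nonneg ‖b‖]
    · exact h
  have ha1 : a ≠ 0 := norm_pos_iff.1 ha0
  -- Multiplication by the phase |a|/a turns (a, b) into (|a|, b|a|/a).
  obtain ⟨x, hx⟩ := sinhPolar_surjective (b * ‖a‖ / a)
  refine ⟨x / κ, ?_⟩
  rw [surfacePoint_eq_iff hV hV0 hW g _ a b hmat]
  have hx' : (κ : ℂ) * (x / κ) = x := by
    rw [mul_div_cancel₀]; exact_mod_cast hκ
  have hc : Real.cosh ‖x‖ = ‖a‖ := by
    have h1 : Real.sinh ‖x‖ = ‖b‖ := by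
      rw [← norm_sinhPolar, hx, norm_div, norm_mul, Complex.norm_real, norm_norm]
      field_simp
    have h2 := Real.cosh_sq ‖x‖
    rw [h1, add_comm, ← hab'] at h2
    exact (sq_eq_sq₀ (Real.cosh_pos _).le ha0.le).1 h2
  rw [hx', hc, hx, div_mul_cancel₀ _ ha1, mul_comm]

/-- Moving σ(0) to the origin by G⁻¹ turns S into a subset of the complex line of multiples of V.
The velocity of σ therefore moves to some yV, and G e^{t hat(yV)} projects to a geodesic with this
velocity that stays in S. -/
theorem isTotallyGeodesic_surface (hV : V * Vᴴ * V = V) (hV0 : V ≠ 0) (hκ : κ ≠ 0)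
    (hW : unitize X = κ • V) (hq : Matrix.trace (Vᴴ * V) ≠ 0) (g : U n m) :
    IsTotallyGeodesic (surface X g) := by
  intro σ hσ hS
  obtain ⟨w₀, hw₀⟩ := hS 0
  set G := surfaceLift X g w₀ with hG
  have hσ0 : σ 0 = projD G := hw₀.symm
  have hderiv : HasDerivAt (fun t => coord (σ t)) (deriv (fun t => coord (σ t)) 0) 0 :=
    (hσ.differentiable (by simp) 0).hasDerivAt
  set Z' := deriv (fun t => coord (σ t)) 0
  obtain ⟨ua, ud, -, -, -⟩ := block_facts G
  have ada := (Matrix.isUnit_iff_isUnit_det _).1 ua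
  have add := (Matrix.isUnit_iff_isUnit_det _).1 ud
  have hinv := mat_inv_fromBlocks G
  have hb := conjTranspose_coord_mul_toBlocks₂₂ G
  have hc := coord_mul_toBlocks₁₁ G
  have hii := mat_inv_mul G
  set a := (mat G).toBlocks₁₁
  set b := (mat G).toBlocks₁₂
  set c := (mat G).toBlocks₂₁
  set d := (mat G).toBlocks₂₂
  have hac : aᴴ * a - cᴴ * c = 1 := by
    have := congrArg Matrix.toBlocks₁₁ hii
    rw [toBlocks₁₁_mul, hinv, Matrix.toBlocks_fromBlocks₁₁, Matrix.toBlocks_fromBlocks₁₂,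
      ← Matrix.fromBlocks_one, Matrix.toBlocks_fromBlocks₁₁, Matrix.neg_mul,
      ← sub_eq_add_neg] at this
    exact this
  -- f B⁻¹ is the chart coordinate of G⁻¹σ: the fractional linear action of G⁻¹ = [[a*, −c*], [−b*,
  -- d*]].
  let f : ℝ → Matrix (Fin m) (Fin n) ℂ := fun t => dᴴ * coord (σ t) - bᴴ
  let B : ℝ → Matrix (Fin n) (Fin n) ℂ := fun t => aᴴ - cᴴ * coord (σ t)
  have hf0 : f 0 = 0 := by
    simp only [f]
    rw [hσ0, ← hb, Matrix.conjTranspose_mul, Matrix.conjTranspose_conjTranspose, sub_self]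
  have hB0 : B 0 * a = 1 := by
    simp only [B]
    rw [hσ0, Matrix.sub_mul, Matrix.mul_assoc, hc, hac]
  have hB0i : (B 0)⁻¹ = a := Matrix.inv_eq_right_inv hB0
  have hfd : HasDerivAt f (dᴴ * Z') 0 := by
    exact ((hasDerivAt_matrix_mul (hasDerivAt_const (0 : ℝ) dᴴ) hderiv).sub_const bᴴ).congr_deriv
      (by simp)
  have hBd : HasDerivAt B (-(cᴴ * Z')) 0 := by
    exact ((hasDerivAt_matrix_mul (hasDerivAt_const (0 : ℝ) cᴴ) hderiv).const_sub aᴴ).congr_deriv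
      (by simp)
  have hfac : ∀ t, IsUnit (B t) ∧ ∃ μ : ℂ, f t = μ • (V * B t) := by
    intro t
    obtain ⟨w, hw⟩ := hS t
    obtain ⟨α, β, hrot, hα⟩ : ∃ α β : ℂ, mat (surfaceLift X g w) = mat G * rot V α β ∧ α ≠ 0 := by
      have h1 : (mat G)⁻¹ * mat (surfaceLift X g w) = rot V (Real.cosh ‖(κ : ℂ) * w₀‖)
          (-sinhPolar (κ * w₀)) * rot V (Real.cosh ‖(κ : ℂ) * w‖) (sinhPolar (κ * w)) := by
        rw [hG, mat_surfaceLift hV hW g w, mat_surfaceLift_inv_mul hV hW]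
      rw [rot_mul hV] at h1
      have h2 : mat (surfaceLift X g w) = mat G * ((mat G)⁻¹ * mat (surfaceLift X g w)) := by
        rw [← Matrix.mul_assoc, mat_mul_inv, Matrix.one_mul]
      rw [h1] at h2
      -- A vanishing first entry would force cosh‖x‖cosh‖y‖ = sinh‖x‖sinh‖y‖, while the difference
      -- is cosh(‖x‖ − ‖y‖) > 0.
      refine ⟨_, _, h2, fun h0 => ?_⟩
      rw [map_neg, neg_mul, ← sub_eq_add_neg, sub_eq_zero] at h0
      generalize (κ : ℂ) * w₀ = x at h0
      generalize (κ : ℂ) * w = y at h0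
      have := congrArg norm h0
      rw [norm_mul, norm_mul, RCLike.norm_conj, norm_sinhPolar, norm_sinhPolar,
        Complex.norm_real, Complex.norm_real, Real.norm_of_nonneg (Real.cosh_pos _).le,
        Real.norm_of_nonneg (Real.cosh_pos _).le] at this
      have h3 := Real.cosh_pos (‖x‖ - ‖y‖)
      rw [Real.cosh_sub] at h3
      linarith
    have uA := (block_facts (surfaceLift X g w)).1
    have hZ : coord (σ t) = coord (projD (surfaceLift X g w)) := by rw [← hw]; rfl
    have hZA := coord_mul_toBlocks₁₁ (surfaceLift X g w)
    rw [← hZ] at hZA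
    have hGr : (mat G)⁻¹ * mat (surfaceLift X g w) = rot V α β := by
      rw [hrot, ← Matrix.mul_assoc, mat_inv_mul, Matrix.one_mul]
    have hup := congrArg Matrix.toBlocks₁₁ hGr
    have hlow := congrArg Matrix.toBlocks₂₁ hGr
    rw [toBlocks₁₁_mul, hinv, Matrix.toBlocks_fromBlocks₁₁, Matrix.toBlocks_fromBlocks₁₂, ← hZA,
      rot, Matrix.toBlocks_fromBlocks₁₁] at hup
    rw [toBlocks₂₁_mul, hinv, Matrix.toBlocks_fromBlocks₂₁, Matrix.toBlocks_fromBlocks₂₂, ← hZA,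
      rot, Matrix.toBlocks_fromBlocks₂₁] at hlow
    set A := (mat (surfaceLift X g w)).toBlocks₁₁
    have hBA : B t * A = 1 + (α - 1) • (Vᴴ * V) := by
      rw [← hup]; simp only [B]
      rw [Matrix.sub_mul, Matrix.neg_mul, Matrix.mul_assoc, sub_eq_add_neg]
    have hfA : f t * A = β • V := by
      rw [← hlow]; simp only [f]
      rw [Matrix.sub_mul, Matrix.neg_mul, Matrix.mul_assoc]; abel
    have hPP : Vᴴ * V * (Vᴴ * V) = Vᴴ * V := by
      rw [Matrix.mul_assoc, ← Matrix.mul_assoc V, hV]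
    have hVBA : V * (B t * A) = α • V := by
      rw [hBA, Matrix.mul_add, Matrix.mul_smul, ← Matrix.mul_assoc, hV, Matrix.mul_one]
      module
    refine ⟨?_, β / α, ?_⟩
    -- 1 + (α − 1)P acts as α on the range of P and as 1 on its kernel, so it is inverted by
    -- replacing α by α⁻¹.
    · have h1 : (1 + (α - 1) • (Vᴴ * V)) * (1 + (α⁻¹ - 1) • (Vᴴ * V)) = 1 := by
        simp only [Matrix.add_mul, Matrix.mul_add, Matrix.one_mul, Matrix.mul_one,
          Matrix.smul_mul, Matrix.mul_smul, hPP, smul_add, smul_smul]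
        have : (α⁻¹ - 1) * (α - 1) = -(α - 1) - (α⁻¹ - 1) := by
          field_simp; ring
        rw [this]
        module
      rw [← hBA, Matrix.mul_assoc] at h1
      exact IsUnit.of_mul_eq_one _ h1
    · have h1 : f t * A = ((β / α) • (V * B t)) * A := by
        rw [hfA, Matrix.smul_mul, Matrix.mul_assoc, hVBA, smul_smul, div_mul_cancel₀ _ hα]
      have h2 := congrArg (· * A⁻¹) h1
      simpa only [Matrix.mul_assoc, Matrix.mul_nonsing_inv _
        ((Matrix.isUnit_iff_isUnit_det _).1 uA), Matrix.mul_one] using h2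
  have hquot := hasDerivAt_matrix_mul hfd (hasDerivAt_matrix_inv hBd (hfac 0).1)
  rw [hf0, Matrix.zero_mul, zero_add, hB0i] at hquot
  -- A linear map with kernel the line ℂV. It annihilates f B⁻¹ at every time, hence also the
  -- derivative at 0.
  let L : Matrix (Fin m) (Fin n) ℂ →ₗ[ℝ] Matrix (Fin m) (Fin n) ℂ :=
    { toFun := fun M => M - (Matrix.trace (Vᴴ * M) / Matrix.trace (Vᴴ * V)) • V
      map_add' := fun M N => by
        rw [Matrix.mul_add, Matrix.trace_add]; module
      map_smul' := fun r M => by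
        simp only [Matrix.mul_smul, Matrix.trace_smul, RingHom.id_apply, smul_sub, smul_assoc,
          smul_div_assoc] }
  have hL : ∀ t, L (f t * (B t)⁻¹) = 0 := by
    intro t
    obtain ⟨hu, μ, hμ⟩ := hfac t
    have : f t * (B t)⁻¹ = μ • V := by
      rw [hμ, Matrix.smul_mul, Matrix.mul_assoc, Matrix.mul_nonsing_inv _
        ((Matrix.isUnit_iff_isUnit_det _).1 hu), Matrix.mul_one]
    rw [this]
    simp only [L, LinearMap.coe_mk, AddHom.coe_mk, Matrix.mul_smul, Matrix.trace_smul, smul_eq_mul]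
    rw [mul_div_cancel_right₀ _ hq, sub_self]
  have hLd := (L.toContinuousLinearMap.hasFDerivAt).comp_hasDerivAt (0 : ℝ) hquot
  have hL0 : (L.toContinuousLinearMap ∘ fun r => f r * (B r)⁻¹) = fun _ => 0 := funext hL
  rw [hL0] at hLd
  have hY : L (dᴴ * Z' * a) = 0 := hLd.unique (hasDerivAt_const _ _)
  obtain ⟨y, hy⟩ : ∃ y : ℂ, dᴴ * Z' * a = y • V := ⟨_, sub_eq_zero.1 hY⟩
  refine ⟨fun t => projD (G * expHat (t • (y • V))), isGeodesic_mul_expHat G _, ?_, ?_, fun t => ?_⟩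
  · have h0 : expHat ((0 : ℝ) • (y • V)) = (1 : U n m) := by
      apply Subtype.ext; apply Units.ext
      change NormedSpace.exp (hat ((0 : ℝ) • (y • V))) = 1
      rw [hat_real_smul, zero_smul, NormedSpace.exp_zero]
    simp only [h0, mul_one, hσ0]
  · rw [deriv_coord_mul_expHat]
    have h0 : mat (G * expHat ((0 : ℝ) • (y • V))) = mat G := by
      rw [mat_mul_expHat, zero_smul, NormedSpace.exp_zero, Matrix.mul_one]
    rw [h0, ← hy]
    change (dᴴ)⁻¹ * (dᴴ * Z' * a) * a⁻¹ = Z'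
    have udH : IsUnit (dᴴ).det := (Matrix.isUnit_iff_isUnit_det _).1 ud.star
    calc (dᴴ)⁻¹ * (dᴴ * Z' * a) * a⁻¹ = ((dᴴ)⁻¹ * dᴴ) * Z' * (a * a⁻¹) := by
          simp only [Matrix.mul_assoc]
      _ = Z' := by
        rw [Matrix.nonsing_inv_mul _ udH, Matrix.mul_nonsing_inv _ ada, Matrix.one_mul,
          Matrix.mul_one]
  · have : t • (y • V) = ((t : ℂ) * y) • V := by rw [mul_smul]; rfl
    simp only [this]
    exact projD_surfaceLift_mul_expHat_mem hV hV0 hκ hW g w₀ _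

end Surface

/-! ### The two area densities -/

theorem hasDerivWithinAt_norm {w : ℝ → ℂ} {w' : ℂ} {s : Set ℝ} {t : ℝ}
    (hw : HasDerivWithinAt w w' s t) (h0 : w t ≠ 0) :
    HasDerivWithinAt (fun r => ‖w r‖) (((starRingEnd ℂ) (w t) * w').re / ‖w t‖) s t := by
  have hr : ‖w t‖ ≠ 0 := norm_ne_zero_iff.2 h0
  have h1 := (hw.norm_sq).sqrt (by positivity)
  simp only [Real.sqrt_sq (norm_nonneg _), Complex.inner] at h1
  refine h1.congr_deriv ?_
  rw [mul_comm (w')]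
  field_simp

theorem hasDerivWithinAt_sinhPolar {w : ℝ → ℂ} {w' : ℂ} {s : Set ℝ} {t : ℝ}
    (hw : HasDerivWithinAt w w' s t) (h0 : w t ≠ 0) :
    HasDerivWithinAt (fun r => sinhPolar (w r))
      ((((Real.cosh ‖w t‖ * ‖w t‖ - Real.sinh ‖w t‖) / ‖w t‖ ^ 2 *
        (((starRingEnd ℂ) (w t) * w').re / ‖w t‖) : ℝ) : ℂ) * w t +
        ((Real.sinh ‖w t‖ / ‖w t‖ : ℝ) : ℂ) * w') s t := by
  have hr : ‖w t‖ ≠ 0 := norm_ne_zero_iff.2 h0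
  have hn := hasDerivWithinAt_norm hw h0
  have h1 := (hn.sinh.div hn hr).ofReal_comp.mul hw
  refine h1.congr_deriv ?_
  congr 3
  field_simp

/-- The derivative of the point of coordinate `w` in the direction `η`, moved to the identity by
left translation, as a multiple of `V`. -/
def velocity (w η : ℂ) : ℂ :=
  ((((starRingEnd ℂ) w * η).re * (1 - Real.sinh ‖w‖ * Real.cosh ‖w‖ / ‖w‖) / ‖w‖ ^ 2 : ℝ) : ℂ) * w +
    ((Real.sinh ‖w‖ * Real.cosh ‖w‖ / ‖w‖ : ℝ) : ℂ) * η

/-- `velocity w` keeps the radial part of η and multiplies the angular part by sinh‖w‖cosh‖w‖/‖w‖,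
which is therefore its determinant; the factor κ² comes from the basis κ, κi. -/
theorem velocity_det {w : ℂ} (hw : w ≠ 0) (κ : ℝ) :
    (velocity w κ).re * (velocity w (κ * Complex.I)).im -
      (velocity w (κ * Complex.I)).re * (velocity w κ).im =
      κ ^ 2 * (Real.sinh ‖w‖ * Real.cosh ‖w‖ / ‖w‖) := by
  have hr : ‖w‖ ^ 2 ≠ 0 := pow_ne_zero 2 (norm_ne_zero_iff.2 hw)
  have hxy : ‖w‖ ^ 2 = w.re ^ 2 + w.im ^ 2 := by
    rw [← Complex.normSq_eq_norm_sq, Complex.normSq_apply, sq, sq]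
  unfold velocity
  generalize Real.sinh ‖w‖ * Real.cosh ‖w‖ / ‖w‖ = k
  simp only [Complex.add_re, Complex.add_im, Complex.mul_re, Complex.mul_im, Complex.ofReal_re,
    Complex.ofReal_im, Complex.conj_re, Complex.conj_im, Complex.I_re, Complex.I_im]
  rw [hxy] at hr ⊢
  field_simp
  ring

/-- The left side is the second component of `rot`⁻¹ times the derivative of `rot`, as given by
`rot_mul_rotTangent`; cosh² − sinh² = 1 simplifies it. -/
theorem velocity_eq {w : ℂ} (hw : w ≠ 0) (η : ℂ) :
    -sinhPolar w * ((Real.sinh ‖w‖ * (((starRingEnd ℂ) w * η).re / ‖w‖) : ℝ) : ℂ) +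
      (starRingEnd ℂ) ((Real.cosh ‖w‖ : ℝ) : ℂ) *
      ((((Real.cosh ‖w‖ * ‖w‖ - Real.sinh ‖w‖) / ‖w‖ ^ 2 *
        (((starRingEnd ℂ) w * η).re / ‖w‖) : ℝ) : ℂ) * w +
        ((Real.sinh ‖w‖ / ‖w‖ : ℝ) : ℂ) * η) = velocity w η := by
  have hr : (‖w‖ : ℂ) ≠ 0 := by exact_mod_cast norm_ne_zero_iff.2 hw
  have hcs : (Real.cosh ‖w‖ : ℂ) ^ 2 - (Real.sinh ‖w‖ : ℂ) ^ 2 = 1 := by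
    exact_mod_cast Real.cosh_sq_sub_sinh_sq ‖w‖
  rw [Complex.conj_ofReal, velocity, sinhPolar]
  generalize ((starRingEnd ℂ) w * η).re = ρ
  generalize Real.sinh ‖w‖ = sh at *
  generalize Real.cosh ‖w‖ = ch at *
  generalize ‖w‖ = r at *
  push_cast
  field_simp
  linear_combination (w * ρ * r) * hcs

section Density

variable {n m : ℕ} {V X : Matrix (Fin m) (Fin n) ℂ} {κ : ℝ}

/-- The component x is block diagonal, hence tangent to U(n) × U(m). Neither area form sees it, so
its value is not recorded. -/
theorem hasDerivAt_surfaceLift (hV : V * Vᴴ * V = V) (hκ : κ ≠ 0) (hW : unitize X = κ • V)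
    (g : U n m) {w : ℂ} (hw : w ≠ 0) (η : ℂ) :
    ∃ x : ℂ, HasDerivAt (fun s : ℝ => mat (surfaceLift X g (w + s * η)))
      (mat (surfaceLift X g w) * rotTangent V x (velocity (κ * w) (κ * η))) 0 := by
  have hκ' : (κ : ℂ) ≠ 0 := by exact_mod_cast hκ
  have hp0 : (κ : ℂ) * w ≠ 0 := mul_ne_zero hκ' hw
  let p : ℝ → ℂ := fun s => κ * (w + s * η)
  have hpz : p 0 = κ * w := by simp [p]
  have hp : HasDerivWithinAt p (κ * η) Set.univ 0 := by
    have h1 : HasDerivAt (fun s : ℝ => (s : ℂ)) 1 0 := Complex.ofRealCLM.hasDerivAt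
    have := ((h1.mul_const η).const_add w).const_mul (κ : ℂ)
    rw [one_mul] at this
    exact this.hasDerivWithinAt
  have hne : p 0 ≠ 0 := by rwa [hpz]
  have hC := ((hasDerivWithinAt_norm hp hne).cosh).ofReal_comp
  have hS := hasDerivWithinAt_sinhPolar hp hne
  have hrot := (hasDerivWithinAt_rot (V := V) hC hS).const_mul (mat g)
  rw [hasDerivWithinAt_univ] at hrot
  have hfun : (fun s : ℝ => mat (surfaceLift X g (w + s * η))) =
      fun s => mat g * rot V ((Real.cosh ‖p s‖ : ℝ) : ℂ) (sinhPolar (p s)) :=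
    funext fun s => mat_surfaceLift hV hW g _
  have key : ∀ c s : ℂ, mat g * rotTangent V c s = mat (surfaceLift X g w) *
      (rot V (Real.cosh ‖(κ : ℂ) * w‖) (-sinhPolar (κ * w)) * rotTangent V c s) := by
    intro c s
    rw [mat_surfaceLift hV hW, Matrix.mul_assoc, ← Matrix.mul_assoc (rot _ _ _),
      rot_mul_rot_neg hV, Matrix.one_mul]
  simp only [hpz] at hrot
  rw [key, rot_mul_rotTangent hV, velocity_eq hp0] at hrot
  rw [hfun]
  exact ⟨_, hrot⟩

/-- With τ = Tr V*V, the determinant is κ²τ² times that of `velocity_det`, and κ²τ = 1 removes all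
constants. -/
theorem relatedDensity_eq (hV : V * Vᴴ * V = V) (hκ : 0 < κ) (hW : unitize X = κ • V)
    (hτ : κ ^ 2 * (Matrix.trace (Vᴴ * V)).re = 1) (g : U n m) {w : ℂ} (hw : w ≠ 0) :
    relatedDensity X g w = Real.sinh (κ * ‖w‖) * Real.cosh (κ * ‖w‖) / (κ * ‖w‖) := by
  have hκ' : (κ : ℂ) ≠ 0 := by exact_mod_cast hκ.ne'
  obtain ⟨x, hx⟩ := hasDerivAt_surfaceLift hV hκ.ne' hW g hw 1
  obtain ⟨y, hy⟩ := hasDerivAt_surfaceLift hV hκ.ne' hW g hw Complex.I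
  have hdet := velocity_det (mul_ne_zero hκ' hw) κ
  have hn : ‖(κ : ℂ) * w‖ = κ * ‖w‖ := by
    rw [norm_mul, Complex.norm_real, Real.norm_of_nonneg hκ.le]
  have hW1 : unitize X = (κ : ℂ) • V := hW
  have hWI : Complex.I • unitize X = (Complex.I * κ : ℂ) • V := by rw [hW1, smul_smul]
  simp only [mul_one] at hx
  rw [relatedDensity, hx.deriv, hy.deriv, areaForm, ← Matrix.mul_assoc, ← Matrix.mul_assoc,
    mat_inv_mul, Matrix.one_mul, Matrix.one_mul, hWI, hW1]
  simp only [ip_rotTangent_hat, Matrix.det_fin_two_of]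
  rw [hn] at hdet
  simp only [Complex.mul_re, Complex.mul_im, Complex.conj_re, Complex.conj_im, Complex.I_re,
    Complex.I_im, Complex.ofReal_re, Complex.ofReal_im]
  set k := Real.sinh (κ * ‖w‖) * Real.cosh (κ * ‖w‖) / (κ * ‖w‖)
  set τ := (Matrix.trace (Vᴴ * V)).re
  linear_combination (κ ^ 2 * τ ^ 2) * hdet + (κ ^ 2 * τ + 1) * k * hτ

theorem ip_hat_hat (a v : ℂ) : ip (hat (a • V)) (hat (v • V)) =
    ((starRingEnd ℂ) a * v).re * (Matrix.trace (Vᴴ * V)).re := by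
  rw [← ip_rotTangent_hat 0]
  congr 1
  simp [hat, rotTangent, Matrix.conjTranspose_smul]

/-- Left translation carries the coordinate vectors to yV and zV. Their Gram determinant is τ²(y.re
z.im − z.re y.im)², whose root is the density of `relatedDensity_eq`. -/
theorem inducedDensity_eq (hV : V * Vᴴ * V = V) (hκ : 0 < κ) (hW : unitize X = κ • V)
    (hτ : κ ^ 2 * (Matrix.trace (Vᴴ * V)).re = 1) (g : U n m) {w : ℂ} (hw : w ≠ 0) :
    inducedDensity X g w = Real.sinh (κ * ‖w‖) * Real.cosh (κ * ‖w‖) / (κ * ‖w‖) := by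
  have hκ' : (κ : ℂ) ≠ 0 := by exact_mod_cast hκ.ne'
  have hder : ∀ η : ℂ, deriv (fun s : ℝ => coord (surfacePoint X g (w + s * η))) 0 =
      (((mat (surfaceLift X g w)).toBlocks₂₂)ᴴ)⁻¹ * (velocity (κ * w) (κ * η) • V) *
        ((mat (surfaceLift X g w)).toBlocks₁₁)⁻¹ := by
    intro η
    obtain ⟨x, hx⟩ := hasDerivAt_surfaceLift hV hκ.ne' hW g hw η
    have := (hasDerivAt_coord hx).deriv
    simp only [Complex.ofReal_zero, zero_mul, add_zero, ← Matrix.mul_assoc, mat_inv_mul,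
      Matrix.one_mul] at this
    exact this
  have hdet := velocity_det (mul_ne_zero hκ' hw) κ
  have hn : ‖(κ : ℂ) * w‖ = κ * ‖w‖ := by
    rw [norm_mul, Complex.norm_real, Real.norm_of_nonneg hκ.le]
  have h1 := hder 1
  have h2 := hder Complex.I
  simp only [mul_one] at h1
  unfold inducedDensity
  simp only [h1, h2]
  simp only [surfacePoint, metricD_submersion, ip_hat_hat]
  rw [hn] at hdet
  simp only [Complex.mul_re, Complex.conj_re, Complex.conj_im]
  set k := Real.sinh (κ * ‖w‖) * Real.cosh (κ * ‖w‖) / (κ * ‖w‖) with hk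
  have hk0 : 0 ≤ k := by
    have : 0 ≤ κ * ‖w‖ := by positivity
    have := Real.sinh_nonneg_iff.2 this
    have := (Real.cosh_pos (κ * ‖w‖)).le
    positivity
  set τ := (Matrix.trace (Vᴴ * V)).re
  rw [← Real.sqrt_sq hk0]
  congr 1
  generalize velocity (κ * w) κ = y at *
  generalize velocity (κ * w) (κ * Complex.I) = z at *
  have h3 : τ * (y.re * z.im - z.re * y.im) = k := by
    rw [hdet]; linear_combination k * hτ
  rw [← h3]
  ring

end Density

/-! ### Winding numbers -/

-- The principal logarithm of p is a primitive as long as p avoids the cut.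
open Set MeasureTheory in
theorem integral_logDeriv_eq_zero {p p' : ℝ → ℂ} (hc : ContinuousOn p (Icc 0 1))
    (hd : ∀ t ∈ Ioo (0 : ℝ) 1, HasDerivAt p (p' t) t) (hs : ∀ t ∈ Icc (0 : ℝ) 1, p t ∈ Complex.slitPlane)
    (hcl : p 0 = p 1) (hp' : ContinuousOn p' (Icc 0 1)) :
    ∫ t in (0 : ℝ)..1, p' t / p t = 0 := by
  have hint : IntervalIntegrable (fun t => p' t / p t) volume 0 1 := by
    apply ContinuousOn.intervalIntegrable
    rw [uIcc_of_le zero_le_one]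
    exact hp'.div hc fun t ht => Complex.slitPlane_ne_zero (hs t ht)
  rw [intervalIntegral.integral_eq_sub_of_hasDerivAt_of_le zero_le_one (hc.clog hs)
    (fun t ht => (hd t ht).clog_real (hs t (Ioo_subset_Icc_self ht))) hint, hcl, sub_self]

section Curve

variable {z : ℝ → ℂ}

open Set

theorem continuousOn_velocity (hz : ContDiffOn ℝ ∞ z (Icc 0 1)) :
    ContinuousOn (derivWithin z (Icc 0 1)) (Icc 0 1) :=
  hz.continuousOn_derivWithin (uniqueDiffOn_Icc zero_lt_one) (by simp)

theorem hasDerivAt_curve (hz : ContDiffOn ℝ ∞ z (Icc 0 1)) {t : ℝ} (ht : t ∈ Ioo (0 : ℝ) 1) :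
    HasDerivAt z (derivWithin z (Icc 0 1) t) t :=
  ((hz.differentiableOn (by simp)) t (Ioo_subset_Icc_self ht)).hasDerivWithinAt.hasDerivAt
    (Icc_mem_nhds ht.1 ht.2)

/-- The unnormalized winding number, with the one-sided derivative at the end points. -/
def windingIntegral (z : ℝ → ℂ) (w : ℂ) : ℂ :=
  ∫ t in (0 : ℝ)..1, derivWithin z (Icc 0 1) t / (z t - w)

/-- At 0 and 1 the two-sided derivative depends on z outside the interval, but two points do not
affect the integral. -/
theorem winding_eq (hz : ContDiffOn ℝ ∞ z (Icc 0 1)) (w : ℂ) :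
    winding z w = (2 * Real.pi * Complex.I)⁻¹ * windingIntegral z w := by
  rw [winding, windingIntegral, intervalIntegral.integral_of_le zero_le_one,
    intervalIntegral.integral_of_le zero_le_one, MeasureTheory.integral_Ioc_eq_integral_Ioo,
    MeasureTheory.integral_Ioc_eq_integral_Ioo]
  congr 1
  refine MeasureTheory.setIntegral_congr_fun measurableSet_Ioo fun t ht => ?_
  simp only [(hasDerivAt_curve hz ht).deriv]

/-- The difference of the integrands is the logarithmic derivative of (z − w')/(z − w) = 1 + (w −
w')/(z − w), which stays in the unit disc about 1 and thus in the slit plane. -/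
theorem windingIntegral_eq_of_near (hz : ContDiffOn ℝ ∞ z (Icc 0 1)) (hcl : z 0 = z 1) {w w' : ℂ}
    (h : ∀ t ∈ Icc (0 : ℝ) 1, ‖w' - w‖ < ‖z t - w‖) (h0 : w' ∉ z '' Icc 0 1) :
    windingIntegral z w' = windingIntegral z w := by
  have hd := continuousOn_velocity hz
  have hzc := hz.continuousOn
  have hw : ∀ t ∈ Icc (0 : ℝ) 1, z t - w ≠ 0 := fun t ht =>
    norm_pos_iff.1 ((norm_nonneg _).trans_lt (h t ht))
  have hw' : ∀ t ∈ Icc (0 : ℝ) 1, z t - w' ≠ 0 := fun t ht h1 =>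
    h0 ⟨t, ht, sub_eq_zero.1 h1⟩
  have key := integral_logDeriv_eq_zero (p := fun t => (z t - w') / (z t - w))
    (p' := fun t => (derivWithin z (Icc 0 1) t * (z t - w) - (z t - w') *
      derivWithin z (Icc 0 1) t) / (z t - w) ^ 2)
    ((hzc.sub continuousOn_const).div (hzc.sub continuousOn_const) hw)
    (fun t ht => ((hasDerivAt_curve hz ht).sub_const w').div ((hasDerivAt_curve hz ht).sub_const w)
      (hw t (Ioo_subset_Icc_self ht)))
    (fun t ht => ?_) (by simp only [hcl])
    (((hd.mul (hzc.sub continuousOn_const)).sub ((hzc.sub continuousOn_const).mul hd)).div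
      ((hzc.sub continuousOn_const).pow 2) fun t ht => pow_ne_zero 2 (hw t ht))
  · rw [← sub_eq_zero, windingIntegral, windingIntegral, ← intervalIntegral.integral_sub, ← key]
    · refine intervalIntegral.integral_congr fun t ht => ?_
      rw [uIcc_of_le zero_le_one] at ht
      have h1 := hw t ht
      have h2 := hw' t ht
      field_simp
    · apply ContinuousOn.intervalIntegrable
      rw [uIcc_of_le zero_le_one]
      exact hd.div (hzc.sub continuousOn_const) hw'
    · apply ContinuousOn.intervalIntegrable
      rw [uIcc_of_le zero_le_one]
      exact hd.div (hzc.sub continuousOn_const) hw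
  · have h1 : (z t - w') / (z t - w) = 1 + (w - w') / (z t - w) := by
      rw [one_add_div (hw t ht)]
      congr 1
      ring
    have h2 : ‖(w - w') / (z t - w)‖ < 1 := by
      rw [norm_div, div_lt_one (norm_pos_iff.2 (hw t ht)), norm_sub_rev]
      exact h t ht
    simp only [h1]
    left
    have := (abs_lt.1 ((Complex.abs_re_le_norm _).trans_lt h2)).1
    simp only [Complex.add_re, Complex.one_re]
    linarith

/-- The integrand is the logarithmic derivative of 1 − z/w, which stays in the unit disc about 1. -/
theorem windingIntegral_eq_zero_of_far (hz : ContDiffOn ℝ ∞ z (Icc 0 1)) (hcl : z 0 = z 1) {w : ℂ}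
    (h : ∀ t ∈ Icc (0 : ℝ) 1, ‖z t‖ < ‖w‖) : windingIntegral z w = 0 := by
  have hd := continuousOn_velocity hz
  have hzc := hz.continuousOn
  have hw0 : w ≠ 0 := norm_pos_iff.1 ((norm_nonneg _).trans_lt (h 0 (by simp)))
  have hw : ∀ t ∈ Icc (0 : ℝ) 1, z t - w ≠ 0 := fun t ht h1 => by
    have := h t ht
    rw [sub_eq_zero.1 h1] at this
    exact lt_irrefl _ this
  rw [← integral_logDeriv_eq_zero (p := fun t => 1 - z t / w)
    (p' := fun t => -(derivWithin z (Icc 0 1) t / w))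
    (continuousOn_const.sub (hzc.div_const w))
    (fun t ht => ((hasDerivAt_curve hz ht).div_const w).const_sub 1)
    (fun t ht => ?_) (by simp only [hcl]) (hd.div_const w).neg, windingIntegral]
  · refine intervalIntegral.integral_congr fun t ht => ?_
    rw [uIcc_of_le zero_le_one] at ht
    have h1 := hw t ht
    have h2 : w - z t ≠ 0 := by rw [← neg_sub]; exact neg_ne_zero.2 h1
    field_simp
    ring
  · left
    have h2 : ‖z t / w‖ < 1 := by
      rw [norm_div, div_lt_one (norm_pos_iff.2 hw0)]
      exact h t ht
    have := (abs_lt.1 ((Complex.abs_re_le_norm _).trans_lt h2)).2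
    simp only [Complex.sub_re, Complex.one_re]
    linarith

theorem isClosed_curve (hz : ContDiffOn ℝ ∞ z (Icc 0 1)) : IsClosed (z '' Icc 0 1) :=
  (isCompact_Icc.image_of_continuousOn hz.continuousOn).isClosed

theorem eventually_windingIntegral_eq (hz : ContDiffOn ℝ ∞ z (Icc 0 1)) (hcl : z 0 = z 1) {w : ℂ}
    (hw : w ∉ z '' Icc 0 1) : ∀ᶠ w' in nhds w, windingIntegral z w' = windingIntegral z w := by
  have hcl' := isClosed_curve hz
  obtain ⟨ε, hε, hball⟩ := Metric.isOpen_iff.1 hcl'.isOpen_compl w hw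
  filter_upwards [Metric.ball_mem_nhds w hε] with w' hw'
  refine windingIntegral_eq_of_near hz hcl (fun t ht => ?_) (hball hw')
  have h1 : z t ∉ Metric.ball w ε := fun h => hball h ⟨t, ht, rfl⟩
  rw [Metric.mem_ball, dist_eq_norm] at h1 hw'
  linarith

/-- The winding number is locally constant off the curve, so it is constant on the component of w,
and this component contains points far from the curve. -/
theorem windingIntegral_eq_zero_of_unbounded (hz : ContDiffOn ℝ ∞ z (Icc 0 1)) (hcl : z 0 = z 1)
    {w : ℂ} (hw : w ∉ z '' Icc 0 1) (hw' : w ∉ enclosed z) : windingIntegral z w = 0 := by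
  set K := connectedComponentIn (z '' Icc 0 1)ᶜ w
  have hK : ¬ Bornology.IsBounded K := fun h => hw' ⟨hw, h⟩
  have hKs : K ⊆ (z '' Icc 0 1)ᶜ := connectedComponentIn_subset _ _
  -- By local constancy every level set and its complement are open off the curve; they cannot
  -- separate the connected set K.
  have hopen : ∀ s : Set ℂ, IsOpen {v | v ∈ (z '' Icc 0 1)ᶜ ∧ windingIntegral z v ∈ s} := by
    intro s
    rw [isOpen_iff_mem_nhds]
    rintro v ⟨hv, hvs⟩
    filter_upwards [eventually_windingIntegral_eq hz hcl hv,
      (isClosed_curve hz).isOpen_compl.mem_nhds hv] with v' h1 h2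
    exact ⟨h2, by rwa [h1]⟩
  have hsub := isPreconnected_connectedComponentIn.subset_left_of_subset_union
    (s := K) (hopen {windingIntegral z w}) (hopen {windingIntegral z w}ᶜ)
    (Set.disjoint_left.2 fun v h1 h2 => h2.2 h1.2)
    (fun v hv => by
      by_cases h : windingIntegral z v = windingIntegral z w
      · exact Or.inl ⟨hKs hv, h⟩
      · exact Or.inr ⟨hKs hv, h⟩)
    ⟨w, mem_connectedComponentIn hw, hw, rfl⟩
  obtain ⟨R, hR⟩ := (isCompact_Icc.image_of_continuousOn hz.continuousOn).isBounded.exists_norm_le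
  obtain ⟨v, hvK, hv⟩ : ∃ v ∈ K, R < ‖v‖ := by
    by_contra! hcon
    exact hK (isBounded_iff_forall_norm_le.2 ⟨R, hcon⟩)
  rw [← (hsub hvK).2]
  exact windingIntegral_eq_zero_of_far hz hcl fun t ht => (hR _ ⟨t, ht, rfl⟩).trans_lt hv

theorem isOpen_enclosed (hz : ContDiffOn ℝ ∞ z (Icc 0 1)) : IsOpen (enclosed z) := by
  rw [isOpen_iff_mem_nhds]
  rintro w ⟨hw, hb⟩
  have hop : IsOpen (z '' Icc 0 1)ᶜ := (isClosed_curve hz).isOpen_compl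
  filter_upwards [hop.connectedComponentIn.mem_nhds (mem_connectedComponentIn hw)] with v hv
  refine ⟨connectedComponentIn_subset _ _ hv, ?_⟩
  rwa [← connectedComponentIn_eq hv]

theorem windingIntegral_of_mem_enclosed (hz : ContDiffOn ℝ ∞ z (Icc 0 1))
    (hor : ∀ w ∈ enclosed z, winding z w = 1) {w : ℂ} (hw : w ∈ enclosed z) :
    windingIntegral z w = 2 * Real.pi * Complex.I := by
  have h := hor w hw
  rw [winding_eq hz, inv_mul_eq_one₀ Complex.two_pi_I_ne_zero] at h
  exact h.symm

/-- Outside the disc the winding number vanishes, whereas the orientation makes it 1 on the enclosed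
region. -/
theorem norm_lt_of_mem_enclosed (hz : ContDiffOn ℝ ∞ z (Icc 0 1)) (hcl : z 0 = z 1)
    (hor : ∀ w ∈ enclosed z, winding z w = 1) {R : ℝ} (hR : ∀ t ∈ Icc (0 : ℝ) 1, ‖z t‖ < R) {w : ℂ}
    (hw : w ∈ enclosed z) : ‖w‖ < R := by
  by_contra! h
  have h1 := windingIntegral_of_mem_enclosed hz hor hw
  rw [windingIntegral_eq_zero_of_far hz hcl fun t ht => (hR t ht).trans_le h] at h1
  exact Complex.two_pi_I_ne_zero h1.symm

-- The curve is the image of a real segment in ℂ under w ↦ z(Re w), and differentiable maps preserve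
-- null sets.
open MeasureTheory in
theorem volume_curve_eq_zero (hz : ContDiffOn ℝ ∞ z (Icc 0 1)) : volume (z '' Icc 0 1) = 0 := by
  have hs : volume (Complex.ofReal '' Icc (0 : ℝ) 1) = 0 := by
    have h1 := Measure.addHaar_submodule (volume : Measure ℂ) (LinearMap.ker Complex.imLm) (by
      intro h
      have : Complex.I ∈ LinearMap.ker Complex.imLm := by rw [h]; trivial
      simp at this)
    refine measure_mono_null ?_ h1
    rintro _ ⟨t, -, rfl⟩
    simp
  have hf : DifferentiableOn ℝ (fun w : ℂ => z w.re) (Complex.ofReal '' Icc (0 : ℝ) 1) := by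
    refine (hz.differentiableOn (by simp)).comp Complex.reCLM.differentiable.differentiableOn ?_
    rintro _ ⟨t, ht, rfl⟩
    simpa using ht
  have := addHaar_image_eq_zero_of_differentiableOn_of_addHaar_eq_zero volume hf hs
  rwa [Set.image_image] at this

end Curve

/-! ### The area enclosed by a curve as an integral over the curve -/

section Area

open MeasureTheory Set

/-- The mean value property, with the angle moved to (−π, π) to fit polar coordinates. -/
theorem integral_circle_eq {f : ℂ → ℂ} {r : ℝ} (hc : ContinuousOn f (Metric.closedBall 0 |r|))
    (hd : ∀ w ∈ Metric.ball (0 : ℂ) |r|, DifferentiableAt ℂ f w) :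
    ∫ θ in (-Real.pi)..Real.pi, f (r * Complex.exp (θ * Complex.I)) = 2 * Real.pi * f 0 := by
  have h := circleAverage_of_differentiable_on_off_countable (c := 0) (R := r) countable_empty hc
    (fun w hw => hd w hw.1)
  rw [Real.circleAverage_def] at h
  have hper : Function.Periodic (fun θ => f (circleMap 0 r θ)) (2 * Real.pi) :=
    (periodic_circleMap 0 r).comp f
  have h2 := hper.intervalIntegral_add_eq (-Real.pi) 0
  rw [show -Real.pi + 2 * Real.pi = Real.pi by ring, zero_add] at h2
  rw [← h2, inv_smul_eq_iff₀ (by positivity)] at h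
  simp only [circleMap, zero_add] at h
  rw [h]
  simp

/-- For r < ‖z‖ the function 1/(z − w) is holomorphic in the disc, with mean value 1/z. For r > ‖z‖
the inversion of the circle turns it into a holomorphic function that vanishes at the centre. -/
theorem integral_circle_inv_sub {z : ℂ} {r : ℝ} (hr : 0 < r) (hrz : r ≠ ‖z‖) :
    ∫ θ in (-Real.pi)..Real.pi, (z - r * Complex.exp (θ * Complex.I))⁻¹ =
      if r < ‖z‖ then 2 * Real.pi / z else 0 := by
  split_ifs with h
  · have hne : ∀ w ∈ Metric.closedBall (0 : ℂ) |r|, z - w ≠ 0 := by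
      intro w hw h0
      rw [mem_closedBall_zero_iff, abs_of_pos hr, ← sub_eq_zero.1 h0] at hw
      linarith
    rw [integral_circle_eq (f := fun w => (z - w)⁻¹)
      ((continuousOn_const.sub continuousOn_id).inv₀ hne)
      (fun w hw => ((differentiableAt_const z).sub differentiableAt_id).inv
        (hne w (Metric.ball_subset_closedBall hw)))]
    simp [div_eq_mul_inv]
  · have hlt : ‖z‖ < r := lt_of_le_of_ne (not_lt.1 h) hrz.symm
    have hne : ∀ w ∈ Metric.closedBall (0 : ℂ) |1|, (r : ℂ) - z * w ≠ 0 := by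
      intro w hw h0
      rw [mem_closedBall_zero_iff, abs_one] at hw
      have h1 := congrArg norm (sub_eq_zero.1 h0)
      rw [norm_mul, Complex.norm_real, Real.norm_of_nonneg hr.le] at h1
      nlinarith [norm_nonneg z]
    have key := integral_circle_eq (f := fun w => -w / (r - z * w)) (r := 1)
      (continuousOn_id.neg.div (continuousOn_const.sub (continuousOn_const.mul continuousOn_id)) hne)
      (fun w hw => differentiableAt_id.neg.div ((differentiableAt_const _).sub
        ((differentiableAt_const z).mul differentiableAt_id))
        (hne w (Metric.ball_subset_closedBall hw)))
    rw [neg_zero, zero_div, mul_zero] at key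
    -- Under θ ↦ −θ, u = e^{iθ} becomes u⁻¹, and (z − ru⁻¹)⁻¹ = −u/(r − zu).
    have hneg := intervalIntegral.integral_comp_neg (a := -Real.pi) (b := Real.pi)
      (fun θ : ℝ => (z - r * Complex.exp (θ * Complex.I))⁻¹)
    rw [neg_neg] at hneg
    rw [← hneg, ← key]
    refine intervalIntegral.integral_congr fun θ _ => ?_
    have hexp : Complex.exp (θ * Complex.I) ≠ 0 := Complex.exp_ne_zero _
    have hmem : Complex.exp (θ * Complex.I) ∈ Metric.closedBall (0 : ℂ) |1| := by
      rw [mem_closedBall_zero_iff, Complex.norm_exp_ofReal_mul_I, abs_one]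
    have hn := hne _ hmem
    simp only [Complex.ofReal_neg, neg_mul, Complex.exp_neg, Complex.ofReal_one, one_mul]
    generalize Complex.exp (θ * Complex.I) = u at *
    have : z - r * u⁻¹ = -((r - z * u) / u) := by field_simp; ring
    rw [this, inv_neg, inv_div, neg_div]

/-- The density of the area form in the coordinate `w`, at distance `r` from the origin. -/
def density (κ r : ℝ) : ℝ := Real.sinh (κ * r) * Real.cosh (κ * r) / (κ * r)

theorem measurable_density (κ : ℝ) : Measurable (density κ) := by
  unfold density
  have h1 : Continuous fun r : ℝ => Real.sinh (κ * r) * Real.cosh (κ * r) := by fun_prop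
  exact h1.measurable.div (measurable_const.mul measurable_id)

theorem sinh_le_self_mul_cosh {x : ℝ} (hx : 0 ≤ x) : Real.sinh x ≤ x * Real.cosh x := by
  have hmono : MonotoneOn (fun y : ℝ => y * Real.cosh y - Real.sinh y) (Ici 0) := by
    apply monotoneOn_of_deriv_nonneg (convex_Ici 0)
    · fun_prop
    · fun_prop
    · intro y hy
      rw [interior_Ici] at hy
      have hd : HasDerivAt (fun y : ℝ => y * Real.cosh y - Real.sinh y) (y * Real.sinh y) y := by
        refine (((hasDerivAt_id y).mul (Real.hasDerivAt_cosh y)).sub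
          (Real.hasDerivAt_sinh y)).congr_deriv ?_
        simp
      rw [hd.deriv]
      exact mul_nonneg (le_of_lt hy) (Real.sinh_nonneg_iff.2 (le_of_lt hy))
  have := hmono (mem_Ici.2 le_rfl) (mem_Ici.2 hx) hx
  simp at this
  linarith

theorem density_nonneg {κ r : ℝ} (hκ : 0 ≤ κ) (hr : 0 ≤ r) : 0 ≤ density κ r := by
  have h1 : 0 ≤ κ * r := by positivity
  have h2 := Real.sinh_nonneg_iff.2 h1
  have h3 := (Real.cosh_pos (κ * r)).le
  unfold density
  positivity

theorem density_le {κ r R : ℝ} (hκ : 0 ≤ κ) (hr : 0 ≤ r) (hR : r ≤ R) :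
    density κ r ≤ Real.cosh (κ * R) ^ 2 := by
  have h1 : 0 ≤ κ * r := by positivity
  have h2 : Real.cosh (κ * r) ≤ Real.cosh (κ * R) := by
    rw [Real.cosh_le_cosh, abs_of_nonneg h1, abs_of_nonneg (mul_nonneg hκ (hr.trans hR))]
    gcongr
  have h3 := Real.cosh_pos (κ * r)
  calc density κ r ≤ Real.cosh (κ * r) ^ 2 := by
        unfold density
        apply div_le_of_le_mul₀ h1 (by positivity)
        nlinarith [sinh_le_self_mul_cosh h1]
    _ ≤ _ := by gcongr

/-- The reflection w ↦ z − w maps the ball into the one of radius 2R about 0, so the bound does not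
depend on z. Fubini's theorem below uses this uniformity. -/
theorem integrableOn_norm_inv_sub (z : ℂ) {R : ℝ} (hz : ‖z‖ ≤ R) :
    IntegrableOn (fun w : ℂ => ‖(z - w)⁻¹‖) (Metric.ball 0 R) ∧
    ∫ w in Metric.ball (0 : ℂ) R, ‖(z - w)⁻¹‖ ≤ ∫ w in Metric.ball (0 : ℂ) (2 * R), ‖w⁻¹‖ := by
  have h0 : IntegrableOn (fun w : ℂ => ‖w⁻¹‖) (Metric.ball 0 (2 * R)) := by
    refine integrableOn_ball_of_norm_le_rpow (by simp) (C := 1) (α := 1) (by simp)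
      (ae_of_all _ fun w => ?_) (measurable_id.inv.norm).aestronglyMeasurable
    rw [norm_norm, norm_inv, Real.rpow_neg_one, one_mul]
  have hmp : MeasurePreserving (fun w : ℂ => z - w) volume volume :=
    Measure.measurePreserving_sub_left volume z
  have hemb : MeasurableEmbedding (fun w : ℂ => z - w) :=
    (MeasurableEquiv.subLeft z).measurableEmbedding
  have hpre : IntegrableOn (fun w : ℂ => ‖(z - w)⁻¹‖)
      ((fun w : ℂ => z - w) ⁻¹' Metric.ball 0 (2 * R)) :=
    (hmp.integrableOn_comp_preimage hemb).2 h0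
  have hsub : Metric.ball (0 : ℂ) R ⊆ (fun w : ℂ => z - w) ⁻¹' Metric.ball 0 (2 * R) := by
    intro w hw
    rw [mem_ball_zero_iff] at hw
    rw [mem_preimage, mem_ball_zero_iff]
    linarith [norm_sub_le z w]
  refine ⟨hpre.mono_set hsub, ?_⟩
  rw [← hmp.setIntegral_preimage_emb hemb (fun w : ℂ => ‖w⁻¹‖)]
  exact setIntegral_mono_set hpre (ae_of_all _ fun w => norm_nonneg _) hsub.eventuallyLE

theorem integrableOn_density_div (κ : ℝ) (hκ : 0 ≤ κ) (z : ℂ) {R : ℝ} (hz : ‖z‖ ≤ R) :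
    IntegrableOn (fun w : ℂ => (density κ ‖w‖ : ℂ) * (z - w)⁻¹) (Metric.ball 0 R) := by
  refine Integrable.mono' ((integrableOn_norm_inv_sub z hz).1.const_mul (Real.cosh (κ * R) ^ 2)) ?_ ?_
  · have h1 : Measurable fun w : ℂ => (density κ ‖w‖ : ℂ) :=
      Complex.measurable_ofReal.comp ((measurable_density κ).comp measurable_norm)
    exact (h1.mul (measurable_const.sub measurable_id).inv).aestronglyMeasurable
  · refine (ae_restrict_iff' measurableSet_ball).2 (ae_of_all _ fun w hw => ?_)
    rw [mem_ball_zero_iff] at hw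
    rw [norm_mul, Complex.norm_real, Real.norm_of_nonneg (density_nonneg hκ (norm_nonneg w))]
    gcongr
    exact density_le hκ (norm_nonneg w) hw.le

theorem integral_mul_density {κ : ℝ} (hκ : 0 < κ) {a : ℝ} (ha : 0 ≤ a) :
    ∫ r in Ioo 0 a, r * density κ r = Real.sinh (κ * a) ^ 2 / (2 * κ ^ 2) := by
  rw [← integral_Ioc_eq_integral_Ioo, ← intervalIntegral.integral_of_le ha]
  -- r times the density is sinh(κr)cosh(κr)/κ, also at r = 0.
  have hd : ∀ r : ℝ, HasDerivAt (fun r => Real.sinh (κ * r) ^ 2 / (2 * κ ^ 2))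
      (Real.sinh (κ * r) * Real.cosh (κ * r) / κ) r := by
    intro r
    refine ((((hasDerivAt_id r).const_mul κ).sinh.pow 2).div_const _).congr_deriv ?_
    simp
    field_simp
  have h := intervalIntegral.integral_eq_sub_of_hasDerivAt (a := 0) (b := a)
    (fun r _ => hd r) (Continuous.intervalIntegrable (by fun_prop) _ _)
  simp only [mul_zero, Real.sinh_zero, ne_eq, OfNat.ofNat_ne_zero, not_false_eq_true, zero_pow,
    zero_div, sub_zero] at h
  rw [← h]
  refine intervalIntegral.integral_congr fun r _ => ?_
  simp only [density]
  rcases eq_or_ne r 0 with rfl | hr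
  · simp
  · field_simp

/-- The shell theorem for the potential of a rotationally symmetric density. -/
theorem integral_density_div {κ : ℝ} (hκ : 0 < κ) (z : ℂ) {R : ℝ} (hz : ‖z‖ < R) :
    ∫ w in Metric.ball (0 : ℂ) R, (density κ ‖w‖ : ℂ) * (z - w)⁻¹ =
      ((Real.pi * Real.sinh (κ * ‖z‖) ^ 2 / κ ^ 2 : ℝ) : ℂ) / z := by
  set F : ℂ → ℂ := (Metric.ball (0 : ℂ) R).indicator
    (fun w => (density κ ‖w‖ : ℂ) * (z - w)⁻¹) with hF
  have hdm : Measurable fun w : ℂ => (density κ ‖w‖ : ℂ) :=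
    Complex.measurable_ofReal.comp ((measurable_density κ).comp measurable_norm)
  have hFm : Measurable F :=
    (hdm.mul (measurable_const.sub measurable_id).inv).indicator measurableSet_ball
  have hFi : Integrable F :=
    (integrable_indicator_iff measurableSet_ball).2 (integrableOn_density_div κ hκ.le z hz.le)
  have hpm : Measurable fun p : ℝ × ℝ => Complex.polarCoord.symm p := by
    simp only [Complex.polarCoord_symm_apply]
    fun_prop
  -- Finiteness of the integral of the norm passes to polar coordinates, so that radius and angle
  -- may be integrated one after the other.
  have hGi : IntegrableOn (fun p : ℝ × ℝ => p.1 • F (Complex.polarCoord.symm p))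
      polarCoord.target := by
    refine ⟨(measurable_fst.smul (hFm.comp hpm)).aestronglyMeasurable, ?_⟩
    have h1 := hFi.2
    rw [HasFiniteIntegral, ← Complex.lintegral_comp_polarCoord_symm] at h1
    rw [HasFiniteIntegral]
    refine lt_of_le_of_lt (le_of_eq ?_) h1
    refine setLIntegral_congr_fun polarCoord.open_target.measurableSet fun p hp => ?_
    simp only [enorm_smul, smul_eq_mul]
    rw [Real.enorm_of_nonneg (le_of_lt (polarCoord_target ▸ hp).1)]
  rw [← integral_indicator measurableSet_ball, ← hF, ← Complex.integral_comp_polarCoord_symm]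
  rw [polarCoord_target] at hGi ⊢
  have hprod := setIntegral_prod (μ := (volume : Measure ℝ)) (ν := (volume : Measure ℝ)) _ hGi
  rw [← Measure.volume_eq_prod] at hprod
  rw [hprod]
  -- Only the circles of radius r < ‖z‖ contribute. The circle through z, where the kernel is
  -- singular, is a single value of r.
  have hinner : ∀ r ∈ Ioi (0 : ℝ), r ≠ ‖z‖ →
      ∫ θ in Ioo (-Real.pi) Real.pi, r • F (Complex.polarCoord.symm (r, θ)) =
        (Ioo 0 ‖z‖).indicator (fun r => ((r * density κ r : ℝ) : ℂ) * (2 * Real.pi / z)) r := by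
    intro r hr hrz
    have hr0 : 0 < r := hr
    have hsym : ∀ θ : ℝ, Complex.polarCoord.symm (r, θ) = r * Complex.exp (θ * Complex.I) := by
      intro θ
      rw [Complex.polarCoord_symm_apply, Complex.exp_mul_I]
      push_cast
      rfl
    have hnorm : ∀ θ : ℝ, ‖(r : ℂ) * Complex.exp (θ * Complex.I)‖ = r := by
      intro θ
      rw [norm_mul, Complex.norm_exp_ofReal_mul_I, Complex.norm_real, Real.norm_of_nonneg hr0.le,
        mul_one]
    by_cases hrR : r < R
    · have hFv : ∀ θ : ℝ, r • F (Complex.polarCoord.symm (r, θ)) =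
          ((r * density κ r : ℝ) : ℂ) * (z - r * Complex.exp (θ * Complex.I))⁻¹ := by
        intro θ
        rw [hsym, hF, indicator_of_mem (by rw [mem_ball_zero_iff, hnorm]; exact hrR), hnorm,
          Complex.real_smul]
        push_cast
        ring
      simp only [hFv]
      rw [integral_const_mul, ← integral_Ioc_eq_integral_Ioo,
        ← intervalIntegral.integral_of_le (by linarith [Real.pi_pos]),
        integral_circle_inv_sub hr0 hrz]
      by_cases h : r < ‖z‖
      · rw [if_pos h, indicator_of_mem (show r ∈ Ioo 0 ‖z‖ from ⟨hr0, h⟩)]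
      · rw [if_neg h, indicator_of_notMem fun h' => h h'.2, mul_zero]
    · have hFv : ∀ θ : ℝ, r • F (Complex.polarCoord.symm (r, θ)) = 0 := by
        intro θ
        rw [hsym, hF, indicator_of_notMem (by rw [mem_ball_zero_iff, hnorm]; exact hrR), smul_zero]
      simp only [hFv, integral_zero]
      rw [indicator_of_notMem fun h' => hrR (h'.2.trans hz)]
  have houter : ∫ r in Ioi (0 : ℝ), (∫ θ in Ioo (-Real.pi) Real.pi,
      r • F (Complex.polarCoord.symm (r, θ))) = ∫ r in Ioi (0 : ℝ),
        (Ioo 0 ‖z‖).indicator (fun r => ((r * density κ r : ℝ) : ℂ) * (2 * Real.pi / z)) r := by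
    refine setIntegral_congr_ae measurableSet_Ioi ?_
    filter_upwards [Measure.ae_ne volume ‖z‖] with r h1 h2
    exact hinner r h2 h1
  rw [houter, setIntegral_indicator measurableSet_Ioo,
    inter_eq_self_of_subset_right (show Ioo 0 ‖z‖ ⊆ Ioi 0 from fun r hr => hr.1), integral_mul_const,
    integral_complex_ofReal, integral_mul_density hκ (norm_nonneg z)]
  push_cast
  ring

end Area

/-! ### Stokes' formula by integration of winding numbers -/

section AreaFormula

open MeasureTheory Set

variable {z : ℝ → ℂ}

/-- The singularity moves with t, but its integral over the ball is bounded uniformly in t, as are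
the velocity and the density. -/
theorem integrable_kernel (hz : ContDiffOn ℝ ∞ z (Icc 0 1)) {κ R : ℝ} (hκ : 0 ≤ κ)
    (hR : ∀ t ∈ Icc (0 : ℝ) 1, ‖z t‖ < R) :
    Integrable (Function.uncurry fun (t : ℝ) (w : ℂ) =>
        derivWithin z (Icc 0 1) t * ((density κ ‖w‖ : ℂ) * (z t - w)⁻¹))
      ((volume.restrict (Ioc (0 : ℝ) 1)).prod (volume.restrict (Metric.ball (0 : ℂ) R))) := by
  set d := derivWithin z (Icc 0 1)
  have hd := continuousOn_velocity hz
  have hdm : AEMeasurable d (volume.restrict (Ioc (0 : ℝ) 1)) :=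
    (hd.mono Ioc_subset_Icc_self).aemeasurable measurableSet_Ioc
  have hzm : AEMeasurable z (volume.restrict (Ioc (0 : ℝ) 1)) :=
    (hz.continuousOn.mono Ioc_subset_Icc_self).aemeasurable measurableSet_Ioc
  have hρ : Measurable fun w : ℂ => (density κ ‖w‖ : ℂ) :=
    Complex.measurable_ofReal.comp ((measurable_density κ).comp measurable_norm)
  have hmeas : AEStronglyMeasurable (Function.uncurry fun (t : ℝ) (w : ℂ) =>
      d t * ((density κ ‖w‖ : ℂ) * (z t - w)⁻¹))
      ((volume.restrict (Ioc (0 : ℝ) 1)).prod (volume.restrict (Metric.ball (0 : ℂ) R))) :=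
    (hdm.comp_fst.mul ((hρ.comp measurable_snd).aemeasurable.mul
      (hzm.comp_fst.sub measurable_snd.aemeasurable).inv)).aestronglyMeasurable
  obtain ⟨M, hM⟩ := (isCompact_Icc.image_of_continuousOn hd).isBounded.exists_norm_le
  have hM0 : 0 ≤ M := (norm_nonneg _).trans (hM _ ⟨0, by simp, rfl⟩)
  rw [integrable_prod_iff hmeas]
  constructor
  · refine (ae_restrict_iff' measurableSet_Ioc).2 (ae_of_all _ fun t ht => ?_)
    exact (integrableOn_density_div κ hκ (z t) (hR t (Ioc_subset_Icc_self ht)).le).const_mul (d t)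
  · refine Integrable.mono' (g := fun _ => M * (Real.cosh (κ * R) ^ 2 *
      ∫ w in Metric.ball (0 : ℂ) (2 * R), ‖w⁻¹‖)) (integrable_const _)
      hmeas.norm.integral_prod_right' ?_
    refine (ae_restrict_iff' measurableSet_Ioc).2 (ae_of_all _ fun t ht => ?_)
    have ht' := Ioc_subset_Icc_self ht
    obtain ⟨hi, hle⟩ := integrableOn_norm_inv_sub (z t) (hR t ht').le
    rw [Real.norm_of_nonneg (integral_nonneg fun _ => norm_nonneg _)]
    simp only [Function.uncurry_apply_pair]
    calc ∫ w in Metric.ball (0 : ℂ) R, ‖d t * ((density κ ‖w‖ : ℂ) * (z t - w)⁻¹)‖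
        ≤ ∫ w in Metric.ball (0 : ℂ) R, M * (Real.cosh (κ * R) ^ 2 * ‖(z t - w)⁻¹‖) := by
          refine setIntegral_mono_on ?_ ((hi.const_mul _).const_mul _) measurableSet_ball ?_
          · exact ((integrableOn_density_div κ hκ (z t) (hR t ht').le).const_mul (d t)).norm
          · intro w hw
            rw [mem_ball_zero_iff] at hw
            rw [norm_mul, norm_mul, Complex.norm_real,
              Real.norm_of_nonneg (density_nonneg hκ (norm_nonneg w))]
            have := mul_nonneg (density_nonneg hκ (norm_nonneg w)) (norm_nonneg (z t - w)⁻¹)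
            gcongr
            · exact hM _ ⟨t, ht', rfl⟩
            · exact density_le hκ (norm_nonneg w) hw.le
      _ ≤ _ := by
        rw [integral_const_mul, integral_const_mul]
        gcongr

/-- The line integral of the primitive of the area form along a closed curve is the area which
the curve encloses. -/
theorem lineIntegral_eq_area (hz : ContDiffOn ℝ ∞ z (Icc 0 1)) (hcl : z 0 = z 1)
    (hor : ∀ w ∈ enclosed z, winding z w = 1) {κ : ℝ} (hκ : 0 < κ) :
    ∫ t in (0 : ℝ)..1, Real.sinh (κ * ‖z t‖) ^ 2 / ‖z t‖ ^ 2 *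
      ((starRingEnd ℂ) (z t) * derivWithin z (Icc 0 1) t).im =
      2 * κ ^ 2 * ∫ w in enclosed z, density κ ‖w‖ := by
  obtain ⟨R₀, hR₀⟩ := (isCompact_Icc.image_of_continuousOn hz.continuousOn).isBounded.exists_norm_le
  obtain ⟨R, hR⟩ : ∃ R, ∀ t ∈ Icc (0 : ℝ) 1, ‖z t‖ < R :=
    ⟨R₀ + 1, fun t ht => (hR₀ _ ⟨t, ht, rfl⟩).trans_lt (lt_add_one _)⟩
  -- Integrating over w first gives the line integral of the potential; integrating over t first
  -- gives the density times the winding integral.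
  have hswap := integral_integral_swap (integrable_kernel hz hκ.le hR)
  have hint := (integrable_kernel hz hκ.le hR).integral_prod_left
  simp only [Function.uncurry_apply_pair] at hint
  set d := derivWithin z (Icc 0 1) with hd
  have hleft : ∀ t ∈ Ioc (0 : ℝ) 1,
      ∫ w in Metric.ball (0 : ℂ) R, d t * ((density κ ‖w‖ : ℂ) * (z t - w)⁻¹) =
        d t * (((Real.pi * Real.sinh (κ * ‖z t‖) ^ 2 / κ ^ 2 : ℝ) : ℂ) / z t) := by
    intro t ht
    rw [integral_const_mul, integral_density_div hκ (z t) (hR t (Ioc_subset_Icc_self ht))]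
  have hright : ∀ w : ℂ, ∫ t in Ioc (0 : ℝ) 1, d t * ((density κ ‖w‖ : ℂ) * (z t - w)⁻¹) =
      (density κ ‖w‖ : ℂ) * windingIntegral z w := by
    intro w
    rw [windingIntegral, intervalIntegral.integral_of_le zero_le_one, ← integral_const_mul]
    congr 1
    ext t
    rw [← hd]
    ring
  have hball : enclosed z ⊆ Metric.ball 0 R := fun w hw =>
    mem_ball_zero_iff.2 (norm_lt_of_mem_enclosed hz hcl hor hR hw)
  have hmeas : MeasurableSet (enclosed z) := (isOpen_enclosed hz).measurableSet
  have hR2 : ∫ w in Metric.ball (0 : ℂ) R,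
      ∫ t in Ioc (0 : ℝ) 1, d t * ((density κ ‖w‖ : ℂ) * (z t - w)⁻¹) =
      (2 * Real.pi * Complex.I) * ((∫ w in enclosed z, density κ ‖w‖ : ℝ) : ℂ) := by
    simp only [hright]
    rw [← integral_complex_ofReal, ← integral_const_mul,
      ← inter_eq_self_of_subset_right hball, ← setIntegral_indicator hmeas]
    -- Off the curve, a null set, the winding integral is 2πi on the enclosed region and 0
    -- elsewhere.
    refine integral_congr_ae (ae_restrict_of_ae ?_)
    filter_upwards [measure_eq_zero_iff_ae_notMem.1 (volume_curve_eq_zero hz)] with w hw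
    by_cases h : w ∈ enclosed z
    · rw [indicator_of_mem h, windingIntegral_of_mem_enclosed hz hor h, mul_comm]
    · rw [indicator_of_notMem h, windingIntegral_eq_zero_of_unbounded hz hcl hw h, mul_zero]
  rw [hR2, setIntegral_congr_fun measurableSet_Ioc hleft] at hswap
  have hint' : IntegrableOn
      (fun t => d t * (((Real.pi * Real.sinh (κ * ‖z t‖) ^ 2 / κ ^ 2 : ℝ) : ℂ) / z t))
      (Ioc 0 1) := IntegrableOn.congr_fun hint hleft measurableSet_Ioc
  -- The area side is purely imaginary, and 1/z = z̄/‖z‖² turns the imaginary part of the other side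
  -- into the required line integral.
  have him := congrArg Complex.im hswap
  rw [← RCLike.im_eq_complex_im, ← integral_im hint', RCLike.im_eq_complex_im] at him
  have hpt : ∀ t : ℝ, (d t * (((Real.pi * Real.sinh (κ * ‖z t‖) ^ 2 / κ ^ 2 : ℝ) : ℂ) / z t)).im =
      Real.pi / κ ^ 2 * (Real.sinh (κ * ‖z t‖) ^ 2 / ‖z t‖ ^ 2 *
        ((starRingEnd ℂ) (z t) * d t).im) := by
    intro t
    have : d t * (((Real.pi * Real.sinh (κ * ‖z t‖) ^ 2 / κ ^ 2 : ℝ) : ℂ) / z t) =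
        ((Real.pi / κ ^ 2 * (Real.sinh (κ * ‖z t‖) ^ 2 / ‖z t‖ ^ 2) : ℝ) : ℂ) *
          ((starRingEnd ℂ) (z t) * d t) := by
      rw [div_eq_mul_inv _ (z t), Complex.inv_def, Complex.normSq_eq_norm_sq]
      push_cast
      ring
    rw [this, Complex.im_ofReal_mul, mul_assoc]
  simp only [hpt] at him
  rw [integral_const_mul, mul_comm (2 * (Real.pi : ℂ)) Complex.I, mul_assoc] at him
  have e : (Complex.I * (2 * (Real.pi : ℂ) * ((∫ w in enclosed z, density κ ‖w‖ : ℝ) : ℂ))).im =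
      2 * Real.pi * ∫ w in enclosed z, density κ ‖w‖ := by
    rw [Complex.I_mul_im]
    norm_cast
  rw [e] at him
  rw [intervalIntegral.integral_of_le zero_le_one]
  have hpi := Real.pi_pos.ne'
  have hκ0 := hκ.ne'
  generalize (∫ t in Ioc (0 : ℝ) 1, Real.sinh (κ * ‖z t‖) ^ 2 / ‖z t‖ ^ 2 *
    ((starRingEnd ℂ) (z t) * d t).im) = I at *
  field_simp at him
  linear_combination him

end AreaFormula

/-! ### Horizontal lifts -/

section Lift

open Set

variable {n m : ℕ}

theorem projTotal_mul_blockHom_eq_iff (G : U n m) (h h' : Matrix.unitaryGroup (Fin n) ℂ)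
    (k k' : Matrix.unitaryGroup (Fin m) ℂ) :
    projTotal (G * blockHom n m (h, k)) = projTotal (G * blockHom n m (h', k')) ↔ h = h' := by
  have e : (G * blockHom n m (h, k))⁻¹ * (G * blockHom n m (h', k')) =
      blockHom n m (h⁻¹ * h', k⁻¹ * k') := by
    rw [mul_inv_rev, mul_assoc, inv_mul_cancel_left, ← map_inv, ← map_mul]
    rfl
  rw [projTotal, projTotal, QuotientGroup.eq, e]
  constructor
  · rintro ⟨l, hl⟩
    have h1 : mat (blockHom n m (1, l)) = mat (blockHom n m (h⁻¹ * h', k⁻¹ * k')) :=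
      congrArg mat hl
    have h2 : (1 : Matrix (Fin n) (Fin n) ℂ) = ((h⁻¹ * h' : Matrix.unitaryGroup (Fin n) ℂ) : _) :=
      congrArg Matrix.toBlocks₁₁ h1
    exact inv_mul_eq_one.1 (Subtype.ext h2.symm)
  · rintro rfl
    exact ⟨k⁻¹ * k', by rw [inv_mul_cancel]; rfl⟩

theorem rightAct_projTotal_blockHom (G : U n m) (h u : Matrix.unitaryGroup (Fin n) ℂ)
    (k : Matrix.unitaryGroup (Fin m) ℂ) :
    rightAct (projTotal (G * blockHom n m (h, k))) u = projTotal (G * blockHom n m (h * u, k)) := by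
  change projTotal (G * blockHom n m (h, k) * blockHom n m (u, 1)) = _
  rw [mul_assoc, ← map_mul, Prod.mk_mul_mk, mul_one]

theorem rightAct_projTotal (G : U n m) (u : Matrix.unitaryGroup (Fin n) ℂ) :
    rightAct (projTotal G) u = projTotal (G * blockHom n m (u, 1)) := rfl

theorem projD_mul_blockHom (G : U n m)
    (p : Matrix.unitaryGroup (Fin n) ℂ × Matrix.unitaryGroup (Fin m) ℂ) :
    projD (G * blockHom n m p) = projD G :=
  QuotientGroup.eq.2 ⟨p⁻¹, by rw [map_inv, mul_inv_rev, inv_mul_cancel_right]⟩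

theorem exists_eq_mul_blockHom {G G' : U n m} (h : projD G = projD G') :
    ∃ p : Matrix.unitaryGroup (Fin n) ℂ × Matrix.unitaryGroup (Fin m) ℂ,
      G' = G * blockHom n m p := by
  obtain ⟨p, hp⟩ := QuotientGroup.eq.1 h
  exact ⟨p, by rw [hp, mul_inv_cancel_left]⟩

open scoped ComplexOrder in
/-- A matrix which is orthogonal to all skew-Hermitian matrices has no skew-Hermitian part. -/
theorem eq_zero_of_forall_skew {H B : Matrix (Fin n) (Fin n) ℂ} (hH : Hᴴ = H) (hB : Bᴴ = -B)
    (h : ∀ A : Matrix (Fin n) (Fin n) ℂ, Aᴴ = -A → (Matrix.trace ((H + B)ᴴ * A)).re = 0) :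
    B = 0 := by
  -- The test matrix is B itself: Tr(HB) is purely imaginary, so the condition reduces to Tr(B*B) =
  -- 0.
  have h1 := h B hB
  have h2 : (Matrix.trace (H * B)).re = 0 := by
    have h3 := reTrace_conjTranspose (H * B)
    rw [Matrix.conjTranspose_mul, hB, hH, Matrix.neg_mul, Matrix.trace_neg, Matrix.trace_mul_comm,
      Complex.neg_re] at h3
    linarith
  have h4 : (Matrix.trace (Bᴴ * B)).im = 0 := by
    refine Complex.conj_eq_iff_im.1 ?_
    rw [starRingEnd_apply, ← Matrix.trace_conjTranspose, Matrix.conjTranspose_mul,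
      Matrix.conjTranspose_conjTranspose]
  rw [Matrix.conjTranspose_add, Matrix.add_mul, hH, Matrix.trace_add, Complex.add_re, h2,
    zero_add] at h1
  exact Matrix.trace_conjTranspose_mul_self_eq_zero_iff.1 (Complex.ext h1 h4)

theorem ip_fromBlocks (M : Mat n m) (A : Matrix (Fin n) (Fin n) ℂ) :
    ip M (Matrix.fromBlocks A 0 0 0) = 1 / 2 * (Matrix.trace ((M.toBlocks₁₁)ᴴ * A)).re := by
  rw [ip]
  conv_lhs => rw [← Matrix.fromBlocks_toBlocks M]
  simp [Matrix.fromBlocks_conjTranspose, Matrix.fromBlocks_multiply, Matrix.trace,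
    Fintype.sum_sum_type]

variable {V X : Matrix (Fin m) (Fin n) ℂ} {κ : ℝ}

/-- The coefficient of the canonical connection along the curve with coordinate `z`. -/
def connectionCoeff (κ : ℝ) (z : ℝ → ℂ) (t : ℝ) : ℝ :=
  ((starRingEnd ℂ) (sinhPolar (κ * z t)) *
    derivWithin (fun s => sinhPolar (κ * z s)) (Icc 0 1) t).im

theorem contDiffOn_sinhPolar_curve {z : ℝ → ℂ} (hz : ContDiffOn ℝ ∞ z (Icc 0 1)) :
    ContDiffOn ℝ ∞ (fun s => sinhPolar (κ * z s)) (Icc 0 1) :=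
  contDiff_sinhPolar.comp_contDiffOn (contDiffOn_const.mul hz)

theorem continuousOn_connectionCoeff {z : ℝ → ℂ} (hz : ContDiffOn ℝ ∞ z (Icc 0 1)) :
    ContinuousOn (connectionCoeff κ z) (Icc 0 1) := by
  have h := contDiffOn_sinhPolar_curve (κ := κ) hz
  exact Complex.continuous_im.comp_continuousOn
    ((Complex.continuous_conj.comp_continuousOn h.continuousOn).mul (continuousOn_velocity h))

/-- `sinhPolar` of κz is a real function φ times z, and Im(φz̄(φ'z + φz')) = φ² Im(z̄z') because z̄z
is real. -/
theorem connectionCoeff_eq {z : ℝ → ℂ} (hz : ContDiffOn ℝ ∞ z (Icc 0 1)) (hκ : 0 < κ) {t : ℝ}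
    (ht : t ∈ Icc (0 : ℝ) 1) : connectionCoeff κ z t =
      Real.sinh (κ * ‖z t‖) ^ 2 / ‖z t‖ ^ 2 *
        ((starRingEnd ℂ) (z t) * derivWithin z (Icc 0 1) t).im := by
  have hκ' : (κ : ℂ) ≠ 0 := by exact_mod_cast hκ.ne'
  by_cases h0 : z t = 0
  · simp [connectionCoeff, h0, sinhPolar]
  have hd : HasDerivWithinAt (fun s => (κ : ℂ) * z s) (κ * derivWithin z (Icc 0 1) t) (Icc 0 1) t :=
    ((hz.differentiableOn (by simp)) t ht).hasDerivWithinAt.const_mul _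
  have hS := hasDerivWithinAt_sinhPolar hd (mul_ne_zero hκ' h0)
  rw [connectionCoeff, hS.derivWithin (uniqueDiffOn_Icc zero_lt_one t ht), sinhPolar]
  have hn : ‖(κ : ℂ) * z t‖ = κ * ‖z t‖ := by
    rw [norm_mul, Complex.norm_real, Real.norm_of_nonneg hκ.le]
  have hr : ‖z t‖ ≠ 0 := norm_ne_zero_iff.2 h0
  rw [hn]
  generalize (Real.cosh (κ * ‖z t‖) * (κ * ‖z t‖) - Real.sinh (κ * ‖z t‖)) / (κ * ‖z t‖) ^ 2 *
    (((starRingEnd ℂ) (κ * z t) * (κ * derivWithin z (Icc 0 1) t)).re / (κ * ‖z t‖)) = f'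
  generalize derivWithin z (Icc 0 1) t = d
  generalize Real.sinh (κ * ‖z t‖) = sh
  have hκ0 := hκ.ne'
  simp only [map_mul, Complex.conj_ofReal, Complex.mul_im, Complex.mul_re, Complex.add_im,
    Complex.add_re, Complex.ofReal_re, Complex.ofReal_im, Complex.conj_re, Complex.conj_im]
  field_simp
  ring

/-- For c̄ = gE diag(h, k), the 𝔲(n)-block of c̄⁻¹c̄' is x h*Ph + h*h' with x = CC' − S̄S'.
Horizontality annihilates its skew-Hermitian part, so h*h' = −i Im(x) h*Ph, and Im x = −Im(S̄S'). -/
theorem hasDerivWithinAt_holonomy (hV : V * Vᴴ * V = V) (hW : unitize X = κ • V) {g : U n m}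
    {z : ℝ → ℂ} (hz : ContDiffOn ℝ ∞ z (Icc 0 1)) {cbar : ℝ → U n m}
    (hcbar : ContDiffOn ℝ ∞ (fun t => mat (cbar t)) (Icc 0 1))
    {p : ℝ → Matrix.unitaryGroup (Fin n) ℂ × Matrix.unitaryGroup (Fin m) ℂ}
    (hp : ∀ t ∈ Icc (0 : ℝ) 1, cbar t = surfaceLift X g (z t) * blockHom n m (p t))
    (hhor : ∀ t ∈ Icc (0 : ℝ) 1, ∀ A : Matrix (Fin n) (Fin n) ℂ, Aᴴ = -A →
      ip ((mat (cbar t))⁻¹ * derivWithin (fun s => mat (cbar s)) (Icc 0 1) t)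
        (Matrix.fromBlocks A 0 0 0) = 0) {t : ℝ} (ht : t ∈ Icc (0 : ℝ) 1) :
    HasDerivWithinAt (fun s => ((p s).1 : Matrix (Fin n) (Fin n) ℂ))
      ((Complex.I * connectionCoeff κ z t) • (Vᴴ * V * ((p t).1 : Matrix (Fin n) (Fin n) ℂ))) (Icc 0 1) t := by
  set I := Icc (0 : ℝ) 1
  have huniq := uniqueDiffOn_Icc (zero_lt_one' ℝ) t ht
  let C : ℝ → ℝ := fun s => Real.cosh ‖(κ : ℂ) * z s‖
  let S : ℝ → ℂ := fun s => sinhPolar (κ * z s)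
  have hSd : HasDerivWithinAt S (derivWithin S I t) I t :=
    ((contDiffOn_sinhPolar_curve (κ := κ) hz).differentiableOn (by simp) t ht).hasDerivWithinAt
  -- C' must be real: then CC' does not contribute to the imaginary part of x.
  obtain ⟨C', hCd⟩ : ∃ C' : ℝ, HasDerivWithinAt (fun s => (C s : ℂ)) C' I t := by
    have h1 : ContDiffOn ℝ ∞ (fun s => (C s : ℂ)) I :=
      contDiff_cosh_norm.comp_contDiffOn (contDiffOn_const.mul hz)
    have h2 := (h1.differentiableOn (by simp) t ht).hasDerivWithinAt
    have h3 : HasDerivWithinAt (fun s => (C s : ℂ).re) (derivWithin (fun s => (C s : ℂ)) I t).re I t :=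
      Complex.reCLM.hasFDerivAt.comp_hasDerivWithinAt t h2
    exact ⟨_, h3.ofReal_comp⟩
  set S' := derivWithin S I t
  let E : ℝ → Mat n m := fun s => rot V (C s) (S s)
  let F : ℝ → Mat n m := fun s => rot V (C s) (-S s)
  let N : ℝ → Mat n m := fun s => Matrix.fromBlocks (p s).1 0 0 (p s).2
  have hFE : ∀ s, F s * E s = 1 := fun s => mul_eq_one_comm.1 (rot_mul_rot_neg hV _)
  have hcE : ∀ s ∈ I, mat (cbar s) = mat g * E s * N s := by
    intro s hs
    rw [hp s hs]
    change mat (surfaceLift X g (z s)) * N s = _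
    rw [mat_surfaceLift hV hW]
  -- The block factor was chosen pointwise; solving for it shows that it is differentiable.
  have hNF : ∀ s ∈ I, N s = F s * ((mat g)⁻¹ * mat (cbar s)) := by
    intro s hs
    rw [hcE s hs, Matrix.mul_assoc (mat g), ← Matrix.mul_assoc (mat g)⁻¹, mat_inv_mul,
      Matrix.one_mul, ← Matrix.mul_assoc, hFE, Matrix.one_mul]
  have hEd : HasDerivWithinAt E (rotTangent V C' S') I t := hasDerivWithinAt_rot hCd hSd
  have hFd : HasDerivWithinAt F (rotTangent V C' (-S')) I t := hasDerivWithinAt_rot hCd hSd.neg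
  have hcd := (hcbar.differentiableOn (by simp) t ht).hasDerivWithinAt
  have hNd : ∃ N', HasDerivWithinAt N N' I t :=
    ⟨_, (hFd.mul (hcd.const_mul (mat g)⁻¹)).congr hNF (hNF t ht)⟩
  obtain ⟨N', hNd⟩ := hNd
  set h : ℝ → Matrix (Fin n) (Fin n) ℂ := fun s => (p s).1 with hh
  have hhd : HasDerivWithinAt h N'.toBlocks₁₁ I t :=
    (block₁₁ (n := n) (m := m)).hasFDerivAt.comp_hasDerivWithinAt t hNd
  set h' := N'.toBlocks₁₁ with hh'
  have hunit : ∀ s, (h s)ᴴ * h s = 1 := fun s => Matrix.mem_unitaryGroup_iff'.1 (p s).1.2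
  have hunit' : ∀ s, h s * (h s)ᴴ = 1 := fun s => Matrix.mem_unitaryGroup_iff.1 (p s).1.2
  have hskew : (h t)ᴴ * h' + h'ᴴ * h t = 0 := by
    have h1 : HasDerivWithinAt (fun s => (h s)ᴴ) h'ᴴ I t :=
      (conjTransposeCLM (ι := Fin n) (κ := Fin n)).hasFDerivAt.comp_hasDerivWithinAt t hhd
    have h2 := hasDerivWithinAt_matrix_mul h1 hhd
    simp only [hunit] at h2
    exact huniq.eq_deriv _ h2 (hasDerivWithinAt_const _ _ _)
  have hcd2 : derivWithin (fun s => mat (cbar s)) I t =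
      mat g * rotTangent V C' S' * N t + mat g * E t * N' :=
    (((hEd.const_mul (mat g)).mul hNd).congr hcE (hcE t ht)).derivWithin huniq
  set x : ℂ := C t * C' + (starRingEnd ℂ) (-S t) * S' with hx
  have hinv : (mat (cbar t))⁻¹ = Matrix.fromBlocks (h t)ᴴ 0 0 ((p t).2 : Matrix _ _ ℂ)ᴴ *
      (F t * (mat g)⁻¹) := by
    apply Matrix.inv_eq_left_inv
    have h2 : ((p t).2 : Matrix (Fin m) (Fin m) ℂ)ᴴ * (p t).2 = 1 :=
      Matrix.mem_unitaryGroup_iff'.1 (p t).2.2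
    rw [Matrix.mul_assoc, Matrix.mul_assoc, ← hNF t ht, Matrix.fromBlocks_multiply]
    have h1 : (h t)ᴴ * ((p t).1 : Matrix (Fin n) (Fin n) ℂ) = 1 := hunit t
    simp only [h1, h2, Matrix.mul_zero, Matrix.zero_mul, add_zero, zero_add, Matrix.fromBlocks_one]
  have hM : ((mat (cbar t))⁻¹ * derivWithin (fun s => mat (cbar s)) I t).toBlocks₁₁ =
      x • ((h t)ᴴ * (Vᴴ * V) * h t) + (h t)ᴴ * h' := by
    have e1 : F t * (mat g)⁻¹ * (mat g * rotTangent V C' S' * N t + mat g * E t * N') =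
        rot V (C t) (-S t) * rotTangent V C' S' * N t + N' := by
      calc F t * (mat g)⁻¹ * (mat g * rotTangent V C' S' * N t + mat g * E t * N')
          = F t * ((mat g)⁻¹ * mat g) * rotTangent V C' S' * N t +
            F t * ((mat g)⁻¹ * mat g) * E t * N' := by
            simp only [Matrix.mul_add, Matrix.mul_assoc]
        _ = _ := by rw [mat_inv_mul, Matrix.mul_one, hFE, Matrix.one_mul]
    rw [hcd2, hinv, Matrix.mul_assoc, e1, rot_mul_rotTangent hV, rotTangent,
      Matrix.fromBlocks_multiply, ← Matrix.fromBlocks_toBlocks N', Matrix.fromBlocks_add,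
      Matrix.fromBlocks_multiply, Matrix.toBlocks_fromBlocks₁₁]
    simp only [Matrix.mul_zero, smul_zero, add_zero, Matrix.zero_mul, Matrix.mul_add,
      Matrix.smul_mul, Matrix.mul_smul, ← Matrix.mul_assoc, hh]
    rfl
  have hxim : x.im = -connectionCoeff κ z t := by
    rw [hx, Complex.add_im, ← Complex.ofReal_mul, Complex.ofReal_im, zero_add, map_neg, neg_mul,
      Complex.neg_im]
    rfl
  have hP : (Vᴴ * V)ᴴ = Vᴴ * V := by
    rw [Matrix.conjTranspose_mul, Matrix.conjTranspose_conjTranspose]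
  set Q := (h t)ᴴ * (Vᴴ * V) * h t with hQ
  have hQH : Qᴴ = Q := by
    rw [hQ, Matrix.conjTranspose_mul, Matrix.conjTranspose_mul, hP,
      Matrix.conjTranspose_conjTranspose, ← Matrix.mul_assoc]
  -- Hermitian part plus skew-Hermitian part; h*h' is skew because h is unitary.
  have hsplit : x • Q + (h t)ᴴ * h' = (x.re : ℂ) • Q + ((Complex.I * x.im) • Q + (h t)ᴴ * h') := by
    nth_rewrite 1 [← Complex.re_add_im x]
    module
  have hB : (Complex.I * x.im) • Q + (h t)ᴴ * h' = 0 := by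
    refine eq_zero_of_forall_skew (H := (x.re : ℂ) • Q) ?_ ?_ fun A hA => ?_
    · rw [Matrix.conjTranspose_smul, hQH]; simp
    · rw [Matrix.conjTranspose_add, Matrix.conjTranspose_smul, hQH, Matrix.conjTranspose_mul,
        Matrix.conjTranspose_conjTranspose, neg_add, ← neg_eq_of_add_eq_zero_right hskew]
      simp
    · have := hhor t ht A hA
      rw [ip_fromBlocks, hM, hsplit] at this
      linarith
  refine hhd.congr_deriv ?_
  have h1 : (h t)ᴴ * h' = (Complex.I * connectionCoeff κ z t) • Q := by
    rw [hxim] at hB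
    rw [eq_neg_of_add_eq_zero_right hB]
    push_cast
    module
  calc h' = h t * (h t)ᴴ * h' := by rw [hunit', Matrix.one_mul]
    _ = _ := by
      rw [Matrix.mul_assoc, h1, Matrix.mul_smul, hQ, ← Matrix.mul_assoc, ← Matrix.mul_assoc,
        hunit', Matrix.one_mul]

theorem holonomy_eq (hV : V * Vᴴ * V = V) (hW : unitize X = κ • V) {g : U n m}
    {z : ℝ → ℂ} (hz : ContDiffOn ℝ ∞ z (Icc 0 1)) {cbar : ℝ → U n m}
    (hcbar : ContDiffOn ℝ ∞ (fun t => mat (cbar t)) (Icc 0 1))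
    {p : ℝ → Matrix.unitaryGroup (Fin n) ℂ × Matrix.unitaryGroup (Fin m) ℂ}
    (hp : ∀ t ∈ Icc (0 : ℝ) 1, cbar t = surfaceLift X g (z t) * blockHom n m (p t))
    (hhor : ∀ t ∈ Icc (0 : ℝ) 1, ∀ A : Matrix (Fin n) (Fin n) ℂ, Aᴴ = -A →
      ip ((mat (cbar t))⁻¹ * derivWithin (fun s => mat (cbar s)) (Icc 0 1) t)
        (Matrix.fromBlocks A 0 0 0) = 0) :
    ((p 1).1 : Matrix (Fin n) (Fin n) ℂ) =
      (1 + (Complex.exp (Complex.I * (∫ t in (0 : ℝ)..1, connectionCoeff κ z t : ℝ)) - 1) •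
        (Vᴴ * V)) * ((p 0).1 : Matrix (Fin n) (Fin n) ℂ) := by
  have hPP : Vᴴ * V * (Vᴴ * V) = Vᴴ * V := by
    rw [Matrix.mul_assoc, ← Matrix.mul_assoc V, hV]
  have hβ := continuousOn_connectionCoeff (κ := κ) hz
  -- A continuous extension of the coefficient to the line makes its primitive differentiable at the
  -- end points too.
  let b : ℝ → ℝ := IccExtend (zero_le_one' ℝ) ((Icc 0 1).domRestrict (connectionCoeff κ z))
  have hb : Continuous b := (continuousOn_iff_continuous_domRestrict.1 hβ).Icc_extend'
  have hbeq : ∀ t ∈ Icc (0 : ℝ) 1, b t = connectionCoeff κ z t := fun t ht =>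
    IccExtend_of_mem _ _ ht
  let T : ℝ → ℝ := fun t => ∫ s in (0 : ℝ)..t, b s
  have hT : ∀ t, HasDerivAt T (b t) t := fun t => (hb.integral_hasStrictDerivAt 0 t).hasDerivAt
  have hT1 : T 1 = ∫ t in (0 : ℝ)..1, connectionCoeff κ z t := by
    refine intervalIntegral.integral_congr fun t ht => hbeq t ?_
    rwa [uIcc_of_le zero_le_one] at ht
  -- Multiplication by the integrating factor e^{−iTP} makes the solution constant.
  let K : ℝ → Matrix (Fin n) (Fin n) ℂ := fun t =>
    (1 + (Complex.exp (-(Complex.I * T t)) - 1) • (Vᴴ * V)) * ((p t).1 : Matrix (Fin n) (Fin n) ℂ)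
  have hK : ∀ t ∈ Icc (0 : ℝ) 1, HasDerivWithinAt K 0 (Icc 0 1) t := by
    intro t ht
    have h1 : HasDerivAt (fun s => Complex.exp (-(Complex.I * T s)))
        (Complex.exp (-(Complex.I * T t)) * (-(Complex.I * b t))) t :=
      (((hT t).ofReal_comp.const_mul Complex.I).neg).cexp
    have h2 := (((h1.sub_const 1).smul_const (Vᴴ * V)).const_add 1).hasDerivWithinAt (s := Icc 0 1)
    have h3 := hasDerivWithinAt_holonomy hV hW hz hcbar hp hhor ht
    refine (hasDerivWithinAt_matrix_mul h2 h3).congr_deriv ?_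
    rw [hbeq t ht, Matrix.add_mul, Matrix.one_mul, Matrix.smul_mul, Matrix.smul_mul,
      Matrix.mul_smul, ← Matrix.mul_assoc, hPP]
    module
  have hconst := constant_of_derivWithin_zero (fun t ht => (hK t ht).differentiableWithinAt)
    (fun t ht => (hK t (Ico_subset_Icc_self ht)).derivWithin
      (uniqueDiffOn_Icc zero_lt_one t (Ico_subset_Icc_self ht))) 1 (right_mem_Icc.2 zero_le_one)
  have hK0 : K 0 = (p 0).1 := by simp [K, T]
  have hinv : (1 + (Complex.exp (Complex.I * T 1) - 1) • (Vᴴ * V)) *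
      (1 + (Complex.exp (-(Complex.I * T 1)) - 1) • (Vᴴ * V)) = 1 := by
    have he : Complex.exp (Complex.I * T 1) * Complex.exp (-(Complex.I * T 1)) = 1 := by
      rw [← Complex.exp_add, add_neg_cancel, Complex.exp_zero]
    generalize Complex.exp (Complex.I * T 1) = u at *
    generalize Complex.exp (-(Complex.I * T 1)) = v at *
    have he' : (v - 1) * (u - 1) = -(u - 1) - (v - 1) := by linear_combination he
    simp only [Matrix.add_mul, Matrix.mul_add, Matrix.one_mul, Matrix.mul_one, Matrix.smul_mul,
      Matrix.mul_smul, hPP, smul_add, smul_smul, he']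
    module
  rw [← hT1, ← hK0, ← hconst]
  simp only [K]
  rw [← Matrix.mul_assoc, hinv, Matrix.one_mul]

end Lift

/-! ### Matrices with a single positive singular value -/

section Spectral

variable {n m : ℕ}

/-- The projection onto the first `q` coordinates. -/
def firstProj (n q : ℕ) : Matrix (Fin n) (Fin n) ℂ :=
  Matrix.diagonal fun j : Fin n => if (j : ℕ) < q then 1 else 0

theorem diagConj_eq_smul (q : ℕ) (a : ℝ) (A : Matrix.unitaryGroup (Fin n) ℂ) :
    diagConj q a A = (2 * Complex.I / q * a) •
      ((A : Matrix (Fin n) (Fin n) ℂ) * firstProj n q * (A : Matrix (Fin n) (Fin n) ℂ)ᴴ) := by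
  have : Matrix.diagonal (fun j : Fin n => if (j : ℕ) < q then 2 * Complex.I / q * a else 0) =
      (2 * Complex.I / q * a) • firstProj n q := by
    rw [firstProj, ← Matrix.diagonal_smul]
    congr 1
    ext j
    simp
  rw [diagConj, this, Matrix.mul_smul, Matrix.smul_mul]

-- The eigenvalues are nonnegative, so each is l or 0, and the multiplicity counts the indices with
-- value l. A permutation puts their eigenvectors first.
open scoped ComplexOrder in
theorem exists_unitary_of_singlePositiveEigenvalue {M : Matrix (Fin n) (Fin n) ℂ}
    (hM : M.PosSemidef) {q : ℕ} {l : ℝ} (hq : M.charpoly.rootMultiplicity (l : ℂ) = q)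
    (huniq : ∀ l' : ℝ, 0 < l' → M.charpoly.IsRoot (l' : ℂ) → l' = l) :
    q ≤ n ∧ ∃ A : Matrix.unitaryGroup (Fin n) ℂ,
      M = (l : ℂ) • ((A : Matrix (Fin n) (Fin n) ℂ) * firstProj n q *
        (A : Matrix (Fin n) (Fin n) ℂ)ᴴ) := by
  have hH := hM.isHermitian
  have hroots := hH.roots_charpoly_eq_eigenvalues
  have hcard : Fintype.card {i : Fin n // hH.eigenvalues i = l} = q := by
    rw [← hq, ← Polynomial.count_roots, hroots, Multiset.count_map, Fintype.card_subtype]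
    rw [Finset.card_def, Finset.filter_val]
    congr 1
    refine Multiset.filter_congr fun i _ => ?_
    simp [eq_comm]
  have hqn : q ≤ n := by
    rw [← hcard]
    simpa using Fintype.card_subtype_le (fun i : Fin n => hH.eigenvalues i = l)
  have heig : ∀ i, hH.eigenvalues i = if hH.eigenvalues i = l then l else 0 := by
    intro i
    split_ifs with h
    · exact h
    · rcases (hM.eigenvalues_nonneg i).eq_or_lt with h0 | h0
      · exact h0.symm
      · refine absurd (huniq _ h0 ?_) h
        apply Polynomial.isRoot_of_mem_roots
        rw [hroots]
        exact Multiset.mem_map.2 ⟨i, Finset.mem_univ_val i, rfl⟩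
  have hcard' : Fintype.card {j : Fin n // (j : ℕ) < q} = q := by
    rw [Fintype.card_subtype]
    exact (Fin.card_filter_val_lt).trans (min_eq_right hqn)
  let e : {j : Fin n // (j : ℕ) < q} ≃ {i : Fin n // hH.eigenvalues i = l} :=
    Fintype.equivOfCardEq (hcard'.trans hcard.symm)
  let σ : Equiv.Perm (Fin n) := e.extendSubtype
  have hσ : ∀ j : Fin n, hH.eigenvalues (σ j) = if (j : ℕ) < q then l else 0 := by
    intro j
    split_ifs with h
    · exact e.extendSubtype_mem j h
    · rw [heig, if_neg (e.extendSubtype_not_mem j h)]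
  let W := hH.eigenvectorUnitary
  have hW : (W : Matrix (Fin n) (Fin n) ℂ) * (W : Matrix (Fin n) (Fin n) ℂ)ᴴ = 1 :=
    Matrix.mem_unitaryGroup_iff.1 W.2
  refine ⟨hqn, ⟨(W : Matrix (Fin n) (Fin n) ℂ).submatrix id σ, ?_⟩, ?_⟩
  · rw [Matrix.mem_unitaryGroup_iff, Matrix.star_eq_conjTranspose, Matrix.conjTranspose_submatrix,
      Matrix.submatrix_mul_equiv, hW, Matrix.submatrix_id_id]
  · have hd : (l : ℂ) • firstProj n q =
        (Matrix.diagonal (RCLike.ofReal ∘ hH.eigenvalues) : Matrix (Fin n) (Fin n) ℂ).submatrix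
          σ σ := by
      rw [Matrix.submatrix_diagonal_equiv, firstProj, ← Matrix.diagonal_smul]
      congr 1
      ext j
      simp only [Pi.smul_apply, Function.comp_apply, hσ]
      split_ifs <;> simp
    have hs : M = (W : Matrix (Fin n) (Fin n) ℂ) * Matrix.diagonal (RCLike.ofReal ∘ hH.eigenvalues) *
        (W : Matrix (Fin n) (Fin n) ℂ)ᴴ := by
      conv_lhs => rw [hH.spectral_theorem, Unitary.conjStarAlgAut_apply]
      rfl
    rw [← Matrix.smul_mul, ← Matrix.mul_smul, hd]
    change M = (W : Matrix (Fin n) (Fin n) ℂ).submatrix id σ * _ *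
      ((W : Matrix (Fin n) (Fin n) ℂ).submatrix id σ)ᴴ
    rw [Matrix.conjTranspose_submatrix, Matrix.submatrix_mul_equiv, Matrix.submatrix_mul_equiv, Matrix.submatrix_id_id]
    exact hs

theorem firstProj_mul_self (q : ℕ) : firstProj n q * firstProj n q = firstProj n q := by
  rw [firstProj, Matrix.diagonal_mul_diagonal]
  congr 1
  ext j
  split_ifs <;> simp

theorem trace_firstProj {q : ℕ} (hq : q ≤ n) : Matrix.trace (firstProj n q) = q := by
  rw [firstProj, Matrix.trace_diagonal, Finset.sum_ite, Finset.sum_const_zero, add_zero,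
    Finset.sum_const, nsmul_eq_mul, mul_one, Fin.card_filter_val_lt, min_eq_right hq]

theorem firstProj_self : firstProj n n = 1 := by
  rw [firstProj, ← Matrix.diagonal_one]
  congr 1
  ext j
  simp

open scoped ComplexOrder in
/-- A matrix with a single positive singular value is a multiple of a partial isometry. -/
theorem exists_partialIsometry {X : Matrix (Fin m) (Fin n) ℂ} {q : ℕ}
    (hX : HasSinglePositiveEigenvalue (Xᴴ * X) q) :
    0 < q ∧ q ≤ n ∧ ∃ (l : ℝ) (V : Matrix (Fin m) (Fin n) ℂ) (A : Matrix.unitaryGroup (Fin n) ℂ),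
      0 < l ∧ X = Real.sqrt l • V ∧ V * Vᴴ * V = V ∧
      Vᴴ * V = (A : Matrix (Fin n) (Fin n) ℂ) * firstProj n q *
        (A : Matrix (Fin n) (Fin n) ℂ)ᴴ := by
  obtain ⟨l, hl, hroot, hmult, huniq⟩ := hX
  have hq0 : 0 < q := by
    rw [← hmult]
    exact (Polynomial.rootMultiplicity_pos (Matrix.charpoly_monic _).ne_zero).2 hroot
  obtain ⟨hqn, A, hA⟩ := exists_unitary_of_singlePositiveEigenvalue
    (Matrix.posSemidef_conjTranspose_mul_self X) hmult huniq
  have hs : Real.sqrt l ≠ 0 := (Real.sqrt_pos.2 hl).ne'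
  have hsc : (Real.sqrt l : ℂ) ≠ 0 := by exact_mod_cast hs
  have hss : (Real.sqrt l : ℂ) * Real.sqrt l = l := by exact_mod_cast Real.mul_self_sqrt hl.le
  have hl0 : (l : ℂ) ≠ 0 := by exact_mod_cast hl.ne'
  set P := (A : Matrix (Fin n) (Fin n) ℂ) * firstProj n q * (A : Matrix (Fin n) (Fin n) ℂ)ᴴ with hP
  have hAA : (A : Matrix (Fin n) (Fin n) ℂ)ᴴ * A = 1 := Matrix.mem_unitaryGroup_iff'.1 A.2
  have hPP : P * P = P := by
    calc P * P = (A : Matrix (Fin n) (Fin n) ℂ) * firstProj n q *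
        ((A : Matrix (Fin n) (Fin n) ℂ)ᴴ * A) * firstProj n q *
          (A : Matrix (Fin n) (Fin n) ℂ)ᴴ := by simp only [hP, Matrix.mul_assoc]
      _ = P := by rw [hAA, Matrix.mul_one, Matrix.mul_assoc _ (firstProj n q) (firstProj n q),
          firstProj_mul_self]
  let V : Matrix (Fin m) (Fin n) ℂ := (Real.sqrt l : ℂ)⁻¹ • X
  have hXV : X = Real.sqrt l • V := by
    have : X = (Real.sqrt l : ℂ) • V := by rw [smul_smul, mul_inv_cancel₀ hsc, one_smul]
    exact this
  have hVV : Vᴴ * V = P := by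
    rw [Matrix.conjTranspose_smul, Matrix.smul_mul, Matrix.mul_smul, hA, smul_smul, smul_smul,
      Complex.star_def, map_inv₀, Complex.conj_ofReal, ← mul_inv, hss, inv_mul_cancel₀ hl0,
      one_smul]
  refine ⟨hq0, hqn, l, V, A, hl, hXV, ?_, hVV⟩
  -- The Gram matrix of V − VP is P − P − P + P, so V = VP.
  have hz : (V - V * P)ᴴ * (V - V * P) = 0 := by
    have hPH : Pᴴ = P := by
      rw [← hVV, Matrix.conjTranspose_mul, Matrix.conjTranspose_conjTranspose]
    have hPVVP : P * Vᴴ * (V * P) = P := by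
      rw [Matrix.mul_assoc, ← Matrix.mul_assoc Vᴴ, hVV, hPP, hPP]
    rw [Matrix.conjTranspose_sub, Matrix.conjTranspose_mul, hPH, Matrix.sub_mul, Matrix.mul_sub,
      Matrix.mul_sub, hPVVP, ← Matrix.mul_assoc Vᴴ V, Matrix.mul_assoc P Vᴴ V, hVV, hPP]
    abel
  have := Matrix.conjTranspose_mul_self_eq_zero.1 hz
  rw [Matrix.mul_assoc, hVV]
  exact (sub_eq_zero.1 this).symm

end Spectral

/-! ### The two areas and the holonomy exponent -/

section Exponent

open Set MeasureTheory

variable {n m : ℕ} {V X : Matrix (Fin m) (Fin n) ℂ} {κ : ℝ}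

/-- The density was computed only for w ≠ 0, which suffices for the integral. -/
theorem relatedArea_eq (hV : V * Vᴴ * V = V) (hκ : 0 < κ) (hW : unitize X = κ • V)
    (hτ : κ ^ 2 * (Matrix.trace (Vᴴ * V)).re = 1) (g : U n m) (z : ℝ → ℂ) :
    relatedArea X g z = ∫ w in enclosed z, density κ ‖w‖ := by
  refine integral_congr_ae (ae_restrict_of_ae ?_)
  filter_upwards [Measure.ae_ne volume (0 : ℂ)] with w hw
  exact relatedDensity_eq hV hκ hW hτ g hw

theorem inducedArea_eq (hV : V * Vᴴ * V = V) (hκ : 0 < κ) (hW : unitize X = κ • V)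
    (hτ : κ ^ 2 * (Matrix.trace (Vᴴ * V)).re = 1) (g : U n m) (z : ℝ → ℂ) :
    inducedArea X g z = ∫ w in enclosed z, density κ ‖w‖ := by
  refine integral_congr_ae (ae_restrict_of_ae ?_)
  filter_upwards [Measure.ae_ne volume (0 : ℂ)] with w hw
  exact inducedDensity_eq hV hκ hW hτ g hw

theorem integral_connectionCoeff {z : ℝ → ℂ} (hz : ContDiffOn ℝ ∞ z (Icc 0 1)) (hcl : z 0 = z 1)
    (hor : ∀ w ∈ enclosed z, winding z w = 1) (hκ : 0 < κ) :
    ∫ t in (0 : ℝ)..1, connectionCoeff κ z t = 2 * κ ^ 2 * ∫ w in enclosed z, density κ ‖w‖ := by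
  rw [← lineIntegral_eq_area hz hcl hor hκ]
  refine intervalIntegral.integral_congr fun t ht => connectionCoeff_eq hz hκ ?_
  rwa [uIcc_of_le zero_le_one] at ht

/-- The exponents start at 1, so every power of lP is a real multiple of P, and the span is
contained in one real line. -/
theorem exists_smul_of_mem_span {P : Matrix (Fin n) (Fin n) ℂ} (hPP : P * P = P) (l : ℝ) {r : ℕ}
    {M : Matrix (Fin n) (Fin n) ℂ} (hM : M ∈ Submodule.span ℝ
      ((fun k : ℕ => Complex.I • ((l : ℂ) • P) ^ k) '' Icc 1 r)) :
    ∃ s : ℝ, M = (Complex.I * s) • P := by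
  have hle : Submodule.span ℝ ((fun k : ℕ => Complex.I • ((l : ℂ) • P) ^ k) '' Icc 1 r) ≤
      Submodule.span ℝ {Complex.I • P} := by
    rw [Submodule.span_le]
    rintro _ ⟨k, hk, rfl⟩
    have hpow : P ^ k = P :=
      IsIdempotentElem.pow_eq (show IsIdempotentElem P from hPP) (Nat.one_le_iff_ne_zero.1 hk.1)
    refine Submodule.mem_span_singleton.2 ⟨l ^ k, ?_⟩
    simp only [smul_pow, hpow]
    rw [← Complex.coe_smul, smul_comm, Complex.ofReal_pow]
  obtain ⟨s, hs⟩ := Submodule.mem_span_singleton.1 (hle hM)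
  refine ⟨s, ?_⟩
  rw [← hs, ← Complex.coe_smul, smul_smul, mul_comm]

theorem rank_pos_of_ne_zero (hX : X ≠ 0) : 1 ≤ X.rank := by
  by_contra! h
  have h0 : X.rank = 0 := by omega
  rw [Matrix.rank, Submodule.finrank_eq_zero, LinearMap.range_eq_bot] at h0
  exact hX (Matrix.mulVec_injective (funext fun v => by
    simpa using LinearMap.congr_fun h0 v))

/-- The skew-Hermitian matrix which generates the holonomy of a curve enclosing the area `a`. -/
def holonomyGenerator (q : ℕ) (a : ℝ) (P : Matrix (Fin n) (Fin n) ℂ)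
    (h : Matrix.unitaryGroup (Fin n) ℂ) : Matrix (Fin n) (Fin n) ℂ :=
  (2 * Complex.I / q * a) •
    ((h : Matrix (Fin n) (Fin n) ℂ)ᴴ * P * (h : Matrix (Fin n) (Fin n) ℂ))

theorem unitary_conjTranspose_mul (h : Matrix.unitaryGroup (Fin n) ℂ) :
    (h : Matrix (Fin n) (Fin n) ℂ)ᴴ * h = 1 := Matrix.mem_unitaryGroup_iff'.1 h.2

theorem unitary_mul_conjTranspose (h : Matrix.unitaryGroup (Fin n) ℂ) :
    (h : Matrix (Fin n) (Fin n) ℂ) * (h : Matrix (Fin n) (Fin n) ℂ)ᴴ = 1 :=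
  Matrix.mem_unitaryGroup_iff.1 h.2

theorem conj_holonomyGenerator (q : ℕ) (a : ℝ) (P : Matrix (Fin n) (Fin n) ℂ)
    (h : Matrix.unitaryGroup (Fin n) ℂ) :
    (h : Matrix (Fin n) (Fin n) ℂ) * holonomyGenerator q a P h *
      (h : Matrix (Fin n) (Fin n) ℂ)ᴴ = (2 * Complex.I / q * a) • P := by
  rw [holonomyGenerator, Matrix.mul_smul, Matrix.smul_mul, Matrix.mul_assoc _ P,
    ← Matrix.mul_assoc, unitary_mul_conjTranspose, Matrix.one_mul, Matrix.mul_assoc,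
    unitary_mul_conjTranspose, Matrix.mul_one]

theorem trace_holonomyGenerator {q : ℕ} (hq : q ≠ 0) (a : ℝ) {P : Matrix (Fin n) (Fin n) ℂ}
    (hP : Matrix.trace P = q) (h : Matrix.unitaryGroup (Fin n) ℂ) :
    Matrix.trace (holonomyGenerator q a P h) = 2 * Complex.I * a := by
  have hq' : (q : ℂ) ≠ 0 := by exact_mod_cast hq
  rw [holonomyGenerator, Matrix.trace_smul, Matrix.trace_mul_cycle, unitary_mul_conjTranspose,
    Matrix.one_mul, hP, smul_eq_mul]
  field_simp

theorem exp_holonomyGenerator (q : ℕ) (a : ℝ) {P : Matrix (Fin n) (Fin n) ℂ} (hPP : P * P = P)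
    (h : Matrix.unitaryGroup (Fin n) ℂ) :
    NormedSpace.exp (holonomyGenerator q a P h) =
      (h : Matrix (Fin n) (Fin n) ℂ)ᴴ *
        ((1 + (Complex.exp (2 * Complex.I / q * a) - 1) • P) * h) := by
  rw [holonomyGenerator, exp_smul_of_idempotent]
  · rw [Matrix.add_mul, Matrix.one_mul, Matrix.mul_add, unitary_conjTranspose_mul, Matrix.smul_mul,
      Matrix.mul_smul, Matrix.mul_assoc]
  · calc (h : Matrix (Fin n) (Fin n) ℂ)ᴴ * P * h * ((h : Matrix (Fin n) (Fin n) ℂ)ᴴ * P * h)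
        = (h : Matrix (Fin n) (Fin n) ℂ)ᴴ * P * (h * (h : Matrix (Fin n) (Fin n) ℂ)ᴴ) * P * h := by
          simp only [Matrix.mul_assoc]
      _ = _ := by rw [unitary_mul_conjTranspose, Matrix.mul_one, Matrix.mul_assoc _ P P, hPP]

/-- The span condition gives hΨh* = isP with s real, and the trace gives isq = 2ia. -/
theorem eq_holonomyGenerator {P Ψ : Matrix (Fin n) (Fin n) ℂ} {q : ℕ} (hq : q ≠ 0)
    (hPP : P * P = P) (hP : Matrix.trace P = q) {l a : ℝ} {h : Matrix.unitaryGroup (Fin n) ℂ}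
    {chat : ℝ → Total n m} (hX : Xᴴ * X = (l : ℂ) • P) (hΨ : IsHolonomyExponent X h chat a Ψ) :
    Ψ = holonomyGenerator q a P h := by
  have hq' : (q : ℂ) ≠ 0 := by exact_mod_cast hq
  have hspan := hΨ.span
  rw [hX] at hspan
  obtain ⟨s, hs⟩ := exists_smul_of_mem_span hPP l hspan
  have htr := congrArg Matrix.trace hs
  rw [Matrix.trace_mul_cycle, unitary_conjTranspose_mul, Matrix.one_mul, hΨ.trace_eq,
    Matrix.trace_smul, hP, smul_eq_mul] at htr
  have hs' : Complex.I * s = 2 * Complex.I / q * a := by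
    rw [div_mul_eq_mul_div, eq_div_iff hq']
    linear_combination -htr
  rw [holonomyGenerator, ← Matrix.smul_mul, ← Matrix.mul_smul, ← hs', ← hs]
  simp only [← Matrix.mul_assoc]
  rw [unitary_conjTranspose_mul, Matrix.one_mul, Matrix.mul_assoc, unitary_conjTranspose_mul,
    Matrix.mul_one]

end Exponent

end

end Holonomy

/-! ### The theorem -/

open Holonomy in
theorem corollary1 (n m q : ℕ) (X : Matrix (Fin m) (Fin n) ℂ) (g : Holonomy.U n m)
    (hX : Holonomy.HasSinglePositiveEigenvalue (Xᴴ * X) q)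
    (c : ℝ → Holonomy.D n m) (z : ℝ → ℂ) (hc : Holonomy.IsSimpleClosedCurve X g c z)
    (chat : ℝ → Holonomy.Total n m) (hchat : Holonomy.IsHorizontalLift chat c) :
    Holonomy.relatedArea X g z = Holonomy.inducedArea X g z ∧
    (∃ h : Matrix.unitaryGroup (Fin n) ℂ, Holonomy.LiesOver X g h (chat 0)) ∧
    (∀ h : Matrix.unitaryGroup (Fin n) ℂ, Holonomy.LiesOver X g h (chat 0) →
      (∃ Ψ : Matrix (Fin n) (Fin n) ℂ,
        Holonomy.IsHolonomyExponent X h chat (Holonomy.relatedArea X g z) Ψ) ∧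
      ∀ Ψ : Matrix (Fin n) (Fin n) ℂ,
        Holonomy.IsHolonomyExponent X h chat (Holonomy.relatedArea X g z) Ψ →
        (∃ A : Matrix.unitaryGroup (Fin n) ℂ,
          Ψ = Holonomy.diagConj q (Holonomy.relatedArea X g z) A ∧
          Ψ = Holonomy.diagConj q (Holonomy.inducedArea X g z) A) ∧
        (q = n → ∃ θ : ℝ, θ = 2 / n * Holonomy.relatedArea X g z ∧
          θ = 2 / n * Holonomy.inducedArea X g z ∧
          NormedSpace.exp Ψ =
            Complex.exp (Complex.I * θ) • (1 : Matrix (Fin n) (Fin n) ℂ))) ∧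
    (q = n → X ∈ Holonomy.conformal m n ∧
      Holonomy.IsTotallyGeodesic (Holonomy.surface X g)) := by
  obtain ⟨hq0, hqn, l, V, A, hl, hXV, hV, hVA⟩ := exists_partialIsometry hX
  have hqR : (0 : ℝ) < q := by exact_mod_cast hq0
  have hqC : (q : ℂ) ≠ 0 := by exact_mod_cast hq0.ne'
  have htr : Matrix.trace (Vᴴ * V) = q := by
    rw [hVA, Matrix.trace_mul_cycle, unitary_conjTranspose_mul, Matrix.one_mul,
      trace_firstProj hqn]
  have hV0 : V ≠ 0 := by
    rintro rfl
    rw [Matrix.mul_zero, Matrix.trace_zero] at htr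
    exact hqC htr.symm
  have hPP : Vᴴ * V * (Vᴴ * V) = Vᴴ * V := by
    rw [Matrix.mul_assoc, ← Matrix.mul_assoc V, hV]
  have hXX : Xᴴ * X = (l : ℂ) • (Vᴴ * V) := by
    have hss : (Real.sqrt l : ℂ) * Real.sqrt l = l := by exact_mod_cast Real.mul_self_sqrt hl.le
    have hX' : X = (Real.sqrt l : ℂ) • V := hXV
    rw [hX', Matrix.conjTranspose_smul, Matrix.smul_mul, Matrix.mul_smul, smul_smul,
      Complex.star_def, Complex.conj_ofReal, hss]
  -- |hat X|² = Tr X*X = lq, so normalizing X = √l V leaves κ = 1/√q.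
  obtain ⟨κ, hκ, hW, hκq⟩ : ∃ κ : ℝ, 0 < κ ∧ unitize X = κ • V ∧ κ ^ 2 * q = 1 := by
    refine ⟨(Real.sqrt q)⁻¹, by positivity, ?_, ?_⟩
    · have hip : ip (hat X) (hat X) = l * q := by
        have hX' : X = (Real.sqrt l : ℂ) • V := hXV
        rw [hX', ip_hat_hat, htr, Complex.conj_ofReal, ← Complex.ofReal_mul,
          Real.mul_self_sqrt hl.le, Complex.ofReal_re, Complex.natCast_re]
      have hsl := (Real.sqrt_pos.2 hl).ne'
      rw [unitize, hip, Real.sqrt_mul hl.le, mul_inv]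
      conv_lhs => rw [hXV]
      rw [smul_smul]
      congr 1
      field_simp
    · rw [inv_pow, Real.sq_sqrt hqR.le, inv_mul_cancel₀ hqR.ne']
  have hτ : κ ^ 2 * (Matrix.trace (Vᴴ * V)).re = 1 := by rw [htr]; simpa using hκq
  have harea : relatedArea X g z = inducedArea X g z := by
    rw [relatedArea_eq hV hκ hW hτ, inducedArea_eq hV hκ hW hτ]
  have hinj := surfacePoint_injective hV hV0 hκ.ne' hW g
  -- The curve is closed in D; injectivity of the coordinate closes it in the plane.
  have hzcl : z 0 = z 1 := by
    apply hinj
    rw [← hc.coord_eq 0 (by simp), ← hc.coord_eq 1 (by simp), hc.closed]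
  obtain ⟨hproj, cbar, hcbar, hlift⟩ := hchat
  have hex : ∀ t ∈ Set.Icc (0 : ℝ) 1, ∃ p, cbar t = surfaceLift X g (z t) * blockHom n m p := by
    intro t ht
    apply exists_eq_mul_blockHom
    change surfacePoint X g (z t) = bundleProj (projTotal (cbar t))
    rw [(hlift t ht).1, hproj t ht, hc.coord_eq t ht]
  -- The lift and the standard lift of the coordinate curve lie over the same points, so they differ
  -- by block diagonal unitaries.
  choose! p hp using hex
  have hhol := holonomy_eq hV hW hc.smooth hcbar hp fun t ht => (hlift t ht).2
  rw [integral_connectionCoeff hc.smooth hzcl hc.oriented hκ,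
    ← relatedArea_eq hV hκ hW hτ g z] at hhol
  -- 2κ² = 2/q.
  have hphase : Complex.I * ((2 * κ ^ 2 * relatedArea X g z : ℝ) : ℂ) =
      2 * Complex.I / q * relatedArea X g z := by
    have : (κ : ℂ) ^ 2 * q = 1 := by exact_mod_cast hκq
    push_cast
    field_simp
    linear_combination (relatedArea X g z : ℂ) * this
  rw [hphase] at hhol
  have h0 : chat 0 = projTotal (surfaceLift X g (z 0) * blockHom n m (p 0)) := by
    rw [← hp 0 (by simp), (hlift 0 (by simp)).1]
  have h1 : chat 1 = projTotal (surfaceLift X g (z 0) * blockHom n m (p 1)) := by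
    rw [hzcl, ← hp 1 (by simp), (hlift 1 (by simp)).1]
  refine ⟨harea, ⟨(p 0).1, z 0, ?_⟩, fun h hh => ⟨⟨holonomyGenerator q (relatedArea X g z)
    (Vᴴ * V) h, ?_, ?_, trace_holonomyGenerator hq0.ne' _ htr h⟩, fun Ψ hΨ => ?_⟩, fun hqn' => ?_⟩
  · rw [h0, rightAct_projTotal]
    exact (projTotal_mul_blockHom_eq_iff _ _ _ _ _).2 rfl
  · rw [conj_holonomyGenerator]
    have hX0 : X ≠ 0 := by
      rintro rfl
      exact hV0 ((smul_eq_zero_iff_right (Real.sqrt_pos.2 hl).ne').1 hXV.symm)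
    have hmem : Complex.I • (Xᴴ * X) ^ 1 ∈ Submodule.span ℝ
        ((fun k : ℕ => Complex.I • (Xᴴ * X) ^ k) '' Set.Icc 1 X.rank) :=
      Submodule.subset_span ⟨1, ⟨le_rfl, rank_pos_of_ne_zero hX0⟩, rfl⟩
    -- The power k = 1 is enough: X*X = lP, so the coefficient is divided by l.
    convert Submodule.smul_mem _ (2 / q * relatedArea X g z / l) hmem using 1
    have hlC : (l : ℂ) ≠ 0 := by exact_mod_cast hl.ne'
    rw [pow_one, hXX, ← Complex.coe_smul, smul_smul, smul_smul]
    congr 1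
    push_cast
    field_simp
  · obtain ⟨w, hw⟩ := hh
    -- The translate through the starting point lies over c(0), which fixes w and then h.
    have hwz : w = z 0 := by
      apply hinj
      rw [← hc.coord_eq 0 (by simp), ← hproj 0 (by simp), hw, rightAct_projTotal]
      exact (projD_mul_blockHom _ _).symm
    have hh0 : h = (p 0).1 := by
      rw [hwz, h0, rightAct_projTotal] at hw
      exact ((projTotal_mul_blockHom_eq_iff _ _ _ _ _).1 hw).symm
    -- With h equal to the value of the U(n)-factor at 0, the displacement is the quotient of its
    -- end values, and `hhol` identifies it with e^Ψ.
    refine ⟨h⁻¹ * (p 1).1, ?_, ?_⟩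
    · rw [exp_holonomyGenerator _ _ hPP, hh0, ← hhol]
      rfl
    · rw [h1, h0, hh0]
      refine Eq.trans ?_ (rightAct_projTotal_blockHom _ (p 0).1 _ (p 0).2).symm
      exact (projTotal_mul_blockHom_eq_iff _ _ _ _ _).2 (mul_inv_cancel_left _ _).symm
  · have hΨ' := eq_holonomyGenerator hq0.ne' hPP htr hXX hΨ
    -- A diagonalizes P, so h*A diagonalizes h*Ph.
    have hdiag : Ψ = diagConj q (relatedArea X g z) (h⁻¹ * A) := by
      rw [hΨ', diagConj_eq_smul, holonomyGenerator, hVA]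
      congr 1
      change _ = (h : Matrix (Fin n) (Fin n) ℂ)ᴴ * (A : Matrix (Fin n) (Fin n) ℂ) * _ *
        ((h : Matrix (Fin n) (Fin n) ℂ)ᴴ * (A : Matrix (Fin n) (Fin n) ℂ))ᴴ
      rw [Matrix.conjTranspose_mul, Matrix.conjTranspose_conjTranspose]
      simp only [Matrix.mul_assoc]
    refine ⟨⟨h⁻¹ * A, hdiag, by rw [← harea]; exact hdiag⟩, fun hqn' => ?_⟩
    refine ⟨_, rfl, by rw [harea], ?_⟩
    subst hqn'
    have hP1 : Vᴴ * V = 1 := by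
      rw [hVA, firstProj_self, Matrix.mul_one, unitary_mul_conjTranspose]
    have hone (e : ℂ) : 1 + (e - 1) • (1 : Matrix (Fin q) (Fin q) ℂ) = e • 1 := by module
    rw [hΨ', exp_holonomyGenerator _ _ hPP, hP1, hone, Matrix.smul_mul, Matrix.one_mul,
      Matrix.mul_smul, unitary_conjTranspose_mul]
    congr 2
    push_cast
    ring
  · subst hqn'
    have hP1 : Vᴴ * V = 1 := by
      rw [hVA, firstProj_self, Matrix.mul_one, unitary_mul_conjTranspose]
    refine ⟨⟨l, by exact_mod_cast hl.ne', by rw [hXX, hP1]⟩, ?_⟩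
    exact isTotallyGeodesic_surface hV hV0 hκ.ne' hW (by rw [htr]; exact hqC) g
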